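/- Let $\mathbb K$ be a field of characteristic $0$. A disk is an open subset of $\mathbb R^2$ diffeomorphic to $\mathbb R^2$. A prefactorization algebra $\mathfrak F$ on $\mathbb R^2$ assigns to each disk $D$ a cochain complex $\mathfrak F(D)$ over $\mathbb K$ and to each tuple $\underline D=(D_1,\dots,D_n)$, $n\ge 0$, of mutually disjoint disks contained in a disk $D$ a cochain map $\mathfrak F(\iota_{\underline D}^D):\bigotimes_i\mathfrak F(D_i)\to\mathfrak F(D)$, compatibly with compositions, identities and (with Koszul signs) permutations. Assume that $\mathfrak F$ is locally constant, i.e. $\mathfrak F(\iota_D^{D'})$ is a quasi-isomorphism for all disks $D\subseteq D'$. For each disk $D$ choose a strong deformation retract $i_D:\mathsf H\mathfrak F(D)\to\mathfrak F(D)$, $p_D:\mathfrak F(D)\to\mathsf H\mathfrak F(D)$, $h_D\in[\mathfrak F(D),\mathfrak F(D)]^{-1}$ to the cohomology (with zero differential), so that $i_D,p_D$ are cochain maps, $p_Di_D=\mathrm{id}$, $\mathrm d h_D+h_D\mathrm d=i_Dp_D-\mathrm{id}$, $h_Di_D=0$, $p_Dh_D=0$, $h_D^2=0$. Write $A:=\mathsf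 H\mathfrak F(\mathbb R^2)$ and $q_D:=p_{\mathbb R^2}\,\mathfrak F(\iota_D^{\mathbb R^2})\,i_D:\mathsf H\mathfrak F(D)\to A$, which is an isomorphism. Put $$\widetilde i_D:=i_Dq_D^{-1},\qquad \widetilde p_D:=p_{\mathbb R^2}\mathfrak F(\iota_D^{\mathbb R^2}),\qquad \widetilde h_D:=h_D-i_D\,q_D^{-1}\,p_{\mathbb R^2}\,\mathfrak F(\iota_D^{\mathbb R^2})\,h_D .$$ For disjoint disks $D_1,D_2$ let $\mu_{(D_1,D_2)}:=p_{\mathbb R^2}\,\mathfrak F(\iota^{\mathbb R^2}_{(D_1,D_2)})(\widetilde i_{D_1}\otimes\widetilde i_{D_2}):A\otimes A\to A$, let $1:=p_{\mathbb R^2}\mathfrak F(\iota_\varnothing^{\mathbb R^2})\in A$, and for disks $A_1\subseteq U$, $B$ with $U\cap B=\varnothing$ and $U,B\subseteq D$ let $$\widetilde\beta^{(2)}\big(\iota_{(U,B)}^{D},\iota_{A_1}^{U}\big):=\widetilde p_D\,\mathfrak F(\iota_{(U,B)}^{D})\,\big(\widetilde h_U\,\mathfrak F(\iota_{A_1}^{U})\,\widetilde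 i_{A_1}\otimes\widetilde i_B\big):A\otimes A\to A ,$$ the first-order Massey cocycle. An annular configuration consists of disks $D_1,D_2,D_u,D_d,\widetilde D\subseteq D$ with $D_1\cap D_2=\varnothing$, $D_1\cup D_2\subseteq D_u\cap D_d$, $D_u\cap\widetilde D=D_d\cap\widetilde D=\varnothing$, such that $D_u\cup D_d$ is homeomorphic to an open annulus and some loop which runs from a point of $D_1$ inside $D_u$ to a point of $D_2$ and back inside $D_d$ winds once clockwise around a point of $\widetilde D$. To it assign the degree $-1$ map $$L:=\widetilde\beta^{(2)}\big(\iota_{(D_u,\widetilde D)}^{D},\iota_{D_1}^{D_u}\big)-\widetilde\beta^{(2)}\big(\iota_{(D_u,\widetilde D)}^{D},\iota_{D_2}^{D_u}\big)+\widetilde\beta^{(2)}\big(\iota_{(D_d,\widetilde D)}^{D},\iota_{D_2}^{D_d}\big)-\widetilde\beta^{(2)}\big(\iota_{(D_d,\widetilde D)}^{D},\iota_{D_1}^{D_d}\big):A\otimes A\to A .$$ **Theorem.** The product $\mu_2:=\mu_{(D_1,D_2)}$ does not depend on the disjoint disks $D_1,D_2$, and $L$ does not depend on the annular configuration. For retracts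 such that every $i_D(x)$ represents the class $x$, $L$ does not depend on the choice of retracts either. The graded vector space $A$ with $\mu_2$ and $1$ is an associative, unital and graded commutative algebra, and $L$ is a Poisson bracket of degree $-1$ on it (a $\mathbb P_2$-algebra structure). That is, with $\tau$ the symmetric braiding (Koszul signs), 1. $L\,\tau=L$; 2. $L(\mathrm{id}\otimes\mu_2)=\mu_2(L\otimes\mathrm{id})+\mu_2(\mathrm{id}\otimes L)(\tau\otimes\mathrm{id})$; 3. $L(\mathrm{id}\otimes L)+L(\mathrm{id}\otimes L)\tau_{(123)}+L(\mathrm{id}\otimes L)\tau_{(132)}=0$. -/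

import Mathlib

open scoped ContDiff

universe u v

namespace Prefact

/-! ### Cochain complexes -/

/-- A cochain complex of `K`-vector spaces, given by its total space `⨁ᵢ Vⁱ`: a vector space that is
the internal direct sum of the subspaces `gr i` of elements of degree `i`, and a differential of
degree `+1`. In this form a map of degree `0` from a tensor product of complexes is a multilinear
map on the total spaces that adds up degrees. -/
structure DGSpace (K : Type u) [Field K] where
  carrier : Type v
  [addCommGroup : AddCommGroup carrier]
  [module : Module K carrier]
  gr : ℤ → Submodule K carrier
  isInternal : DirectSum.IsInternal gr
  d : carrier →ₗ[K] carrier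
  d_mem : ∀ {i : ℤ} {x : carrier}, x ∈ gr i → d x ∈ gr (i + 1)
  d_d : ∀ x : carrier, d (d x) = 0

attribute [instance] DGSpace.addCommGroup DGSpace.module

namespace DGSpace

variable {K : Type u} [Field K]

instance : CoeSort (DGSpace.{u, v} K) (Type v) := ⟨DGSpace.carrier⟩

variable (V : DGSpace.{u, v} K)

/-- The cocycles. -/
abbrev cocycles : Submodule K V := LinearMap.ker V.d

/-- The cohomology, as a vector space: cocycles modulo coboundaries. -/
abbrev Coh : Type v := V.cocycles ⧸ (LinearMap.range V.d).submoduleOf V.cocycles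

/-- The class of a cocycle. -/
abbrev cls : V.cocycles →ₗ[K] V.Coh := Submodule.mkQ _

/-- The classes of the cocycles of degree `i`. -/
def cohGr (i : ℤ) : Submodule K V.Coh := ((V.gr i).submoduleOf V.cocycles).map V.cls

theorem hom_ext {W : Type*} [AddCommGroup W] [Module K W] {f g : V →ₗ[K] W}
    (h : ∀ (i : ℤ), ∀ x ∈ V.gr i, f x = g x) : f = g := by
  ext x
  have hx : x ∈ ⨆ i, V.gr i := by
    rw [V.isInternal.submodule_iSup_eq_top]; trivial
  induction hx using Submodule.iSup_induction' with
  | mem i x hx => exact h i x hx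
  | zero => simp
  | add x y _ _ hx hy => simp [hx, hy]

theorem bijective_coe : Function.Bijective (DirectSum.coeLinearMap V.gr) := V.isInternal

/-- The projection to the component of degree `i`. -/
noncomputable def proj (i : ℤ) : V →ₗ[K] V :=
  (V.gr i).subtype ∘ₗ DirectSum.component K ℤ (fun i => V.gr i) i ∘ₗ
    (LinearEquiv.ofBijective (DirectSum.coeLinearMap V.gr) V.bijective_coe).symm.toLinearMap

theorem proj_mem (i : ℤ) (x : V) : V.proj i x ∈ V.gr i := by
  simp [proj]

theorem proj_of_mem {i j : ℤ} {x : V} (hx : x ∈ V.gr j) :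
    V.proj i x = if j = i then x else 0 := by
  have h : (LinearEquiv.ofBijective (DirectSum.coeLinearMap V.gr) V.bijective_coe).symm x =
      DirectSum.lof K ℤ (fun i => V.gr i) j ⟨x, hx⟩ := by
    rw [LinearEquiv.symm_apply_eq]
    simp
  simp only [proj, LinearMap.comp_apply, LinearEquiv.coe_coe, h]
  split_ifs with hij
  · subst hij
    simp
  · simp [DirectSum.component.of, hij]

theorem d_proj (i : ℤ) (x : V) : V.d (V.proj i x) = V.proj (i + 1) (V.d x) := by
  have : V.d ∘ₗ V.proj i = V.proj (i + 1) ∘ₗ V.d := by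
    refine V.hom_ext fun j x hx => ?_
    simp only [LinearMap.comp_apply, V.proj_of_mem hx, V.proj_of_mem (V.d_mem hx)]
    by_cases h : j = i <;> simp [h]
  exact LinearMap.congr_fun this x

/-- The projection of the cohomology to degree `i`. -/
noncomputable def cohProj (i : ℤ) : V.Coh →ₗ[K] V.Coh :=
  Submodule.mapQ _ _
    ((V.proj i).restrict (p := V.cocycles) (q := V.cocycles) fun x hx => by
      rw [LinearMap.mem_ker] at hx ⊢
      rw [d_proj, hx, map_zero])
    (by
      rintro ⟨x, hx⟩ ⟨y, hy⟩
      refine ⟨V.proj (i - 1) y, ?_⟩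
      rw [d_proj, hy, sub_add_cancel]
      rfl)

theorem cohProj_of_mem {i j : ℤ} {x : V.Coh} (hx : x ∈ V.cohGr j) :
    V.cohProj i x = if j = i then x else 0 := by
  obtain ⟨⟨z, hz⟩, hzj, rfl⟩ := hx
  have hzj' : z ∈ V.gr j := hzj
  have : V.cohProj i (V.cls ⟨z, hz⟩) = V.cls ⟨V.proj i z, by
      rw [LinearMap.mem_ker] at hz ⊢
      rw [d_proj, hz, map_zero]⟩ := rfl
  rw [this]
  split_ifs with h
  · congr 1
    ext
    simp [V.proj_of_mem hzj', h]
  · rw [← map_zero V.cls]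
    congr 1
    ext
    simp [V.proj_of_mem hzj', h]

theorem mem_iSup_cohGr (x : V.Coh) : x ∈ ⨆ i, V.cohGr i := by
  classical
  obtain ⟨⟨z, hz⟩, rfl⟩ := Submodule.mkQ_surjective _ x
  set c := (LinearEquiv.ofBijective (DirectSum.coeLinearMap V.gr) V.bijective_coe).symm z with hc
  have hker : ∀ i, V.proj i z ∈ V.cocycles := fun i => by
    rw [LinearMap.mem_ker] at hz ⊢
    rw [d_proj, hz, map_zero]
  have hsum : z = ∑ i ∈ c.support, V.proj i z := by
    have h1 : DirectSum.coeLinearMap V.gr c = z := by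
      rw [hc]
      exact LinearEquiv.apply_symm_apply
        (LinearEquiv.ofBijective (DirectSum.coeLinearMap V.gr) V.bijective_coe) z
    rw [DirectSum.coeLinearMap_eq_dfinsuppSum, DFinsupp.sum] at h1
    exact h1.symm
  have h2 : (⟨z, hz⟩ : V.cocycles) = ∑ i ∈ c.support, ⟨V.proj i z, hker i⟩ := by
    ext
    rw [AddSubmonoidClass.coe_finsetSum]
    exact hsum
  rw [h2, map_sum]
  exact Submodule.sum_mem _ fun i _ => Submodule.mem_iSup_of_mem i ⟨_, V.proj_mem i z, rfl⟩

theorem cohGr_isInternal : DirectSum.IsInternal V.cohGr := by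
  classical
  rw [DirectSum.isInternal_submodule_iff_iSupIndep_and_iSup_eq_top]
  refine ⟨?_, eq_top_iff.2 fun x _ => V.mem_iSup_cohGr x⟩
  rw [iSupIndep_def]
  intro i
  rw [Submodule.disjoint_def]
  intro x hx hx'
  have h1 : V.cohProj i x = x := by rw [V.cohProj_of_mem hx, if_pos rfl]
  have h2 : (⨆ j, ⨆ (_ : j ≠ i), V.cohGr j) ≤ LinearMap.ker (V.cohProj i) := by
    refine iSup_le fun j => iSup_le fun hj => fun y hy => ?_
    rw [LinearMap.mem_ker, V.cohProj_of_mem hy, if_neg hj]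
  rw [← h1]
  exact h2 hx'

/-- The cohomology of a cochain complex, as a cochain complex with trivial differential. -/
abbrev H : DGSpace.{u, v} K where
  carrier := V.Coh
  gr := V.cohGr
  isInternal := V.cohGr_isInternal
  d := 0
  d_mem := fun _ => by simp
  d_d := fun _ => rfl

/-- The map in cohomology that is induced by a map commuting with the differentials. -/
def cohMap {V W : DGSpace.{u, v} K} (f : V →ₗ[K] W) (hf : ∀ x, f (V.d x) = W.d (f x)) :
    V.Coh →ₗ[K] W.Coh :=
  Submodule.mapQ _ _
    (f.restrict (p := V.cocycles) (q := W.cocycles) fun x hx => by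
      rw [LinearMap.mem_ker] at hx ⊢
      rw [← hf, hx, map_zero])
    (by
      rintro ⟨x, hx⟩ ⟨y, hy⟩
      exact ⟨f y, by rw [← hf, hy]; rfl⟩)

end DGSpace

/-- A strong deformation retract of a cochain complex `V` to its cohomology: cochain maps
`i : H V → V` and `p : V → H V` and a homotopy `h` of degree `-1` with `p i = id`,
`d h + h d = i p - id`, `h i = 0`, `p h = 0` and `h h = 0`. -/
structure DGSpace.Retract {K : Type u} [Field K] (V : DGSpace.{u, v} K) where
  i : V.H →ₗ[K] V
  p : V →ₗ[K] V.H
  h : V →ₗ[K] V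
  i_mem : ∀ {k : ℤ} {x : V.H}, x ∈ V.H.gr k → i x ∈ V.gr k
  p_mem : ∀ {k : ℤ} {x : V}, x ∈ V.gr k → p x ∈ V.H.gr k
  h_mem : ∀ {k : ℤ} {x : V}, x ∈ V.gr k → h x ∈ V.gr (k - 1)
  d_i : ∀ x : V.H, V.d (i x) = 0
  p_d : ∀ x : V, p (V.d x) = 0
  p_i : ∀ x : V.H, p (i x) = x
  d_h : ∀ x : V, V.d (h x) + h (V.d x) = i (p x) - x
  h_i : ∀ x : V.H, h (i x) = 0
  p_h : ∀ x : V, p (h x) = 0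
  h_h : ∀ x : V, h (h x) = 0

namespace DGSpace.Retract

variable {K : Type u} [Field K] {V : DGSpace.{u, v} K} (R : V.Retract)

/-- The map that `i` induces on cohomology. -/
def cohI : V.H →ₗ[K] V.Coh := V.cls ∘ₗ R.i.codRestrict V.cocycles R.d_i

/-- The retract identifies the cohomology of `V` with `H V` by the identity: `i x` is a
representative of the class `x`. -/
def IsNormalized : Prop := ∀ x : V.H, R.cohI x = x

theorem cohI_bijective : Function.Bijective R.cohI := by
  constructor
  · rw [injective_iff_map_eq_zero]
    intro x hx
    obtain ⟨y, hy⟩ := (Submodule.Quotient.mk_eq_zero _).1 hx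
    have hy' : V.d y = R.i x := hy
    rw [← R.p_i x, ← hy', R.p_d]
  · intro c
    obtain ⟨⟨z, hz⟩, rfl⟩ := Submodule.mkQ_surjective _ c
    refine ⟨R.p z, ?_⟩
    refine (Submodule.Quotient.eq _).2 ⟨R.h z, ?_⟩
    have h1 := R.d_h z
    rw [LinearMap.mem_ker.1 hz, map_zero, add_zero] at h1
    exact h1

end DGSpace.Retract

/-! ### Disks in the plane -/

/-- The Cartesian space `ℝ²`. -/
abbrev Plane : Type := EuclideanSpace ℝ (Fin 2)

/-- A subset of `ℝ²` is a disk if it is open and diffeomorphic to `ℝ²`. -/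
def IsDisk (U : Set Plane) : Prop :=
  ∃ e : OpenPartialHomeomorph Plane Plane,
    e.source = U ∧ e.target = Set.univ ∧ ContDiffOn ℝ ∞ e U ∧ ContDiff ℝ ∞ e.symm

/-- The set of disks in `ℝ²`. -/
structure Disk where
  carrier : Set Plane
  isDisk : IsDisk carrier

instance : Coe Disk (Set Plane) := ⟨Disk.carrier⟩

/-- `ℝ²` as a disk in itself. -/
def Disk.whole : Disk where
  carrier := Set.univ
  isDisk := ⟨OpenPartialHomeomorph.refl Plane, rfl, rfl, contDiffOn_id, contDiff_id⟩

/-- The tuple `(D₁, …, Dₙ)` consists of mutually disjoint disks that are contained in `T`. -/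
def Disk.Fits {n : ℕ} (D : Fin n → Disk) (T : Disk) : Prop :=
  (∀ i, (D i : Set Plane) ⊆ T) ∧ ∀ i j, i ≠ j → Disjoint (D i : Set Plane) (D j)

/-- An element of the family indexed by disks, as a family over `Fin 1`. -/
def single {X : Disk → Type v} {A : Disk} (x : X A) : ∀ k : Fin 1, X (![A] k) :=
  Fin.cons (α := fun k : Fin 1 => X (![A] k)) x finZeroElim

/-- The pair of two elements of a family indexed by disks, as a family over `Fin 2`. -/
def pair {X : Disk → Type v} {A B : Disk} (x : X A) (y : X B) : ∀ k : Fin 2, X (![A, B] k) :=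
  Fin.cons (α := fun k : Fin 2 => X (![A, B] k)) x
    (Fin.cons (α := fun k : Fin 1 => X (![B] k)) y finZeroElim)

theorem Disk.fits_one {A T : Disk} (h : (A : Set Plane) ⊆ T) : Disk.Fits ![A] T :=
  ⟨fun _ => by simpa using h, fun i j hij => absurd (Subsingleton.elim i j) hij⟩

theorem Disk.fits_two {A B T : Disk} (hA : (A : Set Plane) ⊆ T) (hB : (B : Set Plane) ⊆ T)
    (h : Disjoint (A : Set Plane) B) : Disk.Fits ![A, B] T := by
  refine ⟨fun i => ?_, fun i j hij => ?_⟩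
  · fin_cases i
    · exact hA
    · exact hB
  · fin_cases i <;> fin_cases j
    · exact absurd rfl hij
    · exact h
    · exact h.symm
    · exact absurd rfl hij

/-! ### Prefactorization algebras -/

/-- The Koszul sign of the permutation `x₁ ⊗ ⋯ ⊗ xₙ ↦ ± x_{σ(1)} ⊗ ⋯ ⊗ x_{σ(n)}` of homogeneous
elements of degrees `k₁, …, kₙ`. -/
def koszulSign {n : ℕ} (σ : Equiv.Perm (Fin n)) (k : Fin n → ℤ) : ℤˣ :=
  ∏ i, ∏ j, if i < j ∧ σ j < σ i then (k (σ i) * k (σ j)).negOnePow else 1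

/-- A prefactorization algebra on `ℝ²`: a cochain complex for each disk, and for each tuple of
mutually disjoint disks `D₁, …, Dₙ ⊆ T` a cochain map `⨂ᵢ F(Dᵢ) → F(T)`, compatibly with
compositions, identities and permutations. -/
structure PFA (K : Type u) [Field K] where
  obj : Disk → DGSpace.{u, v} K
  op : ∀ {n : ℕ} (D : Fin n → Disk) (T : Disk), Disk.Fits D T →
    MultilinearMap K (fun i => obj (D i)) (obj T)
  /-- The structure maps have degree `0`. -/
  op_mem : ∀ {n : ℕ} (D : Fin n → Disk) (T : Disk) (h : Disk.Fits D T) (k : Fin n → ℤ)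
    (x : ∀ i, obj (D i)), (∀ i, x i ∈ (obj (D i)).gr (k i)) →
      op D T h x ∈ (obj T).gr (∑ i, k i)
  /-- The structure maps commute with the differentials. -/
  op_d : ∀ {n : ℕ} (D : Fin n → Disk) (T : Disk) (h : Disk.Fits D T) (k : Fin n → ℤ)
    (x : ∀ i, obj (D i)), (∀ i, x i ∈ (obj (D i)).gr (k i)) →
      (obj T).d (op D T h x) = ∑ i, (∑ j ∈ Finset.univ.filter (· < i), k j).negOnePow •
        op D T h (Function.update x i ((obj (D i)).d (x i)))
  /-- Preservation of compositions. The tuple of tuples `E` is concatenated by the lexicographic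
  bijection `finSigmaFinEquiv`. -/
  op_comp : ∀ {n : ℕ} (N : Fin n → ℕ) (E : ∀ i, Fin (N i) → Disk) (D : Fin n → Disk) (T : Disk)
    (hE : ∀ i, Disk.Fits (E i) (D i)) (hD : Disk.Fits D T)
    (h : Disk.Fits (fun l => E (finSigmaFinEquiv.symm l).1 (finSigmaFinEquiv.symm l).2) T)
    (x : ∀ i j, obj (E i j)),
      op D T hD (fun i => op (E i) (D i) (hE i) (x i)) =
        op (fun l => E (finSigmaFinEquiv.symm l).1 (finSigmaFinEquiv.symm l).2) T h
          (fun l => x (finSigmaFinEquiv.symm l).1 (finSigmaFinEquiv.symm l).2)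
  /-- Preservation of identities. -/
  op_id : ∀ (D : Disk) (h : Disk.Fits ![D] D) (x : ∀ i, obj (![D] i)), op ![D] D h x = x 0
  /-- Equivariance under permutations. -/
  op_perm : ∀ {n : ℕ} (D : Fin n → Disk) (T : Disk) (h : Disk.Fits D T) (σ : Equiv.Perm (Fin n))
    (hσ : Disk.Fits (fun i => D (σ i)) T) (k : Fin n → ℤ) (x : ∀ i, obj (D i)),
      (∀ i, x i ∈ (obj (D i)).gr (k i)) →
      op D T h x = koszulSign σ k • op (fun i => D (σ i)) T hσ (fun i => x (σ i))

namespace PFA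

variable {K : Type u} [Field K] (F : PFA.{u, v} K)

/-- The structure map `F(A) → F(T)` of an inclusion `A ⊆ T`. -/
def incl (A T : Disk) (h : (A : Set Plane) ⊆ T) : F.obj A →ₗ[K] F.obj T where
  toFun x := F.op ![A] T (Disk.fits_one h) (single (X := fun D => F.obj D) x)
  map_add' x y := MultilinearMap.cons_add (F.op ![A] T (Disk.fits_one h)) _ x y
  map_smul' c x := MultilinearMap.cons_smul (F.op ![A] T (Disk.fits_one h)) _ c x

/-- The structure map `F(A) ⊗ F(B) → F(T)` of two disjoint disks in `T`. -/
def op₂ (A B T : Disk) (h : Disk.Fits ![A, B] T) : F.obj A →ₗ[K] F.obj B →ₗ[K] F.obj T :=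
  LinearMap.mk₂ K (fun x y => F.op ![A, B] T h (pair (X := fun D => F.obj D) x y))
    (fun x x' _ => MultilinearMap.cons_add (F.op ![A, B] T h) _ x x')
    (fun c x _ => MultilinearMap.cons_smul (F.op ![A, B] T h) _ c x)
    (fun x y y' => MultilinearMap.cons_add ((F.op ![A, B] T h).curryLeft x) _ y y')
    (fun c x y => MultilinearMap.cons_smul ((F.op ![A, B] T h).curryLeft x) _ c y)

theorem incl_d (A T : Disk) (h : (A : Set Plane) ⊆ T) (x : F.obj A) :
    F.incl A T h ((F.obj A).d x) = (F.obj T).d (F.incl A T h x) := by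
  have key : F.incl A T h ∘ₗ (F.obj A).d = (F.obj T).d ∘ₗ F.incl A T h := by
    refine (F.obj A).hom_ext fun k x hx => ?_
    have h1 := F.op_d ![A] T (Disk.fits_one h) (fun _ => k)
      (single (X := fun D => F.obj D) x) (fun j => by
        obtain rfl : j = 0 := Subsingleton.elim _ _
        exact hx)
    refine Eq.trans ?_ h1.symm
    rw [Fin.sum_univ_one]
    have h2 : (∑ j ∈ Finset.univ.filter (· < (0 : Fin 1)), k).negOnePow = 1 := by simp
    rw [h2, one_smul]
    change F.op ![A] T _ _ = _
    congr 1
    funext j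
    obtain rfl : j = 0 := Subsingleton.elim _ _
    rw [Function.update_self]
    rfl
  exact LinearMap.congr_fun key x

/-- A prefactorization algebra is locally constant if it sends each inclusion of disks to a
quasi-isomorphism. -/
def IsLocallyConstant : Prop :=
  ∀ (A T : Disk) (h : (A : Set Plane) ⊆ T),
    Function.Bijective (DGSpace.cohMap (F.incl A T h) (F.incl_d A T h))

/-- The cohomology `H F(ℝ²)`. -/
abbrev HR : DGSpace.{u, v} K := (F.obj Disk.whole).H

/-- A choice of a strong deformation retract of `F(D)` to its cohomology, for each disk `D`. -/
abbrev Retracts : Type v := ∀ D : Disk, (F.obj D).Retract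

variable {F} (S : F.Retracts)

/-- The structure map `H F(A) → H F(T)` of an inclusion in the transferred prefactorization
algebra `H F`. -/
def hIncl (A T : Disk) (h : (A : Set Plane) ⊆ T) : (F.obj A).H →ₗ[K] (F.obj T).H :=
  (S T).p ∘ₗ F.incl A T h ∘ₗ (S A).i

theorem hIncl_bijective (hF : F.IsLocallyConstant) (A T : Disk) (h : (A : Set Plane) ⊆ T) :
    Function.Bijective (hIncl S A T h) := by
  have hcomm : ∀ x, (S T).cohI (hIncl S A T h x) =
      DGSpace.cohMap (F.incl A T h) (F.incl_d A T h) ((S A).cohI x) := by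
    intro x
    refine (Submodule.Quotient.eq _).2 ⟨(S T).h (F.incl A T h ((S A).i x)), ?_⟩
    have h1 := (S T).d_h (F.incl A T h ((S A).i x))
    rw [← F.incl_d, (S A).d_i, map_zero, map_zero, add_zero] at h1
    exact h1
  have hb : Function.Bijective ((S T).cohI ∘ hIncl S A T h) := by
    have : (S T).cohI ∘ hIncl S A T h =
        DGSpace.cohMap (F.incl A T h) (F.incl_d A T h) ∘ (S A).cohI := funext hcomm
    rw [this]
    exact (hF A T h).comp (S A).cohI_bijective
  exact (Function.Bijective.of_comp_iff' (S T).cohI_bijective _).1 hb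

/-- The canonical identification `H F(D) ≅ H F(ℝ²)`. -/
noncomputable def toWhole (hF : F.IsLocallyConstant) (D : Disk) : (F.obj D).H ≃ₗ[K] F.HR :=
  LinearEquiv.ofBijective (hIncl S D Disk.whole (Set.subset_univ _))
    (hIncl_bijective S hF D Disk.whole (Set.subset_univ _))

/-! The improved strong deformation retract of `F` to the constant object `H F(ℝ²)`. -/

/-- `ĩ_D = i_D H F(ι_D)⁻¹`, where `ι_D` is the inclusion of `D` in `ℝ²`. -/
noncomputable def iT (hF : F.IsLocallyConstant) (D : Disk) : F.HR →ₗ[K] F.obj D :=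
  (S D).i ∘ₗ (toWhole S hF D).symm.toLinearMap

/-- `p̃_D = p_{ℝ²} F(ι_D)`. -/
def pT (D : Disk) : F.obj D →ₗ[K] F.HR :=
  (S Disk.whole).p ∘ₗ F.incl D Disk.whole (Set.subset_univ _)

/-- `h̃_D = h_D - i_D H F(ι_D)⁻¹ p_{ℝ²} F(ι_D) h_D`. -/
noncomputable def hT (hF : F.IsLocallyConstant) (D : Disk) : F.obj D →ₗ[K] F.obj D :=
  (S D).h - (S D).i ∘ₗ (toWhole S hF D).symm.toLinearMap ∘ₗ (S Disk.whole).p ∘ₗ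
    F.incl D Disk.whole (Set.subset_univ _) ∘ₗ (S D).h

/-- The binary operation `μ_{(A, B)}` on `H F(ℝ²)` of two disjoint disks: the structure map
`p_{ℝ²} F(ι_{(A,B)}) (i_A ⊗ i_B) : H F(A) ⊗ H F(B) → H F(ℝ²)`, with `H F(A)` and `H F(B)` identified
with `H F(ℝ²)`. -/
noncomputable def mul (hF : F.IsLocallyConstant) (A B : Disk)
    (h : Disjoint (A : Set Plane) B) : F.HR →ₗ[K] F.HR →ₗ[K] F.HR :=
  ((((F.op₂ A B Disk.whole
    (Disk.fits_two (Set.subset_univ _) (Set.subset_univ _) h)).compl₁₂ (S A).i (S B).i).compr₂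
      (S Disk.whole).p).compl₁₂
        (toWhole S hF A).symm.toLinearMap (toWhole S hF B).symm.toLinearMap)

/-- The nullary operation `μ_∅ ∈ H F(ℝ²)`, i.e. `p_{ℝ²} F(ι_∅)`. -/
def one : F.HR :=
  (S Disk.whole).p (F.op ![] Disk.whole ⟨fun i => i.elim0, fun i => i.elim0⟩ finZeroElim)

/-- The value of the first-order Massey cocycle of the improved strong deformation retract on the
tree with two vertices: top vertex the inclusion `(U, B) → T`, and below its first leg the
inclusion `A → U`. It is `p̃_T F(ι_{(U,B)}) (h̃_U F(ι_A) ĩ_A ⊗ ĩ_B)`, an operation of degree `-1` in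
which the homotopy acts on the first tensor factor, so that no Koszul sign occurs. -/
noncomputable def massey (hF : F.IsLocallyConstant) (A U B T : Disk) (hA : (A : Set Plane) ⊆ U)
    (h : Disk.Fits ![U, B] T) : F.HR →ₗ[K] F.HR →ₗ[K] F.HR :=
  ((F.op₂ U B T h).compl₁₂ (hT S hF U ∘ₗ F.incl A U hA ∘ₗ iT S hF A) (iT S hF B)).compr₂ (pT S T)

end PFA

/-! ### The binary invariant -/

/-- The point of `ℝ²` with polar coordinates `(r, θ)` around `z`. -/
noncomputable def polarPoint (z : Plane) (r θ : ℝ) : Plane :=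
  z + !₂[r * Real.cos θ, r * Real.sin θ]

/-- A configuration of disks `D₁, D₂, D_u, D_d, D̃ ⊆ D` such that `D₁` and `D₂` are disjoint and lie in
both `D_u` and `D_d`, and `D_u ∪ D_d` is an annulus around `D̃`, which is disjoint from it. The
positions are specified by a loop that starts in `D₁`, runs inside `D_u` to `D₂`, returns inside
`D_d`, and winds once clockwise around a point of `D̃`. -/
structure AnnularConfiguration where
  D₁ : Disk
  D₂ : Disk
  Du : Disk
  Dd : Disk
  Dt : Disk
  D : Disk
  disjoint₁₂ : Disjoint (D₁ : Set Plane) D₂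
  sub₁u : (D₁ : Set Plane) ⊆ Du
  sub₂u : (D₂ : Set Plane) ⊆ Du
  sub₁d : (D₁ : Set Plane) ⊆ Dd
  sub₂d : (D₂ : Set Plane) ⊆ Dd
  disjoint_u : Disjoint (Du : Set Plane) Dt
  disjoint_d : Disjoint (Dd : Set Plane) Dt
  sub_u : (Du : Set Plane) ⊆ D
  sub_d : (Dd : Set Plane) ⊆ D
  sub_t : (Dt : Set Plane) ⊆ D
  annulus : Nonempty
    (↥((Du : Set Plane) ∪ (Dd : Set Plane)) ≃ₜ ↥{x : Plane | 1 < ‖x‖ ∧ ‖x‖ < 2})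
  clockwise : ∃ z ∈ (Dt : Set Plane), ∃ r θ : ℝ → ℝ, Continuous r ∧ Continuous θ ∧
    (∀ t, 0 < r t) ∧
    polarPoint z (r 0) (θ 0) ∈ (D₁ : Set Plane) ∧
    (∀ t ∈ Set.Icc (0 : ℝ) 1, polarPoint z (r t) (θ t) ∈ (Du : Set Plane)) ∧
    polarPoint z (r 1) (θ 1) ∈ (D₂ : Set Plane) ∧
    (∀ t ∈ Set.Icc (1 : ℝ) 2, polarPoint z (r t) (θ t) ∈ (Dd : Set Plane)) ∧
    r 2 = r 0 ∧ θ 2 = θ 0 - 2 * Real.pi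

/-- The operation `L` that is built from the first-order Massey cocycle on an annular
configuration of disks. -/
noncomputable def PFA.L {K : Type u} [Field K] {F : PFA.{u, v} K} (S : F.Retracts)
    (hF : F.IsLocallyConstant) (c : AnnularConfiguration) : F.HR →ₗ[K] F.HR →ₗ[K] F.HR :=
  PFA.massey S hF c.D₁ c.Du c.Dt c.D c.sub₁u (Disk.fits_two c.sub_u c.sub_t c.disjoint_u)
  - PFA.massey S hF c.D₂ c.Du c.Dt c.D c.sub₂u (Disk.fits_two c.sub_u c.sub_t c.disjoint_u)
  + PFA.massey S hF c.D₂ c.Dd c.Dt c.D c.sub₂d (Disk.fits_two c.sub_d c.sub_t c.disjoint_d)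
  - PFA.massey S hF c.D₁ c.Dd c.Dt c.D c.sub₁d (Disk.fits_two c.sub_d c.sub_t c.disjoint_d)

/-- A `P₂`-algebra with zero differential: a graded vector space `A` with an associative, unital and
graded commutative product `m` and a Poisson bracket `L` of degree `-1`. In the convention used here
the bracket is a symmetric map `A ⊗ A → A` of degree `-1`, and the signs are the Koszul signs of
* `L τ = L`,
* `L (id ⊗ m) = m (L ⊗ id) + m (id ⊗ L) (τ ⊗ id)`,
* `L (id ⊗ L) + L (id ⊗ L) τ_{(123)} + L (id ⊗ L) τ_{(132)} = 0`,

evaluated on homogeneous elements. -/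
structure IsP₂Algebra {K : Type u} [Field K] {A : Type v} [AddCommGroup A] [Module K A]
    (gr : ℤ → Submodule K A) (m : A →ₗ[K] A →ₗ[K] A) (e : A) (L : A →ₗ[K] A →ₗ[K] A) : Prop where
  isInternal : DirectSum.IsInternal gr
  mul_mem : ∀ {j k : ℤ} {x y : A}, x ∈ gr j → y ∈ gr k → m x y ∈ gr (j + k)
  one_mem : e ∈ gr 0
  mul_assoc : ∀ x y z : A, m (m x y) z = m x (m y z)
  one_mul : ∀ x : A, m e x = x
  mul_one : ∀ x : A, m x e = x
  mul_comm : ∀ {j k : ℤ} {x y : A}, x ∈ gr j → y ∈ gr k → m x y = (j * k).negOnePow • m y x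
  bracket_mem : ∀ {j k : ℤ} {x y : A}, x ∈ gr j → y ∈ gr k → L x y ∈ gr (j + k - 1)
  bracket_symm : ∀ {j k : ℤ} {x y : A}, x ∈ gr j → y ∈ gr k →
    (j * k).negOnePow • L y x = L x y
  bracket_mul : ∀ {j k l : ℤ} {x y z : A}, x ∈ gr j → y ∈ gr k → z ∈ gr l →
    L x (m y z) = m (L x y) z + (j * k + k).negOnePow • m y (L x z)
  jacobi : ∀ {j k l : ℤ} {x y z : A}, x ∈ gr j → y ∈ gr k → z ∈ gr l →
    j.negOnePow • L x (L y z)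
      + (l * (j + k) + l).negOnePow • L z (L x y)
      + (j * (k + l) + k).negOnePow • L y (L z x) = 0

end Prefact

/-!
Write `ev₂ c e` and `ev₃ c e f` for the class in `A = H F(ℝ²)` of the product of elements over
disjoint disks. For cocycles this class only depends on the classes of the factors, and since the
space of pairs of distinct points of the plane is connected, the product on `A` does not depend on
the disks (`PFA.mul_eq_mul`). Associativity, the unit and commutativity follow.

For disks `A ⊆ U`, the element `η = h̃_U F(ι) ĩ_A x` is a primitive of the difference of the two
representatives of `x` in `F(U)`. On pairs of disjoint disks, these primitives in either factor give
a `1`-cocycle with values in `A` (`PFA.cocycle`), i.e. a local system on the configuration space of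
two points of the plane. It is trivialized on half-plane charts, where it has a potential as a
function of polar coordinates (`PairCocycle.pot`). The potential changes by the holonomy under a
full turn, and the bracket `L` of any annular configuration is this holonomy (`PFA.L_eq_holonomy`).
This shows that `L` does not depend on the configuration, and that it is symmetric, because a half
turn exchanges the two points (`PFA.L_symm`).

For the other identities, `z` is put at the origin, and `x` is moved along chains of paths in polar
rectangles. The region between a ring at distance between `3` and `4` and a ring at distance between
`1` and `2` is subdivided by four radial channels, so that the difference of the two rings is a sum
of four loops, each of which has a primitive in a disk (`PFA.Chain.loop_sum`, `PFA.Chain.filling`).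
With `y` inside of the left loop this gives the Leibniz rule: the outer ring contributes
`L(x, yz)`, the inner ring `y L(x, z)`, the left loop `L(x, y) z`, and the other loops nothing
(`PFA.L_prod`; that the left loop around `y` represents `L(x, y)` is the case `z = 1`). For the
Jacobi identity, `y` moves as well, in the ring at distance between `2` and `3`, once through the
top and once through the bottom. The outer and the inner ring of `x` contribute `L(x, L(y, z))` and
`L(y, L(x, z))`, and the loops, corrected by their primitives, are homotopies that move the
representative of `L(x, y)` on the left to the one on the right, above and below the origin
(`PFA.upperMover`, `PFA.lowerMover`). Together they let `L(x, y)` turn around `z`, up to a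
multiplication with a class, which vanishes by the case `z = 1` (`PFA.L_L`).

For normalized retracts `S` and `S'`, both projections send a cocycle to its class. The paths of
`S'` deviate from those of `S` by classes that are additive for inclusions. As the plane is the
largest disk, the deviations in `Du` and `Dd` agree and cancel (`PFA.L_eq_of_isNormalized`).
-/

/-! ### Structure maps of two and three disks -/

namespace Prefact

/-- The triple of elements of a family indexed by disks, as a family over `Fin 3`. -/
def triple {X : Disk → Type v} {A B C : Disk} (x : X A) (y : X B) (z : X C) :
    ∀ k : Fin 3, X (![A, B, C] k) :=
  Fin.cons (α := fun k : Fin 3 => X (![A, B, C] k)) x (pair (X := X) y z)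

theorem Disk.fits_three {A B C T : Disk} (hA : (A : Set Plane) ⊆ T) (hB : (B : Set Plane) ⊆ T)
    (hC : (C : Set Plane) ⊆ T) (hAB : Disjoint (A : Set Plane) B)
    (hAC : Disjoint (A : Set Plane) C) (hBC : Disjoint (B : Set Plane) C) :
    Disk.Fits ![A, B, C] T := by
  refine ⟨fun i => ?_, fun i j hij => ?_⟩
  · fin_cases i
    exacts [hA, hB, hC]
  · fin_cases i <;> fin_cases j
    exacts [absurd rfl hij, hAB, hAC, hAB.symm, absurd rfl hij, hBC, hAC.symm, hBC.symm,
      absurd rfl hij]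

namespace PFA

variable {K : Type u} [Field K] (F : PFA.{u, v} K)

/-- Equal tuples of disks, with equal elements, have equal products. -/
theorem op_congr {n m : ℕ} (hnm : n = m) (D : Fin n → Disk) (D' : Fin m → Disk) (T : Disk)
    (h : Disk.Fits D T) (h' : Disk.Fits D' T) (x : ∀ i, F.obj (D i)) (x' : ∀ i, F.obj (D' i))
    (hD : ∀ i, D i = D' (Fin.cast hnm i)) (hx : ∀ i, HEq (x i) (x' (Fin.cast hnm i))) :
    F.op D T h x = F.op D' T h' x' := by
  subst hnm
  obtain rfl : D = D' := funext hD
  congr 1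
  funext i
  exact eq_of_heq (hx i)

/-- Compatibility of the structure maps with compositions, with the concatenated tuple given by
its own indexing. -/
theorem op_comp_of {n m : ℕ} (N : Fin n → ℕ) (E : ∀ i, Fin (N i) → Disk) (D : Fin n → Disk)
    (T : Disk) (hE : ∀ i, Disk.Fits (E i) (D i)) (hD : Disk.Fits D T) (x : ∀ i j, F.obj (E i j))
    (hm : ∑ i, N i = m) (D' : Fin m → Disk) (h' : Disk.Fits D' T) (x' : ∀ i, F.obj (D' i))
    (hED : ∀ i j, E i j = D' (Fin.cast hm (finSigmaFinEquiv ⟨i, j⟩)))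
    (hx : ∀ i j, HEq (x i j) (x' (Fin.cast hm (finSigmaFinEquiv ⟨i, j⟩)))) :
    F.op D T hD (fun i => F.op (E i) (D i) (hE i) (x i)) = F.op D' T h' x' := by
  have key : ∀ l,
      E (finSigmaFinEquiv.symm l).1 (finSigmaFinEquiv.symm l).2 = D' (Fin.cast hm l) := by
    intro l
    have := hED (finSigmaFinEquiv.symm l).1 (finSigmaFinEquiv.symm l).2
    rwa [Sigma.eta, Equiv.apply_symm_apply] at this
  have h : Disk.Fits (fun l => E (finSigmaFinEquiv.symm l).1 (finSigmaFinEquiv.symm l).2) T := by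
    refine ⟨fun i => ?_, fun i j hij => ?_⟩
    · dsimp only
      rw [key]
      exact h'.1 _
    · dsimp only
      rw [key, key]
      exact h'.2 _ _ fun h => hij (Fin.cast_injective hm h)
  rw [F.op_comp N E D T hE hD h x]
  refine F.op_congr hm _ _ T h h' _ _ key fun l => ?_
  have := hx (finSigmaFinEquiv.symm l).1 (finSigmaFinEquiv.symm l).2
  rwa [Sigma.eta, Equiv.apply_symm_apply] at this

theorem incl_apply (A T : Disk) (h : (A : Set Plane) ⊆ T) (x : F.obj A) :
    F.incl A T h x = F.op ![A] T (Disk.fits_one h) (single (X := fun D => F.obj D) x) := rfl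

theorem op₂_apply (A B T : Disk) (h : Disk.Fits ![A, B] T) (x : F.obj A) (y : F.obj B) :
    F.op₂ A B T h x y = F.op ![A, B] T h (pair (X := fun D => F.obj D) x y) := rfl

/-- The structure map of three mutually disjoint disks in `T`. -/
def op₃ (A B C T : Disk) (h : Disk.Fits ![A, B, C] T) :
    F.obj A →ₗ[K] F.obj B →ₗ[K] F.obj C →ₗ[K] F.obj T where
  toFun x := LinearMap.mk₂ K
    (fun y z => F.op ![A, B, C] T h (triple (X := fun D => F.obj D) x y z))
    (fun y y' _ => MultilinearMap.cons_add ((F.op ![A, B, C] T h).curryLeft x) _ y y')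
    (fun c y _ => MultilinearMap.cons_smul ((F.op ![A, B, C] T h).curryLeft x) _ c y)
    (fun y z z' =>
      MultilinearMap.cons_add (((F.op ![A, B, C] T h).curryLeft x).curryLeft y) _ z z')
    (fun c y z =>
      MultilinearMap.cons_smul (((F.op ![A, B, C] T h).curryLeft x).curryLeft y) _ c z)
  map_add' x x' := by
    ext y z
    exact MultilinearMap.cons_add (F.op ![A, B, C] T h) _ x x'
  map_smul' c x := by
    ext y z
    exact MultilinearMap.cons_smul (F.op ![A, B, C] T h) _ c x

theorem op₃_apply (A B C T : Disk) (h : Disk.Fits ![A, B, C] T) (x : F.obj A) (y : F.obj B)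
    (z : F.obj C) :
    F.op₃ A B C T h x y z = F.op ![A, B, C] T h (triple (X := fun D => F.obj D) x y z) := rfl

theorem incl_self (A : Disk) (h : (A : Set Plane) ⊆ A) (x : F.obj A) : F.incl A A h x = x :=
  F.op_id A _ _

theorem incl_incl (A B C : Disk) (h : (A : Set Plane) ⊆ B) (h' : (B : Set Plane) ⊆ C)
    (x : F.obj A) : F.incl B C h' (F.incl A B h x) = F.incl A C (h.trans h') x := by
  have := F.op_comp_of (fun _ : Fin 1 => 1) (fun _ => ![A]) ![B] C
    (fun i => by fin_cases i; exact Disk.fits_one h) (Disk.fits_one h')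
    (fun _ => single (X := fun D => F.obj D) x) (m := 1) rfl ![A] (Disk.fits_one (h.trans h'))
    (single (X := fun D => F.obj D) x)
    (fun i j => by fin_cases i; fin_cases j; rfl)
    (fun i j => by fin_cases i; fin_cases j; rfl)
  rw [incl_apply, incl_apply, incl_apply, ← this]
  congr 1
  funext i
  fin_cases i
  rfl

theorem incl_op₂ (A B C T : Disk) (h : Disk.Fits ![A, B] C) (hC : (C : Set Plane) ⊆ T)
    (h' : Disk.Fits ![A, B] T) (x : F.obj A) (y : F.obj B) :
    F.incl C T hC (F.op₂ A B C h x y) = F.op₂ A B T h' x y := by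
  have := F.op_comp_of (fun _ : Fin 1 => 2) (fun _ => ![A, B]) ![C] T
    (fun i => by fin_cases i; exact h) (Disk.fits_one hC)
    (fun _ => pair (X := fun D => F.obj D) x y) (m := 2) rfl ![A, B] h'
    (pair (X := fun D => F.obj D) x y)
    (fun i j => by fin_cases i; fin_cases j <;> rfl)
    (fun i j => by fin_cases i; fin_cases j <;> rfl)
  rw [incl_apply, op₂_apply, op₂_apply, ← this]
  congr 1
  funext i
  fin_cases i
  rfl

theorem op₂_incl (A A' B B' T : Disk) (hA : (A : Set Plane) ⊆ A') (hB : (B : Set Plane) ⊆ B')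
    (h' : Disk.Fits ![A', B'] T) (h : Disk.Fits ![A, B] T) (x : F.obj A) (y : F.obj B) :
    F.op₂ A' B' T h' (F.incl A A' hA x) (F.incl B B' hB y) = F.op₂ A B T h x y := by
  have := F.op_comp_of (fun _ : Fin 2 => 1) (Fin.cons ![A] (Fin.cons ![B] finZeroElim)) ![A', B'] T
    (fun i => by fin_cases i; exacts [Disk.fits_one hA, Disk.fits_one hB]) h'
    (Fin.cons (α := fun i : Fin 2 => ∀ j : Fin 1, F.obj ((Fin.cons (α := fun _ => Fin 1 → Disk) ![A]
        (Fin.cons (α := fun _ => Fin 1 → Disk) ![B] finZeroElim) : Fin 2 → Fin 1 → Disk) i j))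
      (single (X := fun D => F.obj D) x)
      (Fin.cons (α := fun i : Fin 1 => ∀ j : Fin 1, F.obj ((Fin.cons (α := fun _ => Fin 1 → Disk)
        ![B] finZeroElim : Fin 1 → Fin 1 → Disk) i j))
       (single (X := fun D => F.obj D) y) finZeroElim)) (m := 2) rfl ![A, B] h
    (pair (X := fun D => F.obj D) x y)
    (fun i j => by fin_cases i <;> fin_cases j <;> rfl)
    (fun i j => by fin_cases i <;> fin_cases j <;> rfl)
  rw [op₂_apply, op₂_apply, ← this]
  congr 1
  funext i
  fin_cases i <;> rfl

theorem op₂_incl_left (A A' B T : Disk) (hA : (A : Set Plane) ⊆ A') (h' : Disk.Fits ![A', B] T)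
    (h : Disk.Fits ![A, B] T) (x : F.obj A) (y : F.obj B) :
    F.op₂ A' B T h' (F.incl A A' hA x) y = F.op₂ A B T h x y := by
  rw [← F.op₂_incl A A' B B T hA subset_rfl h' h, F.incl_self]

end PFA
end Prefact

/-! ### Koszul signs, units, degrees and differentials -/

namespace Prefact

/-- The sign `(-1) ^ j` as a scalar. -/
def sgn (K : Type u) [Field K] (j : ℤ) : K := ((j.negOnePow : ℤ) : K)

section sgn

variable (K : Type u) [Field K]

theorem negOnePow_smul {V : Type*} [AddCommGroup V] [Module K V] (j : ℤ) (x : V) :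
    j.negOnePow • x = sgn K j • x := by
  rw [Units.smul_def, sgn, Int.cast_smul_eq_zsmul]

theorem sgn_add (i j : ℤ) : sgn K (i + j) = sgn K i * sgn K j := by
  simp [sgn, Int.negOnePow_add]

theorem sgn_sub (i j : ℤ) : sgn K (i - j) = sgn K i * sgn K j := by
  simp [sgn, Int.negOnePow_sub]

@[simp] theorem sgn_zero : sgn K 0 = 1 := by simp [sgn]

@[simp] theorem sgn_one : sgn K 1 = -1 := by simp [sgn]

theorem sgn_mul_self (j : ℤ) : sgn K j * sgn K j = 1 := by
  rw [← sgn_sub, sub_self, sgn_zero]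

theorem sgn_mul_sgn_sub_one (j : ℤ) : sgn K j * sgn K (j - 1) = -1 := by
  rw [sgn_sub, sgn_one, mul_neg_one, mul_neg, sgn_mul_self]

variable {K} in
theorem sgn_eq_sgn {a b : ℤ} (c : ℤ) (h : a = b + 2 * c) : sgn K a = sgn K b := by
  rw [h, two_mul, sgn_add, sgn_add, sgn_mul_self, mul_one]

end sgn

namespace PFA

variable {K : Type u} [Field K] (F : PFA.{u, v} K)

theorem op₂_op₂_left (A B C U T : Disk) (h : Disk.Fits ![A, B] U) (h' : Disk.Fits ![U, C] T)
    (h'' : Disk.Fits ![A, B, C] T) (x : F.obj A) (y : F.obj B) (z : F.obj C) :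
    F.op₂ U C T h' (F.op₂ A B U h x y) z = F.op₃ A B C T h'' x y z := by
  have := F.op_comp_of ![2, 1]
    (Fin.cons (α := fun i => Fin (![2, 1] i) → Disk) ![A, B]
      (Fin.cons (α := fun i => Fin (![1] i) → Disk) ![C] finZeroElim)) ![U, C] T
    (fun i => by fin_cases i; exacts [h, Disk.fits_one subset_rfl]) h'
    (Fin.cons (α := fun i : Fin 2 => ∀ j : Fin (![2, 1] i),
        F.obj ((Fin.cons (α := fun i => Fin (![2, 1] i) → Disk) ![A, B]
        (Fin.cons (α := fun i => Fin (![1] i) → Disk) ![C] finZeroElim) :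
          ∀ i : Fin 2, Fin (![2, 1] i) → Disk) i j))
      (pair (X := fun D => F.obj D) x y)
      (Fin.cons (α := fun i : Fin 1 => ∀ j : Fin (![1] i),
        F.obj ((Fin.cons (α := fun i => Fin (![1] i) → Disk)
        ![C] finZeroElim : ∀ i : Fin 1, Fin (![1] i) → Disk) i j))
       (single (X := fun D => F.obj D) z) finZeroElim)) (m := 3) rfl ![A, B, C] h''
    (triple (X := fun D => F.obj D) x y z)
    (fun i j => by fin_cases i <;> fin_cases j <;> rfl)
    (fun i j => by fin_cases i <;> fin_cases j <;> rfl)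
  rw [op₃_apply, op₂_apply, op₂_apply, ← this]
  congr 1
  funext i
  fin_cases i
  · rfl
  · exact (F.op_id C (Disk.fits_one subset_rfl) (single (X := fun D => F.obj D) z)).symm

theorem op₂_op₂_right (A B C U T : Disk) (h : Disk.Fits ![B, C] U) (h' : Disk.Fits ![A, U] T)
    (h'' : Disk.Fits ![A, B, C] T) (x : F.obj A) (y : F.obj B) (z : F.obj C) :
    F.op₂ A U T h' x (F.op₂ B C U h y z) = F.op₃ A B C T h'' x y z := by
  have := F.op_comp_of ![1, 2]
    (Fin.cons (α := fun i => Fin (![1, 2] i) → Disk) ![A]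
      (Fin.cons (α := fun i => Fin (![2] i) → Disk) ![B, C] finZeroElim)) ![A, U] T
    (fun i => by fin_cases i; exacts [Disk.fits_one subset_rfl, h]) h'
    (Fin.cons (α := fun i : Fin 2 => ∀ j : Fin (![1, 2] i),
        F.obj ((Fin.cons (α := fun i => Fin (![1, 2] i) → Disk) ![A]
        (Fin.cons (α := fun i => Fin (![2] i) → Disk) ![B, C] finZeroElim) :
          ∀ i : Fin 2, Fin (![1, 2] i) → Disk) i j))
      (single (X := fun D => F.obj D) x)
      (Fin.cons (α := fun i : Fin 1 => ∀ j : Fin (![2] i),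
        F.obj ((Fin.cons (α := fun i => Fin (![2] i) → Disk)
        ![B, C] finZeroElim : ∀ i : Fin 1, Fin (![2] i) → Disk) i j))
       (pair (X := fun D => F.obj D) y z) finZeroElim)) (m := 3) rfl ![A, B, C] h''
    (triple (X := fun D => F.obj D) x y z)
    (fun i j => by fin_cases i <;> fin_cases j <;> rfl)
    (fun i j => by fin_cases i <;> fin_cases j <;> rfl)
  rw [op₃_apply, op₂_apply, op₂_apply, ← this]
  congr 1
  funext i
  fin_cases i
  · exact (F.op_id A (Disk.fits_one subset_rfl) (single (X := fun D => F.obj D) x)).symm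
  · rfl

theorem op₃_incl (A A' B B' C C' T : Disk) (hA : (A : Set Plane) ⊆ A') (hB : (B : Set Plane) ⊆ B')
    (hC : (C : Set Plane) ⊆ C') (h' : Disk.Fits ![A', B', C'] T) (h : Disk.Fits ![A, B, C] T)
    (x : F.obj A) (y : F.obj B) (z : F.obj C) :
    F.op₃ A' B' C' T h' (F.incl A A' hA x) (F.incl B B' hB y) (F.incl C C' hC z) =
      F.op₃ A B C T h x y z := by
  have := F.op_comp_of (fun _ : Fin 3 => 1)
    (Fin.cons ![A] (Fin.cons ![B] (Fin.cons ![C] finZeroElim))) ![A', B', C'] T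
    (fun i => by fin_cases i; exacts [Disk.fits_one hA, Disk.fits_one hB, Disk.fits_one hC]) h'
    (Fin.cons (α := fun i : Fin 3 => ∀ j : Fin 1, F.obj ((Fin.cons (α := fun _ => Fin 1 → Disk) ![A]
        (Fin.cons (α := fun _ => Fin 1 → Disk) ![B]
          (Fin.cons (α := fun _ => Fin 1 → Disk) ![C] finZeroElim)) : Fin 3 → Fin 1 → Disk) i j))
      (single (X := fun D => F.obj D) x)
      (Fin.cons (α := fun i : Fin 2 => ∀ j : Fin 1, F.obj ((Fin.cons (α := fun _ => Fin 1 → Disk)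
        ![B] (Fin.cons (α := fun _ => Fin 1 → Disk) ![C] finZeroElim) : Fin 2 → Fin 1 → Disk) i j))
       (single (X := fun D => F.obj D) y)
        (Fin.cons (α := fun i : Fin 1 => ∀ j : Fin 1, F.obj ((Fin.cons (α := fun _ => Fin 1 → Disk)
          ![C] finZeroElim : Fin 1 → Fin 1 → Disk) i j))
         (single (X := fun D => F.obj D) z) finZeroElim))) (m := 3) rfl ![A, B, C] h
    (triple (X := fun D => F.obj D) x y z)
    (fun i j => by fin_cases i <;> fin_cases j <;> rfl)
    (fun i j => by fin_cases i <;> fin_cases j <;> rfl)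
  rw [op₃_apply, op₃_apply, ← this]
  congr 1
  funext i
  fin_cases i <;> rfl

/-- The unit of `F` on a disk. -/
def unit (D : Disk) : F.obj D :=
  F.op ![] D ⟨fun i => i.elim0, fun i => i.elim0⟩ finZeroElim

theorem incl_unit (A T : Disk) (h : (A : Set Plane) ⊆ T) : F.incl A T h (F.unit A) = F.unit T := by
  have := F.op_comp_of (fun _ : Fin 1 => 0) (fun _ => ![]) ![A] T
    (fun i => ⟨fun i => i.elim0, fun i => i.elim0⟩) (Disk.fits_one h)
    (fun _ => finZeroElim) (m := 0) rfl ![] ⟨fun i => i.elim0, fun i => i.elim0⟩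
    finZeroElim (fun i j => j.elim0) (fun i j => j.elim0)
  rw [incl_apply, unit, unit, ← this]
  congr 1
  funext i
  fin_cases i
  rfl

theorem op₂_unit_right (A B T : Disk) (h : Disk.Fits ![A, B] T) (hA : (A : Set Plane) ⊆ T)
    (x : F.obj A) : F.op₂ A B T h x (F.unit B) = F.incl A T hA x := by
  have := F.op_comp_of ![1, 0]
    (Fin.cons (α := fun i => Fin (![1, 0] i) → Disk) ![A]
      (Fin.cons (α := fun i => Fin (![0] i) → Disk) ![] finZeroElim)) ![A, B] T
    (fun i => by
      fin_cases i; exacts [Disk.fits_one subset_rfl, ⟨fun i => i.elim0, fun i => i.elim0⟩]) h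
    (Fin.cons (α := fun i : Fin 2 => ∀ j : Fin (![1, 0] i),
        F.obj ((Fin.cons (α := fun i => Fin (![1, 0] i) → Disk) ![A]
        (Fin.cons (α := fun i => Fin (![0] i) → Disk) ![] finZeroElim) :
          ∀ i : Fin 2, Fin (![1, 0] i) → Disk) i j))
      (single (X := fun D => F.obj D) x)
      (Fin.cons (α := fun i : Fin 1 => ∀ j : Fin (![0] i),
        F.obj ((Fin.cons (α := fun i => Fin (![0] i) → Disk)
        ![] finZeroElim : ∀ i : Fin 1, Fin (![0] i) → Disk) i j))
       finZeroElim finZeroElim)) (m := 1) rfl ![A] (Disk.fits_one hA)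
    (single (X := fun D => F.obj D) x)
    (fun i j => by
      fin_cases i
      · fin_cases j; rfl
      · exact j.elim0)
    (fun i j => by
      fin_cases i
      · fin_cases j; rfl
      · exact j.elim0)
  rw [incl_apply, op₂_apply, ← this]
  congr 1
  funext i
  fin_cases i
  · exact (F.op_id A (Disk.fits_one subset_rfl) (single (X := fun D => F.obj D) x)).symm
  · rfl

theorem op₂_unit_left (A B T : Disk) (h : Disk.Fits ![A, B] T) (hB : (B : Set Plane) ⊆ T)
    (x : F.obj B) : F.op₂ A B T h (F.unit A) x = F.incl B T hB x := by
  have := F.op_comp_of ![0, 1]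
    (Fin.cons (α := fun i => Fin (![0, 1] i) → Disk) ![]
      (Fin.cons (α := fun i => Fin (![1] i) → Disk) ![B] finZeroElim)) ![A, B] T
    (fun i => by
      fin_cases i; exacts [⟨fun i => i.elim0, fun i => i.elim0⟩, Disk.fits_one subset_rfl]) h
    (Fin.cons (α := fun i : Fin 2 => ∀ j : Fin (![0, 1] i),
        F.obj ((Fin.cons (α := fun i => Fin (![0, 1] i) → Disk) ![]
        (Fin.cons (α := fun i => Fin (![1] i) → Disk) ![B] finZeroElim) :
          ∀ i : Fin 2, Fin (![0, 1] i) → Disk) i j))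
      finZeroElim
      (Fin.cons (α := fun i : Fin 1 => ∀ j : Fin (![1] i),
        F.obj ((Fin.cons (α := fun i => Fin (![1] i) → Disk)
        ![B] finZeroElim : ∀ i : Fin 1, Fin (![1] i) → Disk) i j))
       (single (X := fun D => F.obj D) x) finZeroElim)) (m := 1) rfl ![B] (Disk.fits_one hB)
    (single (X := fun D => F.obj D) x)
    (fun i j => by
      fin_cases i
      · exact j.elim0
      · fin_cases j; rfl)
    (fun i j => by
      fin_cases i
      · exact j.elim0
      · fin_cases j; rfl)
  rw [incl_apply, op₂_apply, ← this]
  congr 1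
  funext i
  fin_cases i
  · rfl
  · exact (F.op_id B (Disk.fits_one subset_rfl) (single (X := fun D => F.obj D) x)).symm

variable {F}

theorem incl_mem (A T : Disk) (h : (A : Set Plane) ⊆ T) {j : ℤ} {x : F.obj A}
    (hx : x ∈ (F.obj A).gr j) : F.incl A T h x ∈ (F.obj T).gr j := by
  have := F.op_mem ![A] T (Disk.fits_one h) ![j] (single (X := fun D => F.obj D) x)
    (fun i => by fin_cases i; exact hx)
  simp only [Fin.sum_univ_one] at this
  exact this

theorem op₂_mem (A B T : Disk) (h : Disk.Fits ![A, B] T) {j k : ℤ} {x : F.obj A} {y : F.obj B}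
    (hx : x ∈ (F.obj A).gr j) (hy : y ∈ (F.obj B).gr k) :
    F.op₂ A B T h x y ∈ (F.obj T).gr (j + k) := by
  have := F.op_mem ![A, B] T h ![j, k] (pair (X := fun D => F.obj D) x y)
    (fun i => by fin_cases i; exacts [hx, hy])
  simp only [Fin.sum_univ_two] at this
  exact this

theorem unit_mem (D : Disk) : F.unit D ∈ (F.obj D).gr 0 := by
  have := F.op_mem ![] D ⟨fun i => i.elim0, fun i => i.elim0⟩ ![] finZeroElim (fun i => i.elim0)
  simp only [Fin.sum_univ_zero] at this
  exact this

theorem d_unit (D : Disk) : (F.obj D).d (F.unit D) = 0 := by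
  have := F.op_d ![] D ⟨fun i => i.elim0, fun i => i.elim0⟩ ![] finZeroElim (fun i => i.elim0)
  simp only [Fin.sum_univ_zero] at this
  exact this

theorem d_op₂ (A B T : Disk) (h : Disk.Fits ![A, B] T) {j : ℤ} {x : F.obj A}
    (hx : x ∈ (F.obj A).gr j) (y : F.obj B) :
    (F.obj T).d (F.op₂ A B T h x y) =
      F.op₂ A B T h ((F.obj A).d x) y + sgn K j • F.op₂ A B T h x ((F.obj B).d y) := by
  have key : (F.obj T).d ∘ₗ F.op₂ A B T h x =
      F.op₂ A B T h ((F.obj A).d x) + sgn K j • (F.op₂ A B T h x ∘ₗ (F.obj B).d) := by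
    refine (F.obj B).hom_ext fun k y hy => ?_
    have h1 := F.op_d ![A, B] T h ![j, k] (pair (X := fun D => F.obj D) x y)
      (fun i => by fin_cases i; exacts [hx, hy])
    refine h1.trans ?_
    have e0 : (∑ l ∈ Finset.univ.filter (· < (0 : Fin 2)), ![j, k] l) = 0 := by simp
    have e1 : (∑ l ∈ Finset.univ.filter (· < (1 : Fin 2)), ![j, k] l) = j := by
      rw [Finset.sum_filter]; simp
    rw [Fin.sum_univ_two, e0, e1, Int.negOnePow_zero, one_smul, negOnePow_smul K]
    congr 1
    · change F.op ![A, B] T h _ = F.op ![A, B] T h _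
      congr 1
      funext i
      fin_cases i
      · exact Function.update_self _ _ _
      · exact Function.update_of_ne (by decide) _ _
    · change sgn K j • F.op ![A, B] T h _ = sgn K j • F.op ![A, B] T h _
      congr 2
      funext i
      fin_cases i
      · exact Function.update_of_ne (by decide) _ _
      · exact Function.update_self _ _ _
  exact LinearMap.congr_fun key y

theorem d_op₃ (A B C T : Disk) (h : Disk.Fits ![A, B, C] T) {j k : ℤ} {x : F.obj A} {y : F.obj B}
    (hx : x ∈ (F.obj A).gr j) (hy : y ∈ (F.obj B).gr k) (z : F.obj C) :
    (F.obj T).d (F.op₃ A B C T h x y z) =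
      F.op₃ A B C T h ((F.obj A).d x) y z + sgn K j • F.op₃ A B C T h x ((F.obj B).d y) z
        + sgn K (j + k) • F.op₃ A B C T h x y ((F.obj C).d z) := by
  have key : (F.obj T).d ∘ₗ F.op₃ A B C T h x y =
      F.op₃ A B C T h ((F.obj A).d x) y + sgn K j • F.op₃ A B C T h x ((F.obj B).d y)
        + sgn K (j + k) • (F.op₃ A B C T h x y ∘ₗ (F.obj C).d) := by
    refine (F.obj C).hom_ext fun l z hz => ?_
    have h1 := F.op_d ![A, B, C] T h ![j, k, l] (triple (X := fun D => F.obj D) x y z)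
      (fun i => by fin_cases i; exacts [hx, hy, hz])
    refine h1.trans ?_
    have e0 : (∑ i ∈ Finset.univ.filter (· < (0 : Fin 3)), ![j, k, l] i) = 0 := by simp
    have e1 : (∑ i ∈ Finset.univ.filter (· < (1 : Fin 3)), ![j, k, l] i) = j := by
      rw [Finset.sum_filter, Fin.sum_univ_three]; simp
    have e2 : (∑ i ∈ Finset.univ.filter (· < (2 : Fin 3)), ![j, k, l] i) = j + k := by
      rw [Finset.sum_filter, Fin.sum_univ_three]; simp
    rw [Fin.sum_univ_three, e0, e1, e2, Int.negOnePow_zero, one_smul, negOnePow_smul K,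
      negOnePow_smul K]
    congr 1
    · congr 1
      · change F.op ![A, B, C] T h _ = F.op ![A, B, C] T h _
        congr 1
        funext i
        fin_cases i
        · exact Function.update_self _ _ _
        · exact Function.update_of_ne (by decide) _ _
        · exact Function.update_of_ne (by decide) _ _
      · change sgn K j • F.op ![A, B, C] T h _ = sgn K j • F.op ![A, B, C] T h _
        congr 2
        funext i
        fin_cases i
        · exact Function.update_of_ne (by decide) _ _
        · exact Function.update_self _ _ _
        · exact Function.update_of_ne (by decide) _ _
    · change sgn K (j + k) • F.op ![A, B, C] T h _ = sgn K (j + k) • F.op ![A, B, C] T h _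
      congr 2
      funext i
      fin_cases i
      · exact Function.update_of_ne (by decide) _ _
      · exact Function.update_of_ne (by decide) _ _
      · exact Function.update_self _ _ _
  exact LinearMap.congr_fun key z

theorem op₂_comm (A B T : Disk) (h : Disk.Fits ![A, B] T) (h' : Disk.Fits ![B, A] T) {j k : ℤ}
    {x : F.obj A} {y : F.obj B} (hx : x ∈ (F.obj A).gr j) (hy : y ∈ (F.obj B).gr k) :
    F.op₂ A B T h x y = sgn K (j * k) • F.op₂ B A T h' y x := by
  have e : (fun i => ![A, B] (Equiv.swap (0 : Fin 2) 1 i)) = ![B, A] := by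
    funext i; fin_cases i <;> rfl
  have h1 := F.op_perm ![A, B] T h (Equiv.swap 0 1) (by rw [e]; exact h') ![j, k]
    (pair (X := fun D => F.obj D) x y) (fun i => by fin_cases i; exacts [hx, hy])
  have e2 : koszulSign (Equiv.swap (0 : Fin 2) 1) ![j, k] = (j * k).negOnePow := by
    simp [koszulSign, Fin.prod_univ_two, mul_comm]
  rw [op₂_apply, h1, e2, negOnePow_smul K]
  congr 1
  refine F.op_congr rfl _ _ T _ _ _ _ (fun i => by fin_cases i <;> rfl)
    (fun i => by fin_cases i <;> rfl)

theorem op₃_swap (A B C T : Disk) (h : Disk.Fits ![A, B, C] T) (h' : Disk.Fits ![B, A, C] T)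
    {j k : ℤ} {x : F.obj A} {y : F.obj B} (hx : x ∈ (F.obj A).gr j) (hy : y ∈ (F.obj B).gr k)
    (z : F.obj C) :
    F.op₃ A B C T h x y z = sgn K (j * k) • F.op₃ B A C T h' y x z := by
  have key : F.op₃ A B C T h x y = sgn K (j * k) • F.op₃ B A C T h' y x := by
    refine (F.obj C).hom_ext fun l z hz => ?_
    have e : (fun i => ![A, B, C] (Equiv.swap (0 : Fin 3) 1 i)) = ![B, A, C] := by
      funext i; fin_cases i <;> rfl
    have h1 := F.op_perm ![A, B, C] T h (Equiv.swap 0 1) (by rw [e]; exact h') ![j, k, l]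
      (triple (X := fun D => F.obj D) x y z) (fun i => by fin_cases i; exacts [hx, hy, hz])
    have s2 : Equiv.swap (0 : Fin 3) 1 2 = 2 := by decide
    have e2 : koszulSign (Equiv.swap (0 : Fin 3) 1) ![j, k, l] = (j * k).negOnePow := by
      simp [koszulSign, Fin.prod_univ_three, s2, mul_comm]
    rw [op₃_apply, h1, e2, negOnePow_smul K]
    change sgn K (j * k) • F.op _ T _ _ = sgn K (j * k) • F.op _ T _ _
    congr 1
    refine F.op_congr rfl _ _ T _ _ _ _ (fun i => by fin_cases i <;> rfl)
      (fun i => by fin_cases i <;> rfl)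
  exact LinearMap.congr_fun key z

end PFA
end Prefact

/-! ### The improved strong deformation retract -/

namespace Prefact

theorem DGSpace.map_proj {K : Type u} [Field K] {V W : DGSpace.{u, v} K} (f : V →ₗ[K] W)
    (hf : ∀ {k : ℤ} {x : V}, x ∈ V.gr k → f x ∈ W.gr k) (k : ℤ) (x : V) :
    f (V.proj k x) = W.proj k (f x) := by
  have : f ∘ₗ V.proj k = W.proj k ∘ₗ f := by
    refine V.hom_ext fun j x hx => ?_
    simp only [LinearMap.comp_apply, V.proj_of_mem hx, W.proj_of_mem (hf hx)]
    split_ifs <;> simp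
  exact LinearMap.congr_fun this x

theorem Disk.subset_whole (D : Disk) : (D : Set Plane) ⊆ Disk.whole := Set.subset_univ _

namespace PFA

variable {K : Type u} [Field K] {F : PFA.{u, v} K} (S : F.Retracts) (hF : F.IsLocallyConstant)

theorem hIncl_mem (A T : Disk) (h : (A : Set Plane) ⊆ T) {k : ℤ} {x : (F.obj A).H}
    (hx : x ∈ (F.obj A).H.gr k) : hIncl S A T h x ∈ (F.obj T).H.gr k :=
  (S T).p_mem (incl_mem A T h ((S A).i_mem hx))

theorem toWhole_symm_mem (D : Disk) {k : ℤ} {x : F.HR} (hx : x ∈ F.HR.gr k) :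
    (toWhole S hF D).symm x ∈ (F.obj D).H.gr k := by
  have h1 : (toWhole S hF D) ((F.obj D).H.proj k ((toWhole S hF D).symm x)) = x := by
    have := DGSpace.map_proj (V := (F.obj D).H) (W := F.HR) (toWhole S hF D).toLinearMap
      (fun h => hIncl_mem S D Disk.whole _ h) k ((toWhole S hF D).symm x)
    refine this.trans ?_
    rw [LinearEquiv.coe_coe, LinearEquiv.apply_symm_apply]
    exact (F.HR.proj_of_mem hx).trans (if_pos rfl)
  rw [← LinearEquiv.eq_symm_apply] at h1
  rw [← h1]
  exact (F.obj D).H.proj_mem k _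

theorem iT_mem (D : Disk) {k : ℤ} {x : F.HR} (hx : x ∈ F.HR.gr k) :
    iT S hF D x ∈ (F.obj D).gr k :=
  (S D).i_mem (toWhole_symm_mem S hF D hx)

theorem pT_mem (D : Disk) {k : ℤ} {x : F.obj D} (hx : x ∈ (F.obj D).gr k) :
    pT S D x ∈ F.HR.gr k :=
  (S Disk.whole).p_mem (incl_mem _ _ _ hx)

theorem hT_apply (D : Disk) (x : F.obj D) :
    hT S hF D x = (S D).h x - iT S hF D (pT S D ((S D).h x)) := rfl

theorem hT_mem (D : Disk) {k : ℤ} {x : F.obj D} (hx : x ∈ (F.obj D).gr k) :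
    hT S hF D x ∈ (F.obj D).gr (k - 1) := by
  rw [hT_apply]
  exact Submodule.sub_mem _ ((S D).h_mem hx) (iT_mem S hF D (pT_mem S D ((S D).h_mem hx)))

theorem pT_apply (D : Disk) (x : F.obj D) :
    pT S D x = (S Disk.whole).p (F.incl D Disk.whole (Disk.subset_whole D) x) := rfl

@[simp] theorem d_iT (D : Disk) (x : F.HR) : (F.obj D).d (iT S hF D x) = 0 := (S D).d_i _

@[simp] theorem pT_d (D : Disk) (x : F.obj D) : pT S D ((F.obj D).d x) = 0 := by
  rw [pT_apply, F.incl_d, (S Disk.whole).p_d]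

theorem pT_i (D : Disk) (x : (F.obj D).H) : pT S D ((S D).i x) = toWhole S hF D x := rfl

@[simp] theorem pT_iT (D : Disk) (x : F.HR) : pT S D (iT S hF D x) = x := by
  change pT S D ((S D).i ((toWhole S hF D).symm x)) = x
  rw [pT_i S hF, LinearEquiv.apply_symm_apply]

theorem iT_pT_i (D : Disk) (x : (F.obj D).H) : iT S hF D (pT S D ((S D).i x)) = (S D).i x := by
  rw [pT_i S hF]
  change (S D).i ((toWhole S hF D).symm (toWhole S hF D x)) = _
  rw [LinearEquiv.symm_apply_apply]

theorem d_hT (D : Disk) (x : F.obj D) :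
    (F.obj D).d (hT S hF D x) + hT S hF D ((F.obj D).d x) = iT S hF D (pT S D x) - x := by
  have h1 := (S D).d_h x
  have h2 : pT S D ((S D).h ((F.obj D).d x)) = pT S D ((S D).i ((S D).p x)) - pT S D x := by
    rw [← map_sub, ← h1, map_add, pT_d, zero_add]
  have h3 : (S D).h ((F.obj D).d x) = (S D).i ((S D).p x) - x - (F.obj D).d ((S D).h x) := by
    rw [← h1]; abel
  rw [hT_apply, hT_apply, h2, map_sub, map_sub, d_iT, iT_pT_i, h3]
  abel

@[simp] theorem pT_hT (D : Disk) (x : F.obj D) : pT S D (hT S hF D x) = 0 := by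
  rw [hT_apply, map_sub, pT_iT, sub_self]

@[simp] theorem hT_iT (D : Disk) (x : F.HR) : hT S hF D (iT S hF D x) = 0 := by
  rw [hT_apply]
  have : (S D).h (iT S hF D x) = 0 := (S D).h_i _
  rw [this, map_zero, map_zero, sub_self]

@[simp] theorem pT_incl (A T : Disk) (h : (A : Set Plane) ⊆ T) (x : F.obj A) :
    pT S T (F.incl A T h x) = pT S A x := by
  rw [pT_apply, F.incl_incl]
  rfl

theorem d_hT_of_closed (D : Disk) {x : F.obj D} (hx : (F.obj D).d x = 0) :
    (F.obj D).d (hT S hF D x) = iT S hF D (pT S D x) - x := by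
  rw [← d_hT S hF D x, hx, map_zero, add_zero]

/-- The canonical primitive `η = h̃_U F(ι) ĩ_A` of the difference of the two representatives
`ĩ_U x` and `F(ι) ĩ_A x` of a class `x` in `F(U)`, for disks `A ⊆ U`. -/
noncomputable def eta (A U : Disk) (h : (A : Set Plane) ⊆ U) : F.HR →ₗ[K] F.obj U :=
  hT S hF U ∘ₗ F.incl A U h ∘ₗ iT S hF A

theorem d_eta (A U : Disk) (h : (A : Set Plane) ⊆ U) (x : F.HR) :
    (F.obj U).d (eta S hF A U h x) = iT S hF U x - F.incl A U h (iT S hF A x) := by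
  have := d_hT_of_closed S hF U (x := F.incl A U h (iT S hF A x))
    (by rw [← F.incl_d, d_iT, map_zero])
  rw [pT_incl, pT_iT] at this
  exact this

@[simp] theorem pT_eta (A U : Disk) (h : (A : Set Plane) ⊆ U) (x : F.HR) :
    pT S U (eta S hF A U h x) = 0 := pT_hT _ _ _ _

theorem eta_self (A : Disk) (h : (A : Set Plane) ⊆ A) (x : F.HR) : eta S hF A A h x = 0 := by
  change hT S hF A (F.incl A A h _) = 0
  rw [F.incl_self, hT_iT]

theorem eta_mem (A U : Disk) (h : (A : Set Plane) ⊆ U) {k : ℤ} {x : F.HR} (hx : x ∈ F.HR.gr k) :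
    eta S hF A U h x ∈ (F.obj U).gr (k - 1) :=
  hT_mem S hF U (incl_mem A U h (iT_mem S hF A hx))

/-- The element of `F(U)` of degree `-1` that moves the class `x` from the disk `A` to the disk `A'`
inside of `U`. -/
noncomputable def path (U A A' : Disk) (h : (A : Set Plane) ⊆ U) (h' : (A' : Set Plane) ⊆ U) :
    F.HR →ₗ[K] F.obj U := eta S hF A U h - eta S hF A' U h'

theorem path_apply (U A A' : Disk) (h : (A : Set Plane) ⊆ U) (h' : (A' : Set Plane) ⊆ U)
    (x : F.HR) : path S hF U A A' h h' x = eta S hF A U h x - eta S hF A' U h' x := rfl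

theorem d_path (U A A' : Disk) (h : (A : Set Plane) ⊆ U) (h' : (A' : Set Plane) ⊆ U) (x : F.HR) :
    (F.obj U).d (path S hF U A A' h h' x) =
      F.incl A' U h' (iT S hF A' x) - F.incl A U h (iT S hF A x) := by
  rw [path_apply, map_sub, d_eta, d_eta]
  abel

@[simp] theorem pT_path (U A A' : Disk) (h : (A : Set Plane) ⊆ U) (h' : (A' : Set Plane) ⊆ U)
    (x : F.HR) : pT S U (path S hF U A A' h h' x) = 0 := by
  rw [path_apply, map_sub, pT_eta, pT_eta, sub_zero]

theorem path_mem (U A A' : Disk) (h : (A : Set Plane) ⊆ U) (h' : (A' : Set Plane) ⊆ U) {k : ℤ}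
    {x : F.HR} (hx : x ∈ F.HR.gr k) : path S hF U A A' h h' x ∈ (F.obj U).gr (k - 1) :=
  Submodule.sub_mem _ (eta_mem S hF A U h hx) (eta_mem S hF A' U h' hx)

/-- The structure map of two disjoint disks in the plane, followed by the projection to
cohomology. -/
def ev₂ (A B : Disk) (h : Disjoint (A : Set Plane) B) : F.obj A →ₗ[K] F.obj B →ₗ[K] F.HR :=
  (F.op₂ A B Disk.whole (Disk.fits_two (Disk.subset_whole _) (Disk.subset_whole _) h)).compr₂
    (S Disk.whole).p

/-- The structure map of three disjoint disks in the plane, followed by the projection to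
cohomology. -/
def ev₃ (A B C : Disk) (hAB : Disjoint (A : Set Plane) B) (hAC : Disjoint (A : Set Plane) C)
    (hBC : Disjoint (B : Set Plane) C) : F.obj A →ₗ[K] F.obj B →ₗ[K] F.obj C →ₗ[K] F.HR :=
  (F.op₃ A B C Disk.whole (Disk.fits_three (Disk.subset_whole _) (Disk.subset_whole _)
    (Disk.subset_whole _) hAB hAC hBC)).compr₂
      (LinearMap.compRight K (S Disk.whole).p)

theorem ev₂_apply (A B : Disk) (h : Disjoint (A : Set Plane) B) (x : F.obj A) (y : F.obj B) :
    ev₂ S A B h x y = (S Disk.whole).p (F.op₂ A B Disk.whole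
      (Disk.fits_two (Disk.subset_whole _) (Disk.subset_whole _) h) x y) := rfl

theorem ev₃_apply (A B C : Disk) (hAB : Disjoint (A : Set Plane) B)
    (hAC : Disjoint (A : Set Plane) C) (hBC : Disjoint (B : Set Plane) C) (x : F.obj A)
    (y : F.obj B) (z : F.obj C) :
    ev₃ S A B C hAB hAC hBC x y z = (S Disk.whole).p (F.op₃ A B C Disk.whole
      (Disk.fits_three (Disk.subset_whole _) (Disk.subset_whole _) (Disk.subset_whole _)
        hAB hAC hBC) x y z) := rfl

theorem pT_op₂ (A B T : Disk) (h : Disk.Fits ![A, B] T) (h' : Disjoint (A : Set Plane) B)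
    (x : F.obj A) (y : F.obj B) : pT S T (F.op₂ A B T h x y) = ev₂ S A B h' x y := by
  rw [pT_apply, F.incl_op₂ A B T _ h _
    (Disk.fits_two (Disk.subset_whole _) (Disk.subset_whole _) h')]
  rfl

theorem mul_eq (A B : Disk) (h : Disjoint (A : Set Plane) B) (x y : F.HR) :
    mul S hF A B h x y = ev₂ S A B h (iT S hF A x) (iT S hF B y) := rfl

theorem massey_eq (A U B T : Disk) (hA : (A : Set Plane) ⊆ U) (h : Disk.Fits ![U, B] T)
    (h' : Disjoint (U : Set Plane) B) (x y : F.HR) :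
    massey S hF A U B T hA h x y = ev₂ S U B h' (eta S hF A U hA x) (iT S hF B y) :=
  pT_op₂ S U B T h h' _ _

theorem ev₂_incl (A A' B B' : Disk) (hA : (A : Set Plane) ⊆ A') (hB : (B : Set Plane) ⊆ B')
    (h' : Disjoint (A' : Set Plane) B') (h : Disjoint (A : Set Plane) B) (x : F.obj A)
    (y : F.obj B) :
    ev₂ S A' B' h' (F.incl A A' hA x) (F.incl B B' hB y) = ev₂ S A B h x y := by
  rw [ev₂_apply, F.op₂_incl]
  rfl

theorem ev₂_incl_left (A A' B : Disk) (hA : (A : Set Plane) ⊆ A')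
    (h' : Disjoint (A' : Set Plane) B) (h : Disjoint (A : Set Plane) B) (x : F.obj A)
    (y : F.obj B) : ev₂ S A' B h' (F.incl A A' hA x) y = ev₂ S A B h x y := by
  rw [← ev₂_incl S A A' B B hA subset_rfl h' h, F.incl_self]

theorem ev₂_incl_right (A B B' : Disk) (hB : (B : Set Plane) ⊆ B')
    (h' : Disjoint (A : Set Plane) B') (h : Disjoint (A : Set Plane) B) (x : F.obj A)
    (y : F.obj B) : ev₂ S A B' h' x (F.incl B B' hB y) = ev₂ S A B h x y := by
  rw [← ev₂_incl S A A B B' subset_rfl hB h' h, F.incl_self]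

theorem ev₃_incl (A A' B B' C C' : Disk) (hA : (A : Set Plane) ⊆ A') (hB : (B : Set Plane) ⊆ B')
    (hC : (C : Set Plane) ⊆ C') (h₁' : Disjoint (A' : Set Plane) B')
    (h₂' : Disjoint (A' : Set Plane) C') (h₃' : Disjoint (B' : Set Plane) C')
    (h₁ : Disjoint (A : Set Plane) B) (h₂ : Disjoint (A : Set Plane) C)
    (h₃ : Disjoint (B : Set Plane) C) (x : F.obj A) (y : F.obj B) (z : F.obj C) :
    ev₃ S A' B' C' h₁' h₂' h₃' (F.incl A A' hA x) (F.incl B B' hB y) (F.incl C C' hC z) =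
      ev₃ S A B C h₁ h₂ h₃ x y z := by
  rw [ev₃_apply, F.op₃_incl]
  rfl

theorem ev₂_op₂_left (A B C U : Disk) (h : Disk.Fits ![A, B] U) (hUC : Disjoint (U : Set Plane) C)
    (h₁ : Disjoint (A : Set Plane) B) (h₂ : Disjoint (A : Set Plane) C)
    (h₃ : Disjoint (B : Set Plane) C) (x : F.obj A) (y : F.obj B) (z : F.obj C) :
    ev₂ S U C hUC (F.op₂ A B U h x y) z = ev₃ S A B C h₁ h₂ h₃ x y z := by
  rw [ev₂_apply, F.op₂_op₂_left]
  rfl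

theorem ev₂_op₂_right (A B C U : Disk) (h : Disk.Fits ![B, C] U)
    (hAU : Disjoint (A : Set Plane) U)
    (h₁ : Disjoint (A : Set Plane) B) (h₂ : Disjoint (A : Set Plane) C)
    (h₃ : Disjoint (B : Set Plane) C) (x : F.obj A) (y : F.obj B) (z : F.obj C) :
    ev₂ S A U hAU x (F.op₂ B C U h y z) = ev₃ S A B C h₁ h₂ h₃ x y z := by
  rw [ev₂_apply, F.op₂_op₂_right]
  rfl

theorem ev₂_comm (A B : Disk) (h : Disjoint (A : Set Plane) B) (h' : Disjoint (B : Set Plane) A)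
    {j k : ℤ} {x : F.obj A} {y : F.obj B} (hx : x ∈ (F.obj A).gr j) (hy : y ∈ (F.obj B).gr k) :
    ev₂ S A B h x y = sgn K (j * k) • ev₂ S B A h' y x := by
  rw [ev₂_apply, op₂_comm A B _ _
    (Disk.fits_two (Disk.subset_whole _) (Disk.subset_whole _) h') hx hy, map_smul]
  rfl

theorem ev₃_swap (A B C : Disk) (h₁ : Disjoint (A : Set Plane) B) (h₂ : Disjoint (A : Set Plane) C)
    (h₃ : Disjoint (B : Set Plane) C) {j k : ℤ} {x : F.obj A} {y : F.obj B}
    (hx : x ∈ (F.obj A).gr j) (hy : y ∈ (F.obj B).gr k) (z : F.obj C) :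
    ev₃ S A B C h₁ h₂ h₃ x y z = sgn K (j * k) • ev₃ S B A C h₁.symm h₃ h₂ y x z := by
  rw [ev₃_apply, op₃_swap A B C _ _ (Disk.fits_three (Disk.subset_whole _) (Disk.subset_whole _)
    (Disk.subset_whole _) h₁.symm h₃ h₂) hx hy, map_smul]
  rfl

theorem ev₂_mem (A B : Disk) (h : Disjoint (A : Set Plane) B)
    {j k : ℤ} {x : F.obj A} {y : F.obj B} (hx : x ∈ (F.obj A).gr j) (hy : y ∈ (F.obj B).gr k) :
    ev₂ S A B h x y ∈ F.HR.gr (j + k) :=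
  (S Disk.whole).p_mem (op₂_mem _ _ _ _ hx hy)

theorem ev₂_d (A B : Disk) (h : Disjoint (A : Set Plane) B) {j : ℤ} {x : F.obj A}
    (hx : x ∈ (F.obj A).gr j) (y : F.obj B) :
    ev₂ S A B h ((F.obj A).d x) y + sgn K j • ev₂ S A B h x ((F.obj B).d y) = 0 := by
  rw [ev₂_apply, ev₂_apply, ← map_smul, ← map_add, ← d_op₂ A B _ _ hx, (S Disk.whole).p_d]

theorem ev₂_d_left (A B : Disk) (h : Disjoint (A : Set Plane) B) (x : F.obj A) {y : F.obj B}
    (hy : (F.obj B).d y = 0) : ev₂ S A B h ((F.obj A).d x) y = 0 := by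
  have : (ev₂ S A B h).flip y ∘ₗ (F.obj A).d = 0 := by
    refine (F.obj A).hom_ext fun j x hx => ?_
    have := ev₂_d S A B h hx y
    rwa [hy, map_zero, smul_zero, add_zero] at this
  exact LinearMap.congr_fun this x

theorem ev₂_d_right (A B : Disk) (h : Disjoint (A : Set Plane) B) {j : ℤ} {x : F.obj A}
    (hx : x ∈ (F.obj A).gr j) (hdx : (F.obj A).d x = 0) (y : F.obj B) :
    ev₂ S A B h x ((F.obj B).d y) = 0 := by
  have := ev₂_d S A B h hx y
  rw [hdx, map_zero, LinearMap.zero_apply, zero_add] at this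
  have h2 := congrArg (sgn K j • ·) this
  simpa [smul_smul, sgn_mul_self] using h2

theorem ev₃_d (A B C : Disk) (h₁ : Disjoint (A : Set Plane) B) (h₂ : Disjoint (A : Set Plane) C)
    (h₃ : Disjoint (B : Set Plane) C) {j k : ℤ} {x : F.obj A} {y : F.obj B} {z : F.obj C}
    (hx : x ∈ (F.obj A).gr j) (hy : y ∈ (F.obj B).gr k) (hz : (F.obj C).d z = 0) :
    ev₃ S A B C h₁ h₂ h₃ ((F.obj A).d x) y z
      + sgn K j • ev₃ S A B C h₁ h₂ h₃ x ((F.obj B).d y) z = 0 := by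
  have := d_op₃ A B C Disk.whole (Disk.fits_three (Disk.subset_whole _) (Disk.subset_whole _)
    (Disk.subset_whole _) h₁ h₂ h₃) hx hy z
  rw [hz, map_zero, smul_zero, add_zero] at this
  rw [ev₃_apply, ev₃_apply, ← map_smul, ← map_add, ← this, (S Disk.whole).p_d]

/-- The product of two cocycles represents the product of their classes. -/
theorem ev₂_closed (A B : Disk) (h : Disjoint (A : Set Plane) B) {j : ℤ} {x : F.obj A}
    {y : F.obj B} (hx : x ∈ (F.obj A).gr j) (hdx : (F.obj A).d x = 0) (hdy : (F.obj B).d y = 0) :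
    ev₂ S A B h x y = mul S hF A B h (pT S A x) (pT S B y) := by
  have e1 : x = iT S hF A (pT S A x) - (F.obj A).d (hT S hF A x) := by
    rw [d_hT_of_closed S hF A hdx]; abel
  have e2 : y = iT S hF B (pT S B y) - (F.obj B).d (hT S hF B y) := by
    rw [d_hT_of_closed S hF B hdy]; abel
  have h1 : ev₂ S A B h x y = ev₂ S A B h (iT S hF A (pT S A x)) y := by
    conv_lhs => rw [e1]
    rw [map_sub, LinearMap.sub_apply, ev₂_d_left S A B h _ hdy, sub_zero]
  rw [h1, mul_eq]
  conv_lhs => rw [e2]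
  rw [map_sub, ev₂_d_right S A B h (iT_mem S hF A (pT_mem S A hx)) (d_iT S hF A _), sub_zero]

end PFA
end Prefact

/-! ### Balls, half-planes and sectors are disks -/

namespace Prefact

/-- The range of an injective smooth map from the plane to itself with injective derivatives is a
disk. -/
theorem isDisk_range {f : Plane → Plane} (hf : ContDiff ℝ ∞ f) (hinj : Function.Injective f)
    (hd : ∀ v w, fderiv ℝ f v w = 0 → w = 0) : IsDisk (Set.range f) := by
  have hequiv : ∀ v, ∃ f' : Plane ≃L[ℝ] Plane, (f' : Plane →L[ℝ] Plane) = fderiv ℝ f v := by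
    intro v
    have hi : Function.Injective (fderiv ℝ f v : Plane →ₗ[ℝ] Plane) := by
      rw [injective_iff_map_eq_zero]
      exact hd v
    refine ⟨(LinearEquiv.ofInjectiveEndo _ hi).toContinuousLinearEquiv, ?_⟩
    ext w
    rfl
  have hopen : IsOpenMap f := by
    rw [isOpenMap_iff_nhds_le]
    intro v
    obtain ⟨f', hf'⟩ := hequiv v
    have h1 : HasStrictFDerivAt f (f' : Plane →L[ℝ] Plane) v := by
      rw [hf']
      exact hf.contDiffAt.hasStrictFDerivAt (by simp)
    exact h1.map_nhds_eq_of_equiv.ge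
  have hemb : Topology.IsOpenEmbedding f :=
    .of_continuous_injective_isOpenMap hf.continuous hinj hopen
  set e := hemb.toOpenPartialHomeomorph f with he
  have hsource : e.source = Set.univ := rfl
  have htarget : e.target = Set.range f := by
    rw [← e.image_source_eq_target, hsource, Set.image_univ]
    rfl
  refine ⟨e.symm, htarget, hsource, ?_, hf⟩
  intro w hw
  rw [← htarget] at hw
  obtain ⟨f', hf'⟩ := hequiv (e.symm w)
  refine (e.contDiffAt_symm hw (f₀' := f') ?_ hf.contDiffAt).contDiffWithinAt
  rw [hf']
  exact (hf.differentiable (by simp) _).hasFDerivAt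

theorem isDisk_ball (c : Plane) {r : ℝ} (hr : 0 < r) : IsDisk (Metric.ball c r) :=
  ⟨(OpenPartialHomeomorph.univBall c r).symm, OpenPartialHomeomorph.univBall_target c hr,
    OpenPartialHomeomorph.univBall_source c r, OpenPartialHomeomorph.contDiffOn_univBall_symm,
    OpenPartialHomeomorph.contDiff_univBall⟩

/-- The open ball as a disk. -/
def Disk.ball (c : Plane) (r : ℝ) (hr : 0 < r) : Disk := ⟨Metric.ball c r, isDisk_ball c hr⟩

/-- The derivative of a map to the plane, read off in the coordinates. -/
theorem fderiv_plane_apply {f : Plane → Plane} {v : Plane} (hf : DifferentiableAt ℝ f v) {i : Fin 2}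
    {g : Plane →L[ℝ] ℝ} (hg : HasFDerivAt (fun w => f w i) g v) (w : Plane) :
    fderiv ℝ f v w i = g w := by
  have h0 : HasFDerivAt (fun w => f w i)
      ((EuclideanSpace.proj i : Plane →L[ℝ] ℝ) ∘L fderiv ℝ f v) v :=
    (EuclideanSpace.proj i : Plane →L[ℝ] ℝ).hasFDerivAt.comp v hf.hasFDerivAt
  rw [← h0.unique hg]
  rfl

theorem coord_apply (i : Fin 2) (w : Plane) :
    (EuclideanSpace.proj i : Plane →L[ℝ] ℝ) w = w i := rfl

theorem hasFDerivAt_coord (i : Fin 2) (v : Plane) :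
    HasFDerivAt (fun w : Plane => w i) (EuclideanSpace.proj i : Plane →L[ℝ] ℝ) v :=
  (EuclideanSpace.proj i : Plane →L[ℝ] ℝ).hasFDerivAt

/-- The half-plane of the points whose coordinate in the direction of angle `α` exceeds `c`. -/
def halfPlane (α c : ℝ) : Set Plane := {w | c < w 0 * Real.cos α + w 1 * Real.sin α}

/-- The exponential in the direction of angle `α` parametrizes the half-plane. -/
theorem isDisk_halfPlane (α c : ℝ) : IsDisk (halfPlane α c) := by
  set f : Plane → Plane := fun v =>
    !₂[(c + Real.exp (v 0)) * Real.cos α - v 1 * Real.sin α,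
      (c + Real.exp (v 0)) * Real.sin α + v 1 * Real.cos α] with hf
  have hcs := Real.sin_sq_add_cos_sq α
  have e0 : ∀ v, f v 0 * Real.cos α + f v 1 * Real.sin α = c + Real.exp (v 0) := by
    intro v
    simp only [hf, PiLp.toLp_apply, Matrix.cons_val_zero, Matrix.cons_val_one]
    linear_combination (c + Real.exp (v 0)) * hcs
  have e1 : ∀ v, f v 1 * Real.cos α - f v 0 * Real.sin α = v 1 := by
    intro v
    simp only [hf, PiLp.toLp_apply, Matrix.cons_val_zero, Matrix.cons_val_one]
    linear_combination (v 1) * hcs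
  have hsm : ContDiff ℝ ∞ f := by
    rw [contDiff_euclidean]
    intro i
    fin_cases i
    · change ContDiff ℝ ∞ fun v : Plane =>
        (c + Real.exp (v 0)) * Real.cos α - v 1 * Real.sin α
      fun_prop
    · change ContDiff ℝ ∞ fun v : Plane =>
        (c + Real.exp (v 0)) * Real.sin α + v 1 * Real.cos α
      fun_prop
  have hrange : Set.range f = halfPlane α c := by
    ext w
    constructor
    · rintro ⟨v, rfl⟩
      change c < _
      rw [e0]
      linarith [Real.exp_pos (v 0)]
    · intro hw
      have hw' : c < w 0 * Real.cos α + w 1 * Real.sin α := hw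
      refine ⟨!₂[Real.log (w 0 * Real.cos α + w 1 * Real.sin α - c),
        w 1 * Real.cos α - w 0 * Real.sin α], ?_⟩
      ext i
      fin_cases i
      · simp [hf, Real.exp_log (sub_pos.2 hw')]
        linear_combination (w 0) * hcs
      · simp [hf, Real.exp_log (sub_pos.2 hw')]
        linear_combination (w 1) * hcs
  rw [← hrange]
  refine isDisk_range hsm ?_ ?_
  · intro v v' h
    have h0 := (e0 v).symm.trans ((congrArg (fun w : Plane => w 0 * Real.cos α + w 1 * Real.sin α)
      h).trans (e0 v'))
    have h1 := (e1 v).symm.trans ((congrArg (fun w : Plane => w 1 * Real.cos α - w 0 * Real.sin α)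
      h).trans (e1 v'))
    ext i
    fin_cases i
    · exact Real.exp_injective (add_left_cancel h0)
    · exact h1
  · intro v w hw
    have hdf := hsm.differentiable (by simp) v
    have hx : HasFDerivAt (fun v : Plane => (c + Real.exp (v 0)))
        (Real.exp (v 0) • (EuclideanSpace.proj 0 : Plane →L[ℝ] ℝ)) v :=
      ((hasFDerivAt_coord 0 v).exp).const_add c
    have h0 := fderiv_plane_apply hdf (i := 0)
      ((hx.mul_const (Real.cos α)).sub ((hasFDerivAt_coord 1 v).mul_const (Real.sin α))) w
    have h1 := fderiv_plane_apply hdf (i := 1)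
      ((hx.mul_const (Real.sin α)).add ((hasFDerivAt_coord 1 v).mul_const (Real.cos α))) w
    rw [hw] at h0 h1
    simp only [_root_.sub_apply, _root_.add_apply,
      _root_.smul_apply, coord_apply, smul_eq_mul,
      PiLp.zero_apply] at h0 h1
    have a0 : Real.exp (v 0) * w 0 = 0 := by
      linear_combination (-Real.cos α) * h0 - Real.sin α * h1 - (Real.exp (v 0) * w 0) * hcs
    have a1 : w 1 = 0 := by
      linear_combination (Real.sin α) * h0 - Real.cos α * h1 - (w 1) * hcs
    ext i
    fin_cases i
    · exact (mul_eq_zero.1 a0).resolve_left (Real.exp_pos _).ne'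
    · exact a1

/-- The half-plane as a disk. -/
def Disk.halfPlane (α c : ℝ) : Disk := ⟨Prefact.halfPlane α c, isDisk_halfPlane α c⟩

/-- The points of the plane with polar coordinates `r₀ < r < r₁` and `α < θ < β`. -/
def sector (r₀ r₁ α β : ℝ) : Set Plane :=
  {w | ∃ r ∈ Set.Ioo r₀ r₁, ∃ θ ∈ Set.Ioo α β, w = polarPoint 0 r θ}

theorem polarPoint_zero (z : Plane) (r θ : ℝ) : polarPoint z r θ 0 = z 0 + r * Real.cos θ := rfl

theorem polarPoint_one (z : Plane) (r θ : ℝ) : polarPoint z r θ 1 = z 1 + r * Real.sin θ := rfl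

theorem polarPoint_inj {r r' θ θ' : ℝ} (hr : 0 < r) (hr' : 0 < r')
    (h : polarPoint 0 r θ = polarPoint 0 r' θ') : r = r' ∧ Real.cos (θ - θ') = 1 := by
  have h0 : r * Real.cos θ = r' * Real.cos θ' := by
    simpa [polarPoint_zero] using congrArg (fun w : Plane => w 0) h
  have h1 : r * Real.sin θ = r' * Real.sin θ' := by
    simpa [polarPoint_one] using congrArg (fun w : Plane => w 1) h
  have c := Real.sin_sq_add_cos_sq θ
  have c' := Real.sin_sq_add_cos_sq θ'
  have hrr : r = r' := by
    have : r ^ 2 = r' ^ 2 := by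
      have e1 : r ^ 2 = (r * Real.cos θ) ^ 2 + (r * Real.sin θ) ^ 2 := by
        linear_combination (-r ^ 2) * c
      rw [e1, h0, h1]
      linear_combination (r' ^ 2) * c'
    exact (pow_left_inj₀ hr.le hr'.le two_ne_zero).1 this
  subst hrr
  refine ⟨rfl, ?_⟩
  rw [Real.cos_sub, mul_left_cancel₀ hr.ne' h0, mul_left_cancel₀ hr.ne' h1]
  linear_combination c'

theorem sector_mono {r₀ r₁ α β r₀' r₁' α' β' : ℝ} (h₀ : r₀' ≤ r₀) (h₁ : r₁ ≤ r₁') (h₂ : α' ≤ α)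
    (h₃ : β ≤ β') : sector r₀ r₁ α β ⊆ sector r₀' r₁' α' β' := by
  rintro w ⟨r, hr, θ, hθ, rfl⟩
  exact ⟨r, ⟨h₀.trans_lt hr.1, hr.2.trans_le h₁⟩, θ, ⟨h₂.trans_lt hθ.1, hθ.2.trans_le h₃⟩, rfl⟩

theorem polarPoint_sub_two_pi (z : Plane) (r θ : ℝ) :
    polarPoint z r (θ - 2 * Real.pi) = polarPoint z r θ := by
  simp [polarPoint]

/-- A sector does not change when the angles are shifted by a full turn. -/
theorem sector_sub_two_pi (r₀ r₁ α β : ℝ) :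
    sector r₀ r₁ (α - 2 * Real.pi) (β - 2 * Real.pi) = sector r₀ r₁ α β := by
  ext w
  constructor
  · rintro ⟨r, hr, θ, hθ, rfl⟩
    refine ⟨r, hr, θ + 2 * Real.pi, ⟨by linarith [hθ.1], by linarith [hθ.2]⟩, ?_⟩
    rw [← polarPoint_sub_two_pi 0 r (θ + 2 * Real.pi), add_sub_cancel_right]
  · rintro ⟨r, hr, θ, hθ, rfl⟩
    exact ⟨r, hr, θ - 2 * Real.pi, ⟨by linarith [hθ.1], by linarith [hθ.2]⟩,
      (polarPoint_sub_two_pi _ _ _).symm⟩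

theorem sector_disjoint_of_radius {r₀ r₁ α β r₀' r₁' α' β' : ℝ} (h₀ : 0 ≤ r₀) (h₀' : 0 ≤ r₀')
    (h : r₁ ≤ r₀' ∨ r₁' ≤ r₀) : Disjoint (sector r₀ r₁ α β) (sector r₀' r₁' α' β') := by
  rw [Set.disjoint_left]
  rintro w ⟨r, hr, θ, hθ, rfl⟩ ⟨r', hr', θ', hθ', h'⟩
  obtain ⟨rfl, -⟩ := polarPoint_inj (h₀.trans_lt hr.1) (h₀'.trans_lt hr'.1) h'
  rcases h with h | h
  · exact absurd (hr.2.trans_le h) hr'.1.not_gt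
  · exact absurd (hr'.2.trans_le h) hr.1.not_gt

theorem sector_disjoint_of_angle {r₀ r₁ α β r₀' r₁' α' β' : ℝ} (h₀ : 0 ≤ r₀) (h₀' : 0 ≤ r₀')
    (h : β ≤ α') (h' : β' ≤ α + 2 * Real.pi) :
    Disjoint (sector r₀ r₁ α β) (sector r₀' r₁' α' β') := by
  rw [Set.disjoint_left]
  rintro w ⟨r, hr, θ, hθ, rfl⟩ ⟨r', hr', θ', hθ', e⟩
  obtain ⟨-, hc⟩ := polarPoint_inj (h₀.trans_lt hr.1) (h₀'.trans_lt hr'.1) e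
  have hpi := Real.pi_pos
  rw [Real.cos_eq_one_iff_of_lt_of_lt (by linarith [hθ.1, hθ'.2]) (by linarith [hθ.2, hθ'.1])] at hc
  linarith [hθ.2, hθ'.1]

/-- A smooth bijection from the line to an open interval. -/
noncomputable def toIoo (a b t : ℝ) : ℝ := (a + b) / 2 + (b - a) / Real.pi * Real.arctan t

theorem toIoo_mem {a b : ℝ} (h : a < b) (t : ℝ) : toIoo a b t ∈ Set.Ioo a b := by
  have hpi := Real.pi_pos
  have h1 := Real.neg_pi_div_two_lt_arctan t
  have h2 := Real.arctan_lt_pi_div_two t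
  have h3 : 0 < (b - a) / Real.pi := div_pos (sub_pos.2 h) hpi
  have e : (b - a) / Real.pi * (Real.pi / 2) = (b - a) / 2 := by field_simp
  constructor
  · have := mul_lt_mul_of_pos_left h1 h3
    rw [mul_neg, e] at this
    unfold toIoo
    linarith
  · have := mul_lt_mul_of_pos_left h2 h3
    rw [e] at this
    unfold toIoo
    linarith

theorem toIoo_surj {a b : ℝ} (h : a < b) {s : ℝ} (hs : s ∈ Set.Ioo a b) : ∃ t, toIoo a b t = s := by
  have hpi := Real.pi_pos
  have hba : 0 < b - a := sub_pos.2 h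
  refine ⟨Real.tan (Real.pi / (b - a) * (s - (a + b) / 2)), ?_⟩
  have e : Real.pi / (b - a) * ((b - a) / 2) = Real.pi / 2 := by field_simp
  have hp : 0 < Real.pi / (b - a) := div_pos hpi hba
  rw [toIoo, Real.arctan_tan]
  · field_simp
    ring
  · rw [← e, ← mul_neg]
    exact mul_lt_mul_of_pos_left (by linarith [hs.1]) hp
  · rw [← e]
    exact mul_lt_mul_of_pos_left (by linarith [hs.2]) hp

theorem toIoo_injective {a b : ℝ} (h : a < b) : Function.Injective (toIoo a b) := by
  intro s t hst
  have h3 : (b - a) / Real.pi ≠ 0 := (div_pos (sub_pos.2 h) Real.pi_pos).ne'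
  exact Real.arctan_injective (mul_left_cancel₀ h3 (add_left_cancel hst))

theorem hasDerivAt_toIoo (a b t : ℝ) :
    HasDerivAt (toIoo a b) ((b - a) / Real.pi * (1 / (1 + t ^ 2))) t :=
  ((Real.hasDerivAt_arctan t).const_mul _).const_add _

theorem isDisk_sector {r₀ r₁ α β : ℝ} (h₀ : 0 ≤ r₀) (h₁ : r₀ < r₁) (h₂ : α < β)
    (h₃ : β ≤ α + 2 * Real.pi) : IsDisk (sector r₀ r₁ α β) := by
  set ρ : Plane → ℝ := fun v => toIoo r₀ r₁ (v 0) with hρ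
  set τ : Plane → ℝ := fun v => toIoo α β (v 1) with hτ
  have hpos : ∀ v, 0 < ρ v := fun v => h₀.trans_lt (toIoo_mem h₁ _).1
  set f : Plane → Plane := fun v => polarPoint 0 (ρ v) (τ v) with hf
  have hρs : ContDiff ℝ ∞ ρ := by
    have : ContDiff ℝ ∞ (toIoo r₀ r₁) :=
      contDiff_const.add (contDiff_const.mul Real.contDiff_arctan)
    exact this.comp (EuclideanSpace.proj 0 : Plane →L[ℝ] ℝ).contDiff
  have hτs : ContDiff ℝ ∞ τ := by
    have : ContDiff ℝ ∞ (toIoo α β) := contDiff_const.add (contDiff_const.mul Real.contDiff_arctan)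
    exact this.comp (EuclideanSpace.proj 1 : Plane →L[ℝ] ℝ).contDiff
  have hsm : ContDiff ℝ ∞ f := by
    rw [contDiff_euclidean]
    intro i
    fin_cases i
    · exact contDiff_const.add (hρs.mul (Real.contDiff_cos.comp hτs))
    · exact contDiff_const.add (hρs.mul (Real.contDiff_sin.comp hτs))
  have hrange : Set.range f = sector r₀ r₁ α β := by
    ext w
    constructor
    · rintro ⟨v, rfl⟩
      exact ⟨_, toIoo_mem h₁ _, _, toIoo_mem h₂ _, rfl⟩
    · rintro ⟨r, hr, θ, hθ, rfl⟩
      obtain ⟨s, rfl⟩ := toIoo_surj h₁ hr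
      obtain ⟨t, rfl⟩ := toIoo_surj h₂ hθ
      exact ⟨!₂[s, t], rfl⟩
  rw [← hrange]
  refine isDisk_range hsm ?_ ?_
  · intro v v' h
    obtain ⟨e1, e2⟩ := polarPoint_inj (hpos v) (hpos v') h
    have b := toIoo_mem h₂ (v 1)
    have b' := toIoo_mem h₂ (v' 1)
    rw [Real.cos_eq_one_iff_of_lt_of_lt (by linarith [b.1, b'.2]) (by linarith [b.2, b'.1]),
      sub_eq_zero] at e2
    ext i
    fin_cases i
    · exact toIoo_injective h₁ e1
    · exact toIoo_injective h₂ e2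
  · intro v w hw
    have hdf := hsm.differentiable (by simp) v
    have k₁ : 0 < (r₁ - r₀) / Real.pi * (1 / (1 + v 0 ^ 2)) := by
      have := sub_pos.2 h₁
      have := Real.pi_pos
      positivity
    have k₂ : 0 < (β - α) / Real.pi * (1 / (1 + v 1 ^ 2)) := by
      have := sub_pos.2 h₂
      have := Real.pi_pos
      positivity
    have d₁ := (hasDerivAt_toIoo r₀ r₁ (v 0)).comp_hasFDerivAt v (hasFDerivAt_coord 0 v)
    have d₂ := (hasDerivAt_toIoo α β (v 1)).comp_hasFDerivAt v (hasFDerivAt_coord 1 v)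
    have g0 := fderiv_plane_apply hdf (i := 0) ((d₁.mul d₂.cos).const_add ((0 : Plane) 0)) w
    have g1 := fderiv_plane_apply hdf (i := 1) ((d₁.mul d₂.sin).const_add ((0 : Plane) 1)) w
    rw [hw] at g0 g1
    simp only [_root_.add_apply, _root_.smul_apply,
      coord_apply, smul_eq_mul, PiLp.zero_apply, Function.comp_apply] at g0 g1
    have hcs := Real.sin_sq_add_cos_sq (toIoo α β (v 1))
    set k := (r₁ - r₀) / Real.pi * (1 / (1 + v 0 ^ 2))
    set l := (β - α) / Real.pi * (1 / (1 + v 1 ^ 2))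
    set s := Real.sin (toIoo α β (v 1))
    set c := Real.cos (toIoo α β (v 1))
    have a0 : k * w 0 = 0 := by
      linear_combination (-c) * g0 - s * g1 - (k * w 0) * hcs
    have a1 : toIoo r₀ r₁ (v 0) * (l * w 1) = 0 := by
      linear_combination s * g0 - c * g1 - toIoo r₀ r₁ (v 0) * (l * w 1) * hcs
    ext i
    fin_cases i
    · exact (mul_eq_zero.1 a0).resolve_left k₁.ne'
    · exact (mul_eq_zero.1 ((mul_eq_zero.1 a1).resolve_left (hpos v).ne')).resolve_left k₂.ne'

/-- The sector as a disk. -/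
def Disk.sector (r₀ r₁ α β : ℝ) (h₀ : 0 ≤ r₀) (h₁ : r₀ < r₁) (h₂ : α < β)
    (h₃ : β ≤ α + 2 * Real.pi) : Disk :=
  ⟨Prefact.sector r₀ r₁ α β, isDisk_sector h₀ h₁ h₂ h₃⟩

theorem Disk.isOpen (D : Disk) : IsOpen (D : Set Plane) := by
  obtain ⟨e, he, -⟩ := D.isDisk
  rw [← he]
  exact e.open_source

end Prefact

/-! ### Independence of the product of the disks -/

namespace Prefact

theorem Disk.exists_mem_subset {U : Set Plane} (hU : IsOpen U) {a : Plane} (ha : a ∈ U) :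
    ∃ D : Disk, a ∈ (D : Set Plane) ∧ (D : Set Plane) ⊆ U := by
  obtain ⟨r, hr, h⟩ := Metric.isOpen_iff.1 hU a ha
  exact ⟨Disk.ball a r hr, Metric.mem_ball_self hr, h⟩

theorem Disk.nonempty (D : Disk) : (D : Set Plane).Nonempty := by
  obtain ⟨e, he, he', -⟩ := D.isDisk
  refine ⟨e.symm 0, ?_⟩
  rw [← he]
  exact e.map_target (by rw [he']; trivial)

theorem Disk.exists_disjoint {a b : Plane} (h : a ≠ b) :
    ∃ A B : Disk, a ∈ (A : Set Plane) ∧ b ∈ (B : Set Plane) ∧ Disjoint (A : Set Plane) B := by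
  obtain ⟨U, V, hU, hV, ha, hb, hd⟩ := t2_separation h
  obtain ⟨A, hA, hAU⟩ := Disk.exists_mem_subset hU ha
  obtain ⟨B, hB, hBV⟩ := Disk.exists_mem_subset hV hb
  exact ⟨A, B, hA, hB, hd.mono hAU hBV⟩

theorem isPreconnected_ne : IsPreconnected {w : Plane × Plane | w.1 ≠ w.2} := by
  have h1 : IsPreconnected ((Set.univ : Set Plane) ×ˢ ({0}ᶜ : Set Plane)) := by
    refine isPreconnected_univ.prod
      (isConnected_compl_singleton_of_one_lt_rank ?_ 0).isPreconnected
    rw [← Module.finrank_eq_rank]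
    simp
  have h2 := h1.image (fun w : Plane × Plane => (w.1, w.1 + w.2)) (by fun_prop)
  convert h2 using 1
  ext ⟨a, b⟩
  constructor
  · intro h
    exact ⟨(a, b - a), ⟨trivial, fun h' => h (sub_eq_zero.1 h').symm⟩, by simp⟩
  · rintro ⟨⟨a', v⟩, ⟨-, hv⟩, h⟩
    simp only [Prod.mk.injEq] at h
    obtain ⟨rfl, rfl⟩ := h
    intro h
    exact hv (by simpa using h)

namespace PFA

variable {K : Type u} [Field K] {F : PFA.{u, v} K} (S : F.Retracts) (hF : F.IsLocallyConstant)

theorem mul_of_subset (A A' B B' : Disk) (hA : (A : Set Plane) ⊆ A') (hB : (B : Set Plane) ⊆ B')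
    (h' : Disjoint (A' : Set Plane) B') (h : Disjoint (A : Set Plane) B) :
    mul S hF A' B' h' = mul S hF A B h := by
  refine F.HR.hom_ext fun j x hx => ?_
  refine LinearMap.ext fun y => ?_
  have := ev₂_closed S hF A' B' h' (x := F.incl A A' hA (iT S hF A x))
    (y := F.incl B B' hB (iT S hF B y)) (incl_mem A A' hA (iT_mem S hF A hx))
    (by rw [← F.incl_d, d_iT, map_zero]) (by rw [← F.incl_d, d_iT, map_zero])
  rw [pT_incl, pT_incl, pT_iT, pT_iT, ev₂_incl S A A' B B' hA hB h' h] at this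
  rw [← this, mul_eq]

theorem mul_of_mem (A A' B B' : Disk) (h : Disjoint (A : Set Plane) B)
    (h' : Disjoint (A' : Set Plane) B') {a b : Plane} (ha : a ∈ (A : Set Plane))
    (ha' : a ∈ (A' : Set Plane)) (hb : b ∈ (B : Set Plane)) (hb' : b ∈ (B' : Set Plane)) :
    mul S hF A B h = mul S hF A' B' h' := by
  obtain ⟨U, -, hU⟩ := Disk.exists_mem_subset (A.isOpen.inter A'.isOpen) ⟨ha, ha'⟩
  obtain ⟨V, -, hV⟩ := Disk.exists_mem_subset (B.isOpen.inter B'.isOpen) ⟨hb, hb'⟩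
  have hUA := hU.trans Set.inter_subset_left
  have hVB := hV.trans Set.inter_subset_left
  rw [mul_of_subset S hF U A V B hUA hVB h (h.mono hUA hVB),
    mul_of_subset S hF U A' V B' (hU.trans Set.inter_subset_right)
      (hV.trans Set.inter_subset_right) h' (h.mono hUA hVB)]

/-- The binary operation does not depend on the disjoint disks, because the space of pairs of
distinct points of the plane is connected. -/
theorem mul_eq_mul (A B A' B' : Disk) (h : Disjoint (A : Set Plane) B)
    (h' : Disjoint (A' : Set Plane) B') : mul S hF A B h = mul S hF A' B' h' := by
  have ne : ∀ (A B : Disk) (_ : Disjoint (A : Set Plane) B) {a b : Plane}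
      (_ : a ∈ (A : Set Plane)) (_ : b ∈ (B : Set Plane)), a ≠ b := by
    rintro A B h a _ ha hb rfl
    exact Set.disjoint_left.1 h ha hb
  obtain ⟨a, ha⟩ := A.nonempty
  obtain ⟨b, hb⟩ := B.nonempty
  obtain ⟨a', ha'⟩ := A'.nonempty
  obtain ⟨b', hb'⟩ := B'.nonempty
  have key : ∀ w ∈ {w : Plane × Plane | w.1 ≠ w.2}, ∀ w' ∈ {w : Plane × Plane | w.1 ≠ w.2},
      ∀ (A B A' B' : Disk) (h : Disjoint (A : Set Plane) B)
      (h' : Disjoint (A' : Set Plane) B'), w.1 ∈ (A : Set Plane) → w.2 ∈ (B : Set Plane) →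
      w'.1 ∈ (A' : Set Plane) → w'.2 ∈ (B' : Set Plane) →
        mul S hF A B h = mul S hF A' B' h' := by
    intro w hw w' hw'
    refine isPreconnected_ne.induction₂' (fun w w' => ∀ (A B A' B' : Disk)
      (h : Disjoint (A : Set Plane) B)
      (h' : Disjoint (A' : Set Plane) B'), w.1 ∈ (A : Set Plane) → w.2 ∈ (B : Set Plane) →
      w'.1 ∈ (A' : Set Plane) → w'.2 ∈ (B' : Set Plane) →
        mul S hF A B h = mul S hF A' B' h') ?_ ?_ hw hw'
    · intro w hw
      obtain ⟨U, V, hU, hV, hUV⟩ := Disk.exists_disjoint hw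
      have := (U.isOpen.prod V.isOpen).mem_nhds (Set.mk_mem_prod hU hV)
      filter_upwards [mem_nhdsWithin_of_mem_nhds this] with w' hw'
      refine ⟨fun A B A' B' h h' h1 h2 h3 h4 => ?_, fun A B A' B' h h' h1 h2 h3 h4 => ?_⟩
      · exact (mul_of_mem S hF A U B V h hUV h1 hU h2 hV).trans
          (mul_of_mem S hF U A' V B' hUV h' hw'.1 h3 hw'.2 h4)
      · exact (mul_of_mem S hF A U B V h hUV h1 hw'.1 h2 hw'.2).trans
          (mul_of_mem S hF U A' V B' hUV h' hU h3 hV h4)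
    · intro w₁ w₂ w₃ _ h2 _ h12 h23 A B A' B' h h' h1 h2' h3 h4
      obtain ⟨U, V, hU, hV, hUV⟩ := Disk.exists_disjoint h2
      exact (h12 A B U V h hUV h1 h2' hU hV).trans (h23 U V A' B' hUV h' hU hV h3 h4)
  exact key (a, b) (ne A B h ha hb) (a', b') (ne A' B' h' ha' hb') A B A' B' h h' ha hb ha' hb'

theorem halfPlane_disjoint (α c : ℝ) :
    Disjoint (Disk.halfPlane α c : Set Plane) (Disk.halfPlane (α + Real.pi) (-c)) := by
  rw [Set.disjoint_left]
  intro w hw hw'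
  have h1 : c < w 0 * Real.cos α + w 1 * Real.sin α := hw
  have h2 : -c < w 0 * Real.cos (α + Real.pi) + w 1 * Real.sin (α + Real.pi) := hw'
  rw [Real.cos_add_pi, Real.sin_add_pi] at h2
  linarith

/-- The product on `H F(ℝ²)`, computed with two half-planes. -/
noncomputable def prod : F.HR →ₗ[K] F.HR →ₗ[K] F.HR :=
  mul S hF (Disk.halfPlane 0 0) (Disk.halfPlane (0 + Real.pi) (-0)) (halfPlane_disjoint 0 0)

theorem mul_eq_prod (A B : Disk) (h : Disjoint (A : Set Plane) B) :
    mul S hF A B h = prod S hF := mul_eq_mul S hF _ _ _ _ _ _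

theorem ev₂_eq_prod (A B : Disk) (h : Disjoint (A : Set Plane) B) {j : ℤ} {x : F.obj A}
    {y : F.obj B} (hx : x ∈ (F.obj A).gr j) (hdx : (F.obj A).d x = 0) (hdy : (F.obj B).d y = 0) :
    ev₂ S A B h x y = prod S hF (pT S A x) (pT S B y) := by
  rw [ev₂_closed S hF A B h hx hdx hdy, mul_eq_prod]

end PFA
end Prefact

/-! ### Cocycles on the configurations of two points -/

namespace Prefact

open Filter Topology

/-- A pair of disjoint disks. -/
structure DiskPair where
  fst : Disk
  snd : Disk
  disjoint : Disjoint (fst : Set Plane) snd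

namespace DiskPair

instance : Preorder DiskPair where
  le p q := (p.fst : Set Plane) ⊆ q.fst ∧ (p.snd : Set Plane) ⊆ q.snd
  le_refl p := ⟨subset_rfl, subset_rfl⟩
  le_trans p q r h h' := ⟨h.1.trans h'.1, h.2.trans h'.2⟩

/-- A pair of disks is a chart of the configuration space: it contains the configurations with one
point in each disk. -/
instance : Membership (Plane × Plane) DiskPair :=
  ⟨fun p w => w.1 ∈ (p.fst : Set Plane) ∧ w.2 ∈ (p.snd : Set Plane)⟩

theorem mem_of_le {p q : DiskPair} {w : Plane × Plane} (h : p ≤ q) (hw : w ∈ p) : w ∈ q :=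
  ⟨h.1 hw.1, h.2 hw.2⟩

theorem eventually_mem {p : DiskPair} {w : Plane × Plane} (hw : w ∈ p) : ∀ᶠ w' in 𝓝 w, w' ∈ p :=
  (p.fst.isOpen.prod p.snd.isOpen).mem_nhds hw

theorem exists_le_le {p q : DiskPair} {w : Plane × Plane} (hp : w ∈ p) (hq : w ∈ q) :
    ∃ k : DiskPair, w ∈ k ∧ k ≤ p ∧ k ≤ q := by
  obtain ⟨U, hU, hU'⟩ := Disk.exists_mem_subset (p.fst.isOpen.inter q.fst.isOpen) ⟨hp.1, hq.1⟩
  obtain ⟨V, hV, hV'⟩ := Disk.exists_mem_subset (p.snd.isOpen.inter q.snd.isOpen) ⟨hp.2, hq.2⟩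
  rw [Set.subset_inter_iff] at hU' hV'
  exact ⟨⟨U, V, p.disjoint.mono hU'.1 hV'.1⟩, ⟨hU, hV⟩, ⟨hU'.1, hV'.1⟩, ⟨hU'.2, hV'.2⟩⟩

/-- The pair with its members exchanged. -/
def swap (p : DiskPair) : DiskPair := ⟨p.snd, p.fst, p.disjoint.symm⟩

theorem swap_le {p q : DiskPair} (h : p ≤ q) : p.swap ≤ q.swap := ⟨h.2, h.1⟩

theorem ext_carrier {p q : DiskPair} (h : (p.fst : Set Plane) = q.fst)
    (h' : (p.snd : Set Plane) = q.snd) : p = q := by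
  obtain ⟨⟨a, _⟩, ⟨b, _⟩, _⟩ := p
  obtain ⟨⟨a', _⟩, ⟨b', _⟩, _⟩ := q
  obtain rfl : a = a' := h
  obtain rfl : b = b' := h'
  rfl

end DiskPair

/-- A `1`-cocycle on the poset of pairs of disjoint disks. -/
structure PairCocycle (G : Type*) [AddCommGroup G] where
  val : ∀ p q : DiskPair, p ≤ q → G
  add : ∀ (p q r : DiskPair) (h : p ≤ q) (h' : q ≤ r), val p q h + val q r h' = val p r (h.trans h')

namespace PairCocycle

variable {G : Type*} [AddCommGroup G] (b : PairCocycle G)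

open Classical in
/-- The transition from the chart `p` to the chart `q` of the local system given by `b`, at a
configuration of two points that belongs to both charts. -/
noncomputable def trans (w : Plane × Plane) (p q : DiskPair) : G :=
  if h : ∃ k : DiskPair, w ∈ k ∧ k ≤ p ∧ k ≤ q then
    b.val h.choose q h.choose_spec.2.2 - b.val h.choose p h.choose_spec.2.1
  else 0

theorem trans_eq {w : Plane × Plane} {p q k : DiskPair} (hk : w ∈ k) (hp : k ≤ p) (hq : k ≤ q) :
    b.trans w p q = b.val k q hq - b.val k p hp := by
  have h : ∃ k : DiskPair, w ∈ k ∧ k ≤ p ∧ k ≤ q := ⟨k, hk, hp, hq⟩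
  rw [trans, dif_pos h]
  obtain ⟨m, -, hm, hm'⟩ := DiskPair.exists_le_le hk h.choose_spec.1
  have e1 := b.add m k p hm hp
  have e2 := b.add m k q hm hq
  have e3 := b.add m _ p hm' h.choose_spec.2.1
  have e4 := b.add m _ q hm' h.choose_spec.2.2
  rw [← e3] at e1
  rw [← e4] at e2
  rw [sub_eq_sub_iff_add_eq_add]
  have e5 : b.val h.choose q h.choose_spec.2.2 =
      b.val m k hm + b.val k q hq - b.val m h.choose hm' := by rw [e2]; abel
  have e6 : b.val h.choose p h.choose_spec.2.1 =
      b.val m k hm + b.val k p hp - b.val m h.choose hm' := by rw [e1]; abel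
  rw [e5, e6]
  abel

theorem val_self (p : DiskPair) (h : p ≤ p) : b.val p p h = 0 := by
  simpa using b.add p p p h h

theorem trans_add {w : Plane × Plane} {p q r : DiskPair} (hp : w ∈ p) (hq : w ∈ q) (hr : w ∈ r) :
    b.trans w p q + b.trans w q r = b.trans w p r := by
  obtain ⟨k, hk, hkp, hkq⟩ := DiskPair.exists_le_le hp hq
  obtain ⟨m, hm, hmk, hmr⟩ := DiskPair.exists_le_le hk hr
  rw [b.trans_eq hm (hmk.trans hkp) (hmk.trans hkq), b.trans_eq hm (hmk.trans hkq) hmr,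
    b.trans_eq hm (hmk.trans hkp) hmr]
  abel

theorem trans_self {w : Plane × Plane} {p : DiskPair} (hp : w ∈ p) : b.trans w p p = 0 := by
  rw [b.trans_eq hp le_rfl le_rfl, sub_self]

theorem trans_symm {w : Plane × Plane} {p q : DiskPair} (hp : w ∈ p) (hq : w ∈ q) :
    b.trans w q p = -b.trans w p q := by
  rw [eq_neg_iff_add_eq_zero, b.trans_add hq hp hq, b.trans_self hq]

theorem trans_of_le {w : Plane × Plane} {k p : DiskPair} (hk : w ∈ k) (h : k ≤ p) :
    b.trans w k p = b.val k p h := by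
  rw [b.trans_eq hk le_rfl h, val_self, sub_zero]

theorem trans_eventually {w : Plane × Plane} {p q : DiskPair} (hp : w ∈ p) (hq : w ∈ q) :
    ∀ᶠ w' in 𝓝 w, b.trans w' p q = b.trans w p q := by
  obtain ⟨k, hk, hkp, hkq⟩ := DiskPair.exists_le_le hp hq
  filter_upwards [DiskPair.eventually_mem hk] with w' hw'
  rw [b.trans_eq hk hkp hkq, b.trans_eq hw' hkp hkq]

/-- The transition functions are locally constant. -/
theorem trans_const {s : Set (Plane × Plane)} (hs : IsPreconnected s) {p q : DiskPair}
    (hp : ∀ w ∈ s, w ∈ p) (hq : ∀ w ∈ s, w ∈ q) {w w' : Plane × Plane} (hw : w ∈ s) (hw' : w' ∈ s) :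
    b.trans w p q = b.trans w' p q := by
  refine hs.induction₂' (fun w w' => b.trans w p q = b.trans w' p q) ?_ ?_ hw hw'
  · intro w hw
    filter_upwards [mem_nhdsWithin_of_mem_nhds (b.trans_eventually (hp w hw) (hq w hw))] with w' h
    exact ⟨h.symm, h⟩
  · intro _ _ _ _ _ _ h h'
    exact h.trans h'

end PairCocycle

/-! ### Half-plane charts -/

/-- The coordinate of a point in the direction of angle `n π / 2`. -/
noncomputable def coordDir (n : ℤ) (w : Plane) : ℝ :=
  w 0 * Real.cos (n * (Real.pi / 2)) + w 1 * Real.sin (n * (Real.pi / 2))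

theorem coordDir_polarPoint (n : ℤ) (z : Plane) (r θ : ℝ) :
    coordDir n (polarPoint z r θ) = coordDir n z + r * Real.cos (θ - n * (Real.pi / 2)) := by
  rw [coordDir, coordDir, polarPoint_zero, polarPoint_one, Real.cos_sub]
  ring

theorem coordDir_sub_four (n : ℤ) : coordDir (n - 4) = coordDir n := by
  funext w
  have : ((n - 4 : ℤ) : ℝ) * (Real.pi / 2) = n * (Real.pi / 2) - 2 * Real.pi := by push_cast; ring
  rw [coordDir, this, Real.cos_sub_two_pi, Real.sin_sub_two_pi, coordDir]

theorem coordDir_add_two (n : ℤ) (w : Plane) : coordDir (n + 2) w = -coordDir n w := by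
  have : ((n + 2 : ℤ) : ℝ) * (Real.pi / 2) = n * (Real.pi / 2) + Real.pi := by push_cast; ring
  rw [coordDir, this, Real.cos_add_pi, Real.sin_add_pi, coordDir]
  ring

/-- The chart of the pairs of points that are separated by a line perpendicular to the direction of
angle `n π / 2`. -/
noncomputable def chart (n : ℤ) (c : ℝ) : DiskPair :=
  ⟨Disk.halfPlane (n * (Real.pi / 2)) c, Disk.halfPlane (n * (Real.pi / 2) + Real.pi) (-c),
    PFA.halfPlane_disjoint _ _⟩

theorem mem_chart {n : ℤ} {c : ℝ} {w : Plane × Plane} :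
    w ∈ chart n c ↔ c < coordDir n w.1 ∧ coordDir n w.2 < c := by
  refine and_congr Iff.rfl ?_
  change -c < w.2 0 * Real.cos (_ + Real.pi) + w.2 1 * Real.sin (_ + Real.pi) ↔ _
  rw [Real.cos_add_pi, Real.sin_add_pi, coordDir]
  constructor <;> intro h <;> linarith

theorem chart_fst (n : ℤ) (c : ℝ) :
    ((chart n c).fst : Set Plane) = {w | c < coordDir n w} := rfl

theorem chart_snd (n : ℤ) (c : ℝ) :
    ((chart n c).snd : Set Plane) = {w | coordDir n w < c} := by
  ext w
  change -c < w 0 * Real.cos (_ + Real.pi) + w 1 * Real.sin (_ + Real.pi) ↔ _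
  rw [Real.cos_add_pi, Real.sin_add_pi, Set.mem_ofPred_eq, coordDir]
  constructor <;> intro h <;> linarith

theorem chart_sub_four (n : ℤ) (c : ℝ) : chart (n - 4) c = chart n c :=
  DiskPair.ext_carrier (by rw [chart_fst, chart_fst, coordDir_sub_four])
    (by rw [chart_snd, chart_snd, coordDir_sub_four])

theorem chart_swap (n : ℤ) : (chart n 0).swap = chart (n + 2) 0 := by
  refine DiskPair.ext_carrier ?_ ?_
  · change ((chart n 0).snd : Set Plane) = _
    rw [chart_fst, chart_snd]
    ext w
    rw [Set.mem_ofPred_eq, Set.mem_ofPred_eq, coordDir_add_two]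
    constructor <;> intro h <;> linarith
  · change ((chart n 0).fst : Set Plane) = _
    rw [chart_fst, chart_snd]
    ext w
    rw [Set.mem_ofPred_eq, Set.mem_ofPred_eq, coordDir_add_two]
    constructor <;> intro h <;> linarith

theorem convex_chart (n : ℤ) (c : ℝ) : Convex ℝ {w | w ∈ chart n c} := by
  have h : IsLinearMap ℝ (coordDir n) :=
    ⟨fun v w => by simp [coordDir]; ring, fun a w => by simp [coordDir]; ring⟩
  have h1 : Convex ℝ {w : Plane | c < coordDir n w} := convex_halfSpace_gt h c
  have h2 : Convex ℝ {w : Plane | coordDir n w < c} := convex_halfSpace_lt h c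
  convert h1.prod h2 using 1
  ext w
  exact mem_chart

/-- A pair of points far apart in the directions of angles `n π / 2` and `(n + 1) π / 2`. -/
noncomputable def farPair (n : ℤ) (R : ℝ) : Plane × Plane :=
  (polarPoint 0 (2 * R) (n * (Real.pi / 2) + Real.pi / 4),
    polarPoint 0 (-2 * R) (n * (Real.pi / 2) + Real.pi / 4))

theorem farPair_mem {n : ℤ} {c R : ℝ} (h : |c| < R) :
    farPair n R ∈ chart n c ∧ farPair n R ∈ chart (n + 1) c := by
  have hR : 0 < R := (abs_nonneg c).trans_lt h
  obtain ⟨h1, h2⟩ := abs_lt.1 h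
  have h0 : ∀ m, coordDir m 0 = 0 := fun m => by simp [coordDir]
  have e0 : (n : ℝ) * (Real.pi / 2) + Real.pi / 4 - n * (Real.pi / 2) = Real.pi / 4 := by ring
  have e1 : (n : ℝ) * (Real.pi / 2) + Real.pi / 4 - ((n + 1 : ℤ) : ℝ) * (Real.pi / 2) =
      -(Real.pi / 4) := by push_cast; ring
  have hs : 1 < Real.sqrt 2 := by
    rw [Real.lt_sqrt] <;> norm_num
  have h3 : R < 2 * R * (Real.sqrt 2 / 2) := by nlinarith
  have h4 : -2 * R * (Real.sqrt 2 / 2) < -R := by nlinarith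
  rw [mem_chart, mem_chart]
  simp only [farPair, coordDir_polarPoint, h0, e0, e1, Real.cos_neg, Real.cos_pi_div_four, zero_add]
  exact ⟨⟨by linarith, by linarith⟩, ⟨by linarith, by linarith⟩⟩

namespace PairCocycle

variable {G : Type*} [AddCommGroup G] (b : PairCocycle G)

theorem trans_chart {n m : ℤ} {c c' : ℝ} {w w' : Plane × Plane} (h₁ : w ∈ chart n c)
    (h₂ : w ∈ chart m c') (h₁' : w' ∈ chart n c) (h₂' : w' ∈ chart m c') :
    b.trans w (chart n c) (chart m c') = b.trans w' (chart n c) (chart m c') :=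
  b.trans_const (s := {w | w ∈ chart n c} ∩ {w | w ∈ chart m c'})
    ((convex_chart n c).inter (convex_chart m c')).isPreconnected (fun _ h => h.1) (fun _ h => h.2)
    ⟨h₁, h₂⟩ ⟨h₁', h₂'⟩

/-- The transition from the `n`-th to the `(n + 1)`-st half-plane chart. -/
noncomputable def turn (n : ℤ) : G := b.trans (farPair n 1) (chart n 0) (chart (n + 1) 0)

/-- The transition that is caused by the translation of a half-plane chart. -/
noncomputable def shift (n : ℤ) (c : ℝ) : G :=
  b.trans (farPair n (|c| + 1)) (chart n 0) (chart n c)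

theorem turn_eq {n : ℤ} {w : Plane × Plane} (h : w ∈ chart n 0) (h' : w ∈ chart (n + 1) 0) :
    b.turn n = b.trans w (chart n 0) (chart (n + 1) 0) :=
  b.trans_chart (farPair_mem (by simp)).1 (farPair_mem (by simp)).2 h h'

theorem shift_eq {n : ℤ} {c : ℝ} {w : Plane × Plane} (h : w ∈ chart n 0) (h' : w ∈ chart n c) :
    b.shift n c = b.trans w (chart n 0) (chart n c) :=
  b.trans_chart (farPair_mem (by simpa using by positivity)).1 (farPair_mem (by simp)).1 h h'

theorem turn_sub_four (n : ℤ) : b.turn (n - 4) = b.turn n := by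
  have e : n - 4 + 1 = n + 1 - 4 := by ring
  have h : farPair n 1 ∈ chart n 0 ∧ farPair n 1 ∈ chart (n + 1) 0 := farPair_mem (by simp)
  rw [b.turn_eq (n := n - 4) (w := farPair n 1) (by rw [chart_sub_four]; exact h.1)
    (by rw [e, chart_sub_four]; exact h.2), e, chart_sub_four, chart_sub_four]
  rfl

theorem shift_sub_four (n : ℤ) (c : ℝ) : b.shift (n - 4) c = b.shift n c := by
  have h0 : farPair n (|c| + 1) ∈ chart n 0 := (farPair_mem (by simpa using by positivity)).1
  have h1 : farPair n (|c| + 1) ∈ chart n c := (farPair_mem (by simp)).1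
  rw [b.shift_eq (n := n - 4) (w := farPair n (|c| + 1)) (by rw [chart_sub_four]; exact h0)
    (by rw [chart_sub_four]; exact h1), chart_sub_four, chart_sub_four]
  rfl

theorem trans_chart_same {n : ℤ} {c c' : ℝ} {w : Plane × Plane} (h : w ∈ chart n c)
    (h' : w ∈ chart n c') : b.trans w (chart n c) (chart n c') = b.shift n c' - b.shift n c := by
  set R := |c| + |c'| + 1 with hR
  have h0 : farPair n R ∈ chart n 0 := (farPair_mem (by simpa [hR] using by positivity)).1
  have h1 : farPair n R ∈ chart n c := (farPair_mem (by linarith [abs_nonneg c'])).1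
  have h2 : farPair n R ∈ chart n c' := (farPair_mem (by linarith [abs_nonneg c])).1
  rw [b.trans_chart h h' h1 h2, b.shift_eq h0 h1, b.shift_eq h0 h2, ← b.trans_add h0 h1 h2]
  abel

theorem trans_chart_succ {n : ℤ} {c c' : ℝ} {w : Plane × Plane} (h : w ∈ chart n c)
    (h' : w ∈ chart (n + 1) c') : b.trans w (chart n c) (chart (n + 1) c') =
      b.turn n + b.shift (n + 1) c' - b.shift n c := by
  set R := |c| + |c'| + 1 with hR
  have h0 : farPair n R ∈ chart n 0 ∧ farPair n R ∈ chart (n + 1) 0 :=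
    farPair_mem (by simpa [hR] using by positivity)
  have h1 : farPair n R ∈ chart n c := (farPair_mem (by linarith [abs_nonneg c'])).1
  have h2 : farPair n R ∈ chart (n + 1) c' := (farPair_mem (by linarith [abs_nonneg c])).2
  rw [b.trans_chart h h' h1 h2, b.shift_eq h0.1 h1, b.shift_eq h0.2 h2, b.turn_eq h0.1 h0.2,
    ← b.trans_add h1 h0.1 h2, ← b.trans_add h0.1 h0.2 h2, b.trans_symm h0.1 h1]
  abel

end PairCocycle

/-- Every sequence indexed by the integers is a sequence of differences. -/
theorem exists_int_primitive {G : Type*} [AddCommGroup G] (s : ℤ → G) :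
    ∃ f : ℤ → G, ∀ n, f (n + 1) = f n + s n := by
  refine ⟨fun n => match n with
    | Int.ofNat m => ∑ i ∈ Finset.range m, s i
    | Int.negSucc m => -∑ i ∈ Finset.range (m + 1), s (Int.negSucc i), fun n => ?_⟩
  match n with
  | Int.ofNat m =>
    change ∑ i ∈ Finset.range (m + 1), s i = ∑ i ∈ Finset.range m, s i + s m
    rw [Finset.sum_range_succ]
  | Int.negSucc 0 =>
    change ∑ i ∈ Finset.range 0, s i = -∑ i ∈ Finset.range 1, s (Int.negSucc i) + s (Int.negSucc 0)
    simp
  | Int.negSucc (m + 1) =>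
    change -∑ i ∈ Finset.range (m + 1), s (Int.negSucc i) =
      -∑ i ∈ Finset.range (m + 2), s (Int.negSucc i) + s (Int.negSucc (m + 1))
    rw [Finset.sum_range_succ _ (m + 1)]
    abel

namespace PairCocycle

variable {G : Type*} [AddCommGroup G] (b : PairCocycle G)

/-- A primitive of the transitions between consecutive half-plane charts. -/
noncomputable def prim : ℤ → G := (exists_int_primitive b.turn).choose

theorem prim_succ (n : ℤ) : b.prim (n + 1) = b.prim n + b.turn n :=
  (exists_int_primitive b.turn).choose_spec n

/-- The holonomy of the local system given by `b` along a clockwise loop of the first point around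
the second. -/
noncomputable def holonomy : G := -(b.turn 0 + b.turn 1 + b.turn 2 + b.turn 3)

/-- Four quarter turns clockwise contribute the holonomy, because the charts have period four. -/
theorem prim_sub_four (n : ℤ) : b.prim (n - 4) - b.prim n = b.holonomy := by
  have step : ∀ n, b.prim (n + 1 - 4) - b.prim (n + 1) = b.prim (n - 4) - b.prim n := by
    intro n
    have e : n + 1 - 4 = n - 4 + 1 := by ring
    rw [e, prim_succ, prim_succ, turn_sub_four]
    abel
  have h4 : b.prim (4 - 4) - b.prim 4 = b.holonomy := by
    have e1 := b.prim_succ 0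
    have e2 := b.prim_succ 1
    have e3 := b.prim_succ 2
    have e4 := b.prim_succ 3
    norm_num at e1 e2 e3 e4 ⊢
    rw [e4, e3, e2, e1, holonomy]
    abel
  induction n using Int.induction_on with
  | zero =>
    have a0 := step 0
    have a1 := step 1
    have a2 := step 2
    have a3 := step 3
    norm_num at a0 a1 a2 a3 h4 ⊢
    rw [← a0, ← a1, ← a2, ← a3, h4]
  | succ n ih => rw [step, ih]
  | pred n ih =>
    have := step (-n - 1)
    rw [sub_add_cancel] at this
    rw [← this, ih]

/-- The potential of `b` at a point in the domain of the chart `(n, c)`, relative to that chart. -/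
noncomputable def chartPot (n : ℤ) (c : ℝ) (w : Plane × Plane) (p : DiskPair) : G :=
  b.prim n + b.shift n c + b.trans w (chart n c) p

theorem chartPot_same {n : ℤ} {c c' : ℝ} {w : Plane × Plane} {p : DiskPair} (h : w ∈ chart n c)
    (h' : w ∈ chart n c') (hp : w ∈ p) : b.chartPot n c w p = b.chartPot n c' w p := by
  rw [chartPot, chartPot, ← b.trans_add h h' hp, b.trans_chart_same h h']
  abel

theorem chartPot_succ {n : ℤ} {c c' : ℝ} {w : Plane × Plane} {p : DiskPair} (h : w ∈ chart n c)
    (h' : w ∈ chart (n + 1) c') (hp : w ∈ p) :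
    b.chartPot n c w p = b.chartPot (n + 1) c' w p := by
  rw [chartPot, chartPot, ← b.trans_add h h' hp, b.trans_chart_succ h h', prim_succ]
  abel

theorem chartPot_eq {n n' : ℤ} {c c' θ : ℝ} {w : Plane × Plane} {p : DiskPair}
    (hn : |θ - n * (Real.pi / 2)| < Real.pi / 2) (hn' : |θ - n' * (Real.pi / 2)| < Real.pi / 2)
    (h : w ∈ chart n c) (h' : w ∈ chart n' c') (hp : w ∈ p) :
    b.chartPot n c w p = b.chartPot n' c' w p := by
  have hpi := Real.pi_pos
  rw [abs_lt] at hn hn'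
  have h1 : ((n' - n : ℤ) : ℝ) < (2 : ℤ) := by
    push_cast
    by_contra! hc
    nlinarith
  have h2 : ((n - n' : ℤ) : ℝ) < (2 : ℤ) := by
    push_cast
    by_contra! hc
    nlinarith
  rw [Int.cast_lt] at h1 h2
  obtain e | e | e : n' = n ∨ n' = n + 1 ∨ n = n' + 1 := by omega
  · subst e; exact b.chartPot_same h h' hp
  · subst e; exact b.chartPot_succ h h' hp
  · subst e; exact (b.chartPot_succ h' h hp).symm

/-- The potential of `b` on the configurations of the points `z + r e^{iθ}` and `z`, as a function
of the polar coordinates: a trivialization of the local system on the universal covering. It is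
computed in the half-plane chart of the nearest quarter turn, cut halfway between the points. -/
noncomputable def pot (z : Plane) (r θ : ℝ) (p : DiskPair) : G :=
  b.chartPot (round (θ / (Real.pi / 2)))
    (coordDir (round (θ / (Real.pi / 2))) z +
      r * Real.cos (θ - round (θ / (Real.pi / 2)) * (Real.pi / 2)) / 2) (polarPoint z r θ, z) p

theorem mem_chart_polar {z : Plane} {r θ : ℝ} (hr : 0 < r) {n : ℤ}
    (hn : |θ - n * (Real.pi / 2)| < Real.pi / 2) :
    (polarPoint z r θ, z) ∈
      chart n (coordDir n z + r * Real.cos (θ - n * (Real.pi / 2)) / 2) := by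
  rw [abs_lt] at hn
  have hc : 0 < r * Real.cos (θ - n * (Real.pi / 2)) :=
    mul_pos hr (Real.cos_pos_of_mem_Ioo ⟨hn.1, hn.2⟩)
  rw [mem_chart, coordDir_polarPoint]
  exact ⟨by linarith, by linarith⟩

theorem abs_round_lt (θ : ℝ) :
    |θ - round (θ / (Real.pi / 2)) * (Real.pi / 2)| < Real.pi / 2 := by
  have hpi : 0 < Real.pi / 2 := by have := Real.pi_pos; positivity
  have h := abs_sub_round (θ / (Real.pi / 2))
  have e : θ - round (θ / (Real.pi / 2)) * (Real.pi / 2) =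
      (θ / (Real.pi / 2) - round (θ / (Real.pi / 2))) * (Real.pi / 2) := by
    rw [sub_mul, div_mul_cancel₀ _ hpi.ne']
  rw [e, abs_mul, abs_of_pos hpi]
  nlinarith

/-- Every half-plane chart whose direction is within a right angle of `θ` computes the potential.
-/
theorem pot_eq {z : Plane} {r θ : ℝ} (hr : 0 < r) {n : ℤ} {c : ℝ} {p : DiskPair}
    (hn : |θ - n * (Real.pi / 2)| < Real.pi / 2) (h : (polarPoint z r θ, z) ∈ chart n c)
    (hp : (polarPoint z r θ, z) ∈ p) : b.pot z r θ p = b.chartPot n c (polarPoint z r θ, z) p :=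
  b.chartPot_eq (abs_round_lt θ) hn (mem_chart_polar hr (abs_round_lt θ)) h hp

theorem pot_sub_pot {z : Plane} {r θ : ℝ} (hr : 0 < r) {k p : DiskPair}
    (hk : (polarPoint z r θ, z) ∈ k) (h : k ≤ p) :
    b.pot z r θ p - b.pot z r θ k = b.val k p h := by
  have hc := mem_chart_polar (z := z) hr (abs_round_lt θ)
  rw [b.pot_eq hr (abs_round_lt θ) hc hk, b.pot_eq hr (abs_round_lt θ) hc (DiskPair.mem_of_le h hk),
    chartPot, chartPot, ← b.trans_add hc hk (DiskPair.mem_of_le h hk), b.trans_of_le hk h]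
  abel

/-- The monodromy of the potential is the holonomy. -/
theorem pot_sub_two_pi {z : Plane} {r θ : ℝ} (hr : 0 < r) {p : DiskPair}
    (hp : (polarPoint z r θ, z) ∈ p) :
    b.pot z r (θ - 2 * Real.pi) p - b.pot z r θ p = b.holonomy := by
  obtain ⟨n, c, hn, hc⟩ : ∃ (n : ℤ) (c : ℝ), |θ - n * (Real.pi / 2)| < Real.pi / 2 ∧
    (polarPoint z r θ, z) ∈ chart n c := ⟨_, _, abs_round_lt θ, mem_chart_polar hr (abs_round_lt θ)⟩
  have e : θ - 2 * Real.pi - ((n - 4 : ℤ) : ℝ) * (Real.pi / 2) = θ - n * (Real.pi / 2) := by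
    push_cast; ring
  rw [b.pot_eq hr hn hc hp, b.pot_eq (n := n - 4) (c := c) hr (by rw [e]; exact hn)
    (by rw [polarPoint_sub_two_pi, chart_sub_four]; exact hc)
    (by rw [polarPoint_sub_two_pi]; exact hp), polarPoint_sub_two_pi, chartPot, chartPot,
    chart_sub_four, shift_sub_four, ← b.prim_sub_four n]
  abel

/-- The potential relative to `p` is constant along paths inside of `p`. -/
theorem pot_const {z : Plane} {r θ : ℝ → ℝ} (hr : Continuous r) (hθ : Continuous θ) {t₀ t₁ : ℝ}
    (h01 : t₀ ≤ t₁) (hpos : ∀ t ∈ Set.Icc t₀ t₁, 0 < r t) {p : DiskPair}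
    (hp : ∀ t ∈ Set.Icc t₀ t₁, (polarPoint z (r t) (θ t), z) ∈ p) :
    b.pot z (r t₀) (θ t₀) p = b.pot z (r t₁) (θ t₁) p := by
  have hcont : Continuous fun t => (polarPoint z (r t) (θ t), z) := by
    refine Continuous.prodMk ?_ continuous_const
    refine continuous_const.add ?_
    refine (PiLp.continuous_toLp 2 _).comp ?_
    refine continuous_pi fun i => ?_
    fin_cases i
    · exact hr.mul (Real.continuous_cos.comp hθ)
    · exact hr.mul (Real.continuous_sin.comp hθ)
  refine (isPreconnected_Icc (a := t₀) (b := t₁)).induction₂'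
    (fun s t => b.pot z (r s) (θ s) p = b.pot z (r t) (θ t) p) ?_ ?_
    (Set.left_mem_Icc.2 h01) (Set.right_mem_Icc.2 h01)
  · intro t ht
    obtain ⟨n, c, hn, hc⟩ : ∃ (n : ℤ) (c : ℝ), |θ t - n * (Real.pi / 2)| < Real.pi / 2 ∧
      (polarPoint z (r t) (θ t), z) ∈ chart n c :=
      ⟨_, _, abs_round_lt _, mem_chart_polar (hpos t ht) (abs_round_lt _)⟩
    have h1 : ∀ᶠ s in 𝓝 t, |θ s - n * (Real.pi / 2)| < Real.pi / 2 :=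
      (by fun_prop : Continuous fun s => |θ s - n * (Real.pi / 2)|).continuousAt.eventually_lt
        continuousAt_const hn
    have h2 := hcont.continuousAt.eventually (DiskPair.eventually_mem hc)
    have h3 := hcont.continuousAt.eventually (b.trans_eventually hc (hp t ht))
    filter_upwards [mem_nhdsWithin_of_mem_nhds h1, mem_nhdsWithin_of_mem_nhds h2,
      mem_nhdsWithin_of_mem_nhds h3, self_mem_nhdsWithin] with s e1 e2 e3 hs
    have : b.pot z (r t) (θ t) p = b.pot z (r s) (θ s) p := by
      rw [b.pot_eq (hpos t ht) hn hc (hp t ht), b.pot_eq (hpos s hs) e1 e2 (hp s hs), chartPot,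
        chartPot, e3]
    exact ⟨this, this.symm⟩
  · intro _ _ _ _ _ _ h h'
    exact h.trans h'

/-- The values of a cocycle along a path of the first point inside of `p` from `k` to `k'`. -/
theorem val_sub_val {z : Plane} {r θ : ℝ → ℝ} (hr : Continuous r) (hθ : Continuous θ) {t₀ t₁ : ℝ}
    (h01 : t₀ ≤ t₁) (hpos : ∀ t ∈ Set.Icc t₀ t₁, 0 < r t) {p k k' : DiskPair}
    (hp : ∀ t ∈ Set.Icc t₀ t₁, (polarPoint z (r t) (θ t), z) ∈ p) (hk : k ≤ p) (hk' : k' ≤ p)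
    (h₀ : (polarPoint z (r t₀) (θ t₀), z) ∈ k) (h₁ : (polarPoint z (r t₁) (θ t₁), z) ∈ k') :
    b.val k p hk - b.val k' p hk' = b.pot z (r t₁) (θ t₁) k' - b.pot z (r t₀) (θ t₀) k := by
  rw [← b.pot_sub_pot (hpos _ (Set.left_mem_Icc.2 h01)) h₀ hk,
    ← b.pot_sub_pot (hpos _ (Set.right_mem_Icc.2 h01)) h₁ hk', b.pot_const hr hθ h01 hpos hp]
  abel

/-- The cocycle with the two points exchanged. -/
def swap : PairCocycle G where
  val p q h := b.val p.swap q.swap (DiskPair.swap_le h)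
  add _ _ _ _ _ := b.add _ _ _ _ _

/-- Exchanging the two points is a half turn, which shifts the half-plane charts by two. -/
theorem turn_swap (n : ℤ) : b.swap.turn n = b.turn (n + 2) := by
  have h : farPair n 1 ∈ chart n 0 ∧ farPair n 1 ∈ chart (n + 1) 0 := farPair_mem (by simp)
  obtain ⟨k, hk, hkp, hkq⟩ := DiskPair.exists_le_le h.1 h.2
  have e : n + 2 + 1 = n + 1 + 2 := by ring
  have hk' : (farPair n 1).swap ∈ k.swap := ⟨hk.2, hk.1⟩
  have h1 : k.swap ≤ chart (n + 2) 0 := by rw [← chart_swap]; exact DiskPair.swap_le hkp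
  have h2 : k.swap ≤ chart (n + 2 + 1) 0 := by rw [e, ← chart_swap]; exact DiskPair.swap_le hkq
  rw [turn, b.swap.trans_eq hk hkp hkq, b.turn_eq (DiskPair.mem_of_le h1 hk')
    (DiskPair.mem_of_le h2 hk'), b.trans_eq hk' h1 h2]
  simp only [swap, chart_swap, e]

/-- A turn of the first point around the second is also one of the second around the first. -/
theorem holonomy_swap : b.swap.holonomy = b.holonomy := by
  have e0 := b.turn_swap 0
  have e1 := b.turn_swap 1
  have e2 := b.turn_swap 2
  have e3 := b.turn_swap 3
  have f2 := b.turn_sub_four 4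
  have f3 := b.turn_sub_four 5
  norm_num at e0 e1 e2 e3 f2 f3
  rw [holonomy, holonomy, e0, e1, e2, e3, ← f2, ← f3]
  abel

theorem holonomy_congr {b b' : PairCocycle G} (e : G →+ G)
    (h : ∀ p q hpq, b'.val p q hpq = e (b.val p q hpq)) : b'.holonomy = e b.holonomy := by
  have ht : ∀ n, b'.turn n = e (b.turn n) := by
    intro n
    have hm : farPair n 1 ∈ chart n 0 ∧ farPair n 1 ∈ chart (n + 1) 0 := farPair_mem (by simp)
    obtain ⟨k, hk, hkp, hkq⟩ := DiskPair.exists_le_le hm.1 hm.2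
    rw [turn, turn, b'.trans_eq hk hkp hkq, b.trans_eq hk hkp hkq, h, h, map_sub]
  simp only [holonomy, ht, map_neg, map_add]

end PairCocycle
end Prefact

/-! ### The bracket as a holonomy -/

namespace Prefact
namespace PFA

variable {K : Type u} [Field K] {F : PFA.{u, v} K} (S : F.Retracts) (hF : F.IsLocallyConstant)

/-- The failure of `η` to be additive is a cocycle of class `0`. -/
theorem d_eta_sub (A U T : Disk) (h : (A : Set Plane) ⊆ U) (h' : (U : Set Plane) ⊆ T) (x : F.HR) :
    (F.obj T).d (eta S hF A T (h.trans h') x - eta S hF U T h' x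
      - F.incl U T h' (eta S hF A U h x)) = 0 := by
  rw [map_sub, map_sub, d_eta, d_eta, ← F.incl_d, d_eta, map_sub, F.incl_incl]
  abel

theorem eta_sub_mem (A U T : Disk) (h : (A : Set Plane) ⊆ U) (h' : (U : Set Plane) ⊆ T) {k : ℤ}
    {x : F.HR} (hx : x ∈ F.HR.gr k) : eta S hF A T (h.trans h') x - eta S hF U T h' x
      - F.incl U T h' (eta S hF A U h x) ∈ (F.obj T).gr (k - 1) :=
  Submodule.sub_mem _ (Submodule.sub_mem _ (eta_mem S hF _ _ _ hx) (eta_mem S hF _ _ _ hx))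
    (incl_mem _ _ _ (eta_mem S hF _ _ _ hx))

theorem pT_eta_sub (A U T : Disk) (h : (A : Set Plane) ⊆ U) (h' : (U : Set Plane) ⊆ T) (x : F.HR) :
    pT S T (eta S hF A T (h.trans h') x - eta S hF U T h' x
      - F.incl U T h' (eta S hF A U h x)) = 0 := by
  rw [map_sub, map_sub, pT_eta, pT_eta, pT_incl, pT_eta, sub_zero, sub_zero]

theorem ev₂_eta_left (A U T B : Disk) (h : (A : Set Plane) ⊆ U) (h' : (U : Set Plane) ⊆ T)
    (hTB : Disjoint (T : Set Plane) B) (hUB : Disjoint (U : Set Plane) B) {k : ℤ} {x : F.HR}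
    (hx : x ∈ F.HR.gr k) {y : F.obj B} (hy : (F.obj B).d y = 0) :
    ev₂ S T B hTB (eta S hF A T (h.trans h') x) y =
      ev₂ S T B hTB (eta S hF U T h' x) y + ev₂ S U B hUB (eta S hF A U h x) y := by
  have := ev₂_eq_prod S hF T B hTB (eta_sub_mem S hF A U T h h' hx) (d_eta_sub S hF A U T h h' x) hy
  rw [pT_eta_sub, map_zero, LinearMap.zero_apply, map_sub, map_sub, LinearMap.sub_apply,
    LinearMap.sub_apply, ev₂_incl_left S U T B h' hTB hUB, sub_sub, sub_eq_zero] at this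
  exact this

theorem ev₂_eta_right (A U T B : Disk) (h : (A : Set Plane) ⊆ U) (h' : (U : Set Plane) ⊆ T)
    (hTB : Disjoint (B : Set Plane) T) (hUB : Disjoint (B : Set Plane) U) {k : ℤ} {y : F.obj B}
    (hy : y ∈ (F.obj B).gr k) (hdy : (F.obj B).d y = 0) (x : F.HR) :
    ev₂ S B T hTB y (eta S hF A T (h.trans h') x) =
      ev₂ S B T hTB y (eta S hF U T h' x) + ev₂ S B U hUB y (eta S hF A U h x) := by
  have := ev₂_eq_prod S hF B T hTB hy hdy (d_eta_sub S hF A U T h h' x)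
  rw [pT_eta_sub, map_zero, map_sub, map_sub, ev₂_incl_right S B U T h' hTB hUB, sub_sub,
    sub_eq_zero] at this
  exact this

/-- Interchange of the homotopies that move `x` from `A` to `U` and `y` from `B` to `V`. -/
theorem ev₂_eta_eta (A U B V : Disk) (hA : (A : Set Plane) ⊆ U) (hB : (B : Set Plane) ⊆ V)
    (h : Disjoint (U : Set Plane) V) (h₁ : Disjoint (U : Set Plane) B)
    (h₂ : Disjoint (A : Set Plane) V) {j : ℤ} {x : F.HR} (hx : x ∈ F.HR.gr j) (y : F.HR) :
    ev₂ S U B h₁ (eta S hF A U hA x) (iT S hF B y)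
        + sgn K j • ev₂ S U V h (iT S hF U x) (eta S hF B V hB y) =
      ev₂ S U V h (eta S hF A U hA x) (iT S hF V y)
        + sgn K j • ev₂ S A V h₂ (iT S hF A x) (eta S hF B V hB y) := by
  have := congrArg (sgn K j • ·)
    (ev₂_d S U V h (eta_mem S hF A U hA hx) (eta S hF B V hB y))
  simp only [smul_add, smul_smul, sgn_mul_sgn_sub_one, smul_zero, neg_smul, one_smul] at this
  rw [d_eta, d_eta, map_sub, map_sub, LinearMap.sub_apply, ev₂_incl_left S A U V hA h h₂,
    ev₂_incl_right S U B V hB h h₁, smul_sub] at this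
  rw [← sub_eq_zero, ← this]
  abel

/-- The `1`-cocycle on the poset of pairs of disjoint disks that compares the representatives
`ĩ x ⊗ ĩ y` over the pairs. -/
noncomputable def cocycle {j : ℤ} {x : F.HR} (hx : x ∈ F.HR.gr j) (y : F.HR) :
    PairCocycle F.HR where
  val p q h :=
    ev₂ S q.fst p.snd (q.disjoint.mono_right h.2) (eta S hF p.fst q.fst h.1 x) (iT S hF p.snd y)
      + sgn K j • ev₂ S q.fst q.snd q.disjoint (iT S hF q.fst x) (eta S hF p.snd q.snd h.2 y)
  add p q r h h' := by
    have e1 := ev₂_eta_left S hF p.fst q.fst r.fst p.snd h.1 h'.1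
      (r.disjoint.mono_right (h.2.trans h'.2)) (q.disjoint.mono_right h.2) hx (d_iT S hF p.snd y)
    have e2 := ev₂_eta_right S hF p.snd q.snd r.snd r.fst h.2 h'.2 r.disjoint
      (r.disjoint.mono_right h'.2) (iT_mem S hF r.fst hx) (d_iT S hF r.fst x) y
    have e3 := ev₂_eta_eta S hF q.fst r.fst p.snd q.snd h'.1 h.2 (r.disjoint.mono_right h'.2)
      (r.disjoint.mono_right (h.2.trans h'.2)) q.disjoint hx y
    rw [e1, e2, smul_add]
    rw [← sub_eq_zero] at e3 ⊢
    rw [← neg_eq_zero, ← e3]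
    abel

theorem cocycle_val {j : ℤ} {x : F.HR} (hx : x ∈ F.HR.gr j) (y : F.HR) (p q : DiskPair)
    (h : p ≤ q) : (cocycle S hF hx y).val p q h =
    ev₂ S q.fst p.snd (q.disjoint.mono_right h.2) (eta S hF p.fst q.fst h.1 x) (iT S hF p.snd y)
      + sgn K j • ev₂ S q.fst q.snd q.disjoint (iT S hF q.fst x) (eta S hF p.snd q.snd h.2 y) := rfl

theorem cocycle_val_of_snd {j : ℤ} {x : F.HR} (hx : x ∈ F.HR.gr j) (y : F.HR) (A U B : Disk)
    (hA : (A : Set Plane) ⊆ U) (hU : Disjoint (U : Set Plane) B) (h : Disjoint (A : Set Plane) B)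
    (hle : (⟨A, B, h⟩ : DiskPair) ≤ ⟨U, B, hU⟩) :
    (cocycle S hF hx y).val ⟨A, B, h⟩ ⟨U, B, hU⟩ hle =
      ev₂ S U B hU (eta S hF A U hA x) (iT S hF B y) := by
  rw [cocycle_val, eta_self, map_zero, smul_zero, add_zero]

/-- The cocycle on a path of the first point inside of `U`. -/
theorem ev₂_path {j : ℤ} {x : F.HR} (hx : x ∈ F.HR.gr j) (y : F.HR) {U A A' B : Disk}
    (hA : (A : Set Plane) ⊆ U) (hA' : (A' : Set Plane) ⊆ U) (hU : Disjoint (U : Set Plane) B)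
    {z : Plane} {r θ : ℝ → ℝ} (hr : Continuous r) (hθ : Continuous θ) {t₀ t₁ : ℝ} (h01 : t₀ ≤ t₁)
    (hpos : ∀ t ∈ Set.Icc t₀ t₁, 0 < r t) (hz : z ∈ (B : Set Plane))
    (hp : ∀ t ∈ Set.Icc t₀ t₁, polarPoint z (r t) (θ t) ∈ (U : Set Plane))
    (h₀ : polarPoint z (r t₀) (θ t₀) ∈ (A : Set Plane))
    (h₁ : polarPoint z (r t₁) (θ t₁) ∈ (A' : Set Plane)) :
    ev₂ S U B hU (path S hF U A A' hA hA' x) (iT S hF B y) =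
      (cocycle S hF hx y).pot z (r t₁) (θ t₁) ⟨A', B, hU.mono_left hA'⟩
        - (cocycle S hF hx y).pot z (r t₀) (θ t₀) ⟨A, B, hU.mono_left hA⟩ := by
  have := (cocycle S hF hx y).val_sub_val hr hθ h01 hpos (p := ⟨U, B, hU⟩)
    (k := ⟨A, B, hU.mono_left hA⟩) (k' := ⟨A', B, hU.mono_left hA'⟩) (fun t ht => ⟨hp t ht, hz⟩)
    ⟨hA, subset_rfl⟩ ⟨hA', subset_rfl⟩ ⟨h₀, hz⟩ ⟨h₁, hz⟩
  rw [cocycle_val_of_snd, cocycle_val_of_snd] at this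
  rw [← this, path_apply, map_sub, LinearMap.sub_apply]

/-- The four terms of `L` combine to a path of `x` in `Du` and a path back in `Dd`. -/
theorem L_apply (c : AnnularConfiguration) (x y : F.HR) :
    L S hF c x y =
      ev₂ S c.Du c.Dt c.disjoint_u (path S hF c.Du c.D₁ c.D₂ c.sub₁u c.sub₂u x) (iT S hF c.Dt y)
        + ev₂ S c.Dd c.Dt c.disjoint_d (path S hF c.Dd c.D₂ c.D₁ c.sub₂d c.sub₁d x)
          (iT S hF c.Dt y) := by
  simp only [L, LinearMap.add_apply, LinearMap.sub_apply]
  rw [path_apply, path_apply, map_sub, map_sub, LinearMap.sub_apply, LinearMap.sub_apply,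
    massey_eq S hF _ _ _ _ _ _ c.disjoint_u, massey_eq S hF _ _ _ _ _ _ c.disjoint_u,
    massey_eq S hF _ _ _ _ _ _ c.disjoint_d, massey_eq S hF _ _ _ _ _ _ c.disjoint_d]
  abel

/-- The bracket is the holonomy of the comparison cocycle: the two paths form a clockwise loop. -/
theorem L_eq_holonomy (c : AnnularConfiguration) {j : ℤ} {x : F.HR} (hx : x ∈ F.HR.gr j)
    (y : F.HR) : L S hF c x y = (cocycle S hF hx y).holonomy := by
  obtain ⟨z, hz, r, θ, hr, hθ, hpos, h1, hu, h2, hd, er, eθ⟩ := c.clockwise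
  have h1' : polarPoint z (r 2) (θ 2) ∈ (c.D₁ : Set Plane) := by
    rw [er, eθ, polarPoint_sub_two_pi]
    exact h1
  rw [L_apply, ev₂_path S hF hx y c.sub₁u c.sub₂u c.disjoint_u hr hθ zero_le_one
    (fun t _ => hpos t) hz hu h1 h2, ev₂_path S hF hx y c.sub₂d c.sub₁d c.disjoint_d hr hθ
    one_le_two (fun t _ => hpos t) hz hd h2 h1', er, eθ,
    ← (cocycle S hF hx y).pot_sub_two_pi (hpos 0)
      (p := ⟨c.D₁, c.Dt, c.disjoint_u.mono_left c.sub₁u⟩) ⟨h1, hz⟩]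
  abel

theorem L_eq_L (c c' : AnnularConfiguration) : L S hF c = L S hF c' := by
  refine F.HR.hom_ext fun j x hx => LinearMap.ext fun y => ?_
  rw [L_eq_holonomy S hF c hx, L_eq_holonomy S hF c' hx]

theorem L_mem (c : AnnularConfiguration) {j k : ℤ} {x y : F.HR} (hx : x ∈ F.HR.gr j)
    (hy : y ∈ F.HR.gr k) : L S hF c x y ∈ F.HR.gr (j + k - 1) := by
  rw [L_apply, add_sub_right_comm]
  exact Submodule.add_mem _ (ev₂_mem S _ _ _ (path_mem S hF _ _ _ _ _ hx) (iT_mem S hF _ hy))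
    (ev₂_mem S _ _ _ (path_mem S hF _ _ _ _ _ hx) (iT_mem S hF _ hy))

/-- Exchanging the points exchanges the arguments, up to the Koszul sign. -/
theorem cocycle_swap_val {j k : ℤ} {x y : F.HR} (hx : x ∈ F.HR.gr j) (hy : y ∈ F.HR.gr k)
    (p q : DiskPair) (h : p ≤ q) : (cocycle S hF hy x).val p q h =
      sgn K (j * k) • (cocycle S hF hx y).swap.val p q h := by
  have e := ev₂_eta_eta S hF p.snd q.snd p.fst q.fst h.2 h.1 q.disjoint.symm
    (q.disjoint.symm.mono_right h.1) (q.disjoint.symm.mono_left h.2) hx y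
  change _ = sgn K (j * k) • (_ + _)
  refine Eq.trans ?_ (congrArg (sgn K (j * k) • ·) e.symm)
  rw [cocycle_val, ev₂_comm S q.fst p.snd _ (q.disjoint.symm.mono_left h.2)
    (eta_mem S hF p.fst q.fst h.1 hy) (iT_mem S hF p.snd hx),
    ev₂_comm S q.fst q.snd _ q.disjoint.symm (iT_mem S hF q.fst hy)
      (eta_mem S hF p.snd q.snd h.2 hx), smul_add, smul_smul, smul_smul, add_comm, ← sgn_add,
      ← sgn_add]
  congr 2
  · rw [show k + k * (j - 1) = j * k by ring]
  · rw [show (k - 1) * j = j * k - j by ring, sgn_sub, ← sgn_add]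

theorem L_symm (c : AnnularConfiguration) {j k : ℤ} {x y : F.HR} (hx : x ∈ F.HR.gr j)
    (hy : y ∈ F.HR.gr k) : L S hF c y x = sgn K (j * k) • L S hF c x y := by
  rw [L_eq_holonomy S hF c hx, L_eq_holonomy S hF c hy, ← (cocycle S hF hx y).holonomy_swap]
  exact PairCocycle.holonomy_congr
    (sgn K (j * k) • LinearMap.id (R := K) (M := F.HR)).toAddMonoidHom
    (fun p q h => cocycle_swap_val S hF hx hy p q h)

end PFA
end Prefact

/-! ### Formal sums of elements over different disks -/

namespace Prefact
namespace PFA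

variable {K : Type u} [Field K] (F : PFA.{u, v} K)

/-- Needed to form direct sums over the disks. -/
noncomputable instance : DecidableEq Disk := Classical.decEq _

/-- Formal sums of elements of the cochain complexes of different disks. -/
abbrev Chain : Type v := DirectSum Disk fun U => F.obj U

namespace Chain

variable {F} {V : Type*} [AddCommMonoid V] [Module K V]

/-- An element of `F(U)` as a chain. -/
noncomputable def of (U : Disk) : F.obj U →ₗ[K] F.Chain := DirectSum.lof K Disk (fun U => F.obj U) U

/-- The linear map on chains that is given by a family of linear maps. -/
noncomputable def lift (f : ∀ U, F.obj U →ₗ[K] V) : F.Chain →ₗ[K] V := DirectSum.toModule K Disk V f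

@[simp] theorem lift_of (f : ∀ U, F.obj U →ₗ[K] V) (U : Disk) (x : F.obj U) :
    lift f (of U x) = f U x := DirectSum.toModule_lof ..

/-- The differential, applied to each summand of a chain. -/
noncomputable def bdry : F.Chain →ₗ[K] F.Chain := lift fun U => of U ∘ₗ (F.obj U).d

theorem bdry_of (U : Disk) (x : F.obj U) : bdry (of U x) = of U ((F.obj U).d x) := lift_of ..

/-- The sum of a chain of elements in subdisks of `T`; summands in other disks are dropped. -/
noncomputable def sumIn (T : Disk) : F.Chain →ₗ[K] F.obj T :=
  open Classical in lift fun U => if h : (U : Set Plane) ⊆ T then F.incl U T h else 0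

theorem sumIn_of {U T : Disk} (h : (U : Set Plane) ⊆ T) (x : F.obj U) :
    sumIn T (of U x) = F.incl U T h x := by
  rw [sumIn, lift_of, dif_pos h]

/-- The product in `F(T)` of a chain with an element of `F(Y)`; summands in disks that do not fit
are dropped. -/
noncomputable def mulIn (Y T : Disk) : F.Chain →ₗ[K] F.obj Y →ₗ[K] F.obj T :=
  open Classical in lift fun U => if h : Disk.Fits ![U, Y] T then F.op₂ U Y T h else 0

theorem mulIn_of {U Y T : Disk} (h : Disk.Fits ![U, Y] T) (x : F.obj U) (y : F.obj Y) :
    mulIn Y T (of U x) y = F.op₂ U Y T h x y := by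
  rw [mulIn, lift_of, dif_pos h]

/-- The disks `U`, `Y` and `Z` are mutually disjoint. -/
def Disjoint₃ (U Y Z : Disk) : Prop :=
  Disjoint (U : Set Plane) Y ∧ Disjoint (U : Set Plane) Z ∧ Disjoint (Y : Set Plane) Z

variable (S : F.Retracts)

/-- The product of a chain with an element, followed by the projection to cohomology. -/
noncomputable def ev₂ (Y : Disk) : F.Chain →ₗ[K] F.obj Y →ₗ[K] F.HR :=
  open Classical in lift fun U => if h : Disjoint (U : Set Plane) Y then PFA.ev₂ S U Y h else 0

theorem ev₂_of {U Y : Disk} (h : Disjoint (U : Set Plane) Y) (x : F.obj U) (y : F.obj Y) :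
    ev₂ S Y (of U x) y = PFA.ev₂ S U Y h x y := by
  rw [ev₂, lift_of, dif_pos h]

/-- The product of a chain with two elements, followed by the projection to cohomology. -/
noncomputable def ev₃ (Y Z : Disk) : F.Chain →ₗ[K] F.obj Y →ₗ[K] F.obj Z →ₗ[K] F.HR :=
  open Classical in
    lift fun U => if h : Disjoint₃ U Y Z then PFA.ev₃ S U Y Z h.1 h.2.1 h.2.2 else 0

theorem ev₃_of {U Y Z : Disk} (h : Disjoint₃ U Y Z) (x : F.obj U) (y : F.obj Y) (z : F.obj Z) :
    ev₃ S Y Z (of U x) y z = PFA.ev₃ S U Y Z h.1 h.2.1 h.2.2 x y z := by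
  rw [ev₃, lift_of, dif_pos h]

/-- The chains of degree `m` in disks with the property `P`. -/
def chains (P : Disk → Prop) (m : ℤ) : Submodule K F.Chain :=
  Submodule.span K {c | ∃ U, P U ∧ ∃ x ∈ (F.obj U).gr m, c = of U x}

variable {S}

theorem of_mem {P : Disk → Prop} {m : ℤ} {U : Disk} (hU : P U) {x : F.obj U}
    (hx : x ∈ (F.obj U).gr m) : of U x ∈ chains (F := F) P m :=
  Submodule.subset_span ⟨U, hU, x, hx, rfl⟩

/-- Linear maps on chains that agree on the summands agree. -/
theorem map_eq_map {P : Disk → Prop} {m : ℤ} {c : F.Chain} (hc : c ∈ chains P m)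
    (f g : F.Chain →ₗ[K] V) (h : ∀ U, P U → ∀ x ∈ (F.obj U).gr m, f (of U x) = g (of U x)) :
    f c = g c := by
  have : chains P m ≤ LinearMap.eqLocus f g := by
    refine Submodule.span_le.2 ?_
    rintro _ ⟨U, hU, x, hx, rfl⟩
    exact h U hU x hx
  exact this hc

theorem map_mem {P : Disk → Prop} {m : ℤ} {c : F.Chain} (hc : c ∈ chains P m)
    (f : F.Chain →ₗ[K] V) (N : Submodule K V)
    (h : ∀ U, P U → ∀ x ∈ (F.obj U).gr m, f (of U x) ∈ N) : f c ∈ N := by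
  have : chains P m ≤ N.comap f := by
    refine Submodule.span_le.2 ?_
    rintro _ ⟨U, hU, x, hx, rfl⟩
    exact h U hU x hx
  exact this hc

theorem sumIn_mem {T : Disk} {m : ℤ} {c : F.Chain}
    (hc : c ∈ chains (fun U => (U : Set Plane) ⊆ T) m) : sumIn T c ∈ (F.obj T).gr m := by
  refine map_mem hc _ _ fun U hU x hx => ?_
  rw [sumIn_of hU]
  exact incl_mem U T hU hx

theorem d_sumIn {T : Disk} {m : ℤ} {c : F.Chain}
    (hc : c ∈ chains (fun U => (U : Set Plane) ⊆ T) m) :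
    (F.obj T).d (sumIn T c) = sumIn T (bdry c) := by
  refine map_eq_map hc ((F.obj T).d ∘ₗ sumIn T) (sumIn T ∘ₗ bdry) fun U hU x _ => ?_
  rw [LinearMap.comp_apply, LinearMap.comp_apply, bdry_of, sumIn_of hU, sumIn_of hU, F.incl_d]

theorem mulIn_mem {Y T : Disk} {m n : ℤ} {c : F.Chain}
    (hc : c ∈ chains (fun U => Disk.Fits ![U, Y] T) m) {y : F.obj Y} (hy : y ∈ (F.obj Y).gr n) :
    mulIn Y T c y ∈ (F.obj T).gr (m + n) := by
  refine map_mem hc ((mulIn Y T).flip y) _ fun U hU x hx => ?_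
  rw [LinearMap.flip_apply, mulIn_of hU]
  exact op₂_mem _ _ _ _ hx hy

theorem d_mulIn {Y T : Disk} {m : ℤ} {c : F.Chain}
    (hc : c ∈ chains (fun U => Disk.Fits ![U, Y] T) m) (y : F.obj Y) :
    (F.obj T).d (mulIn Y T c y) =
      mulIn Y T (bdry c) y + sgn K m • mulIn Y T c ((F.obj Y).d y) := by
  refine map_eq_map hc ((F.obj T).d ∘ₗ (mulIn Y T).flip y)
    ((mulIn Y T).flip y ∘ₗ bdry + sgn K m • (mulIn Y T).flip ((F.obj Y).d y)) fun U hU x hx => ?_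
  rw [LinearMap.comp_apply, LinearMap.add_apply, LinearMap.comp_apply, bdry_of,
    LinearMap.smul_apply, LinearMap.flip_apply, LinearMap.flip_apply, LinearMap.flip_apply,
    mulIn_of hU, mulIn_of hU, mulIn_of hU, d_op₂ _ _ _ _ hx]

theorem incl_mulIn {Y T T' : Disk} (hT : (T : Set Plane) ⊆ T') {m : ℤ} {c : F.Chain}
    (hc : c ∈ chains (fun U => Disk.Fits ![U, Y] T) m) (y : F.obj Y) :
    F.incl T T' hT (mulIn Y T c y) = mulIn Y T' c y := by
  refine map_eq_map hc (F.incl T T' hT ∘ₗ (mulIn Y T).flip y) ((mulIn Y T').flip y)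
    fun U hU x _ => ?_
  have hU' : Disk.Fits ![U, Y] T' := ⟨fun i => (hU.1 i).trans hT, hU.2⟩
  rw [LinearMap.comp_apply, LinearMap.flip_apply, LinearMap.flip_apply, mulIn_of hU, mulIn_of hU',
    F.incl_op₂ U Y T T' hU hT hU']

theorem fits_left {U Y T : Disk} (h : Disk.Fits ![U, Y] T) : (U : Set Plane) ⊆ T := h.1 0

theorem fits_right {U Y T : Disk} (h : Disk.Fits ![U, Y] T) : (Y : Set Plane) ⊆ T := h.1 1

theorem fits_disjoint {U Y T : Disk} (h : Disk.Fits ![U, Y] T) : Disjoint (U : Set Plane) Y :=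
  h.2 0 1 (by decide)

theorem fits_mono {U U' Y Y' T : Disk} (h : Disk.Fits ![U, Y] T) (hU : (U' : Set Plane) ⊆ U)
    (hY : (Y' : Set Plane) ⊆ Y) : Disk.Fits ![U', Y'] T :=
  Disk.fits_two (hU.trans (fits_left h)) (hY.trans (fits_right h))
    ((fits_disjoint h).mono hU hY)

theorem mulIn_incl {Y Y' T : Disk} (hY : (Y' : Set Plane) ⊆ Y) {m : ℤ} {c : F.Chain}
    (hc : c ∈ chains (fun U => Disk.Fits ![U, Y] T) m) (y : F.obj Y') :
    mulIn Y T c (F.incl Y' Y hY y) = mulIn Y' T c y := by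
  refine map_eq_map hc ((mulIn Y T).flip (F.incl Y' Y hY y)) ((mulIn Y' T).flip y)
    fun U hU x _ => ?_
  have hU' : Disk.Fits ![U, Y'] T := fits_mono hU subset_rfl hY
  rw [LinearMap.flip_apply, LinearMap.flip_apply, mulIn_of hU, mulIn_of hU']
  conv_lhs => rw [← F.incl_self U subset_rfl x]
  rw [F.op₂_incl U U Y' Y T subset_rfl hY hU hU']

theorem op₂_sumIn {E Y T : Disk} (hE : Disk.Fits ![E, Y] T) {m : ℤ} {c : F.Chain}
    (hc : c ∈ chains (fun U => (U : Set Plane) ⊆ E) m) (y : F.obj Y) :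
    F.op₂ E Y T hE (sumIn E c) y = mulIn Y T c y := by
  refine map_eq_map hc ((F.op₂ E Y T hE).flip y ∘ₗ sumIn E) ((mulIn Y T).flip y) fun U hU x _ => ?_
  have hU' : Disk.Fits ![U, Y] T := fits_mono hE hU subset_rfl
  rw [LinearMap.comp_apply, LinearMap.flip_apply, LinearMap.flip_apply, mulIn_of hU', sumIn_of hU]
  conv_lhs => rw [← F.incl_self Y subset_rfl y]
  rw [F.op₂_incl U E Y Y T hU subset_rfl hE hU']

theorem pT_mulIn {Y T : Disk} {m : ℤ} {c : F.Chain}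
    (hc : c ∈ chains (fun U => Disk.Fits ![U, Y] T) m) (y : F.obj Y) :
    pT S T (mulIn Y T c y) = ev₂ S Y c y := by
  refine map_eq_map hc (pT S T ∘ₗ (mulIn Y T).flip y) ((ev₂ S Y).flip y) fun U hU x _ => ?_
  rw [LinearMap.comp_apply, LinearMap.flip_apply, LinearMap.flip_apply, mulIn_of hU,
    ev₂_of S (fits_disjoint hU), pT_op₂ S U Y T hU (fits_disjoint hU)]

theorem ev₂_d {Y : Disk} {m : ℤ} {c : F.Chain}
    (hc : c ∈ chains (fun U => Disjoint (U : Set Plane) Y) m) (y : F.obj Y) :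
    ev₂ S Y (bdry c) y + sgn K m • ev₂ S Y c ((F.obj Y).d y) = 0 := by
  refine map_eq_map hc ((ev₂ S Y).flip y ∘ₗ bdry + sgn K m • (ev₂ S Y).flip ((F.obj Y).d y)) 0
    fun U hU x hx => ?_
  rw [LinearMap.add_apply, LinearMap.comp_apply, bdry_of,
    LinearMap.smul_apply, LinearMap.flip_apply, LinearMap.flip_apply,
    ev₂_of S hU, ev₂_of S hU, PFA.ev₂_d S _ _ _ hx, LinearMap.zero_apply]

theorem ev₂_mulIn {Y Z T : Disk} (hT : Disjoint (T : Set Plane) Z) {m : ℤ} {c : F.Chain}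
    (hc : c ∈ chains (fun U => Disk.Fits ![U, Y] T) m) (y : F.obj Y) (z : F.obj Z) :
    PFA.ev₂ S T Z hT (mulIn Y T c y) z = ev₃ S Y Z c y z := by
  refine map_eq_map hc ((PFA.ev₂ S T Z hT).flip z ∘ₗ (mulIn Y T).flip y)
    (((ev₃ S Y Z).flip y).flip z) fun U hU x _ => ?_
  have h : Disjoint₃ U Y Z := ⟨fits_disjoint hU, hT.mono_left (fits_left hU),
    hT.mono_left (fits_right hU)⟩
  rw [LinearMap.comp_apply, LinearMap.flip_apply, LinearMap.flip_apply, LinearMap.flip_apply,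
    LinearMap.flip_apply, mulIn_of hU, ev₃_of S h, ev₂_op₂_left S U Y Z T hU hT h.1 h.2.1 h.2.2]

/-- A chain outside of `T` sees two elements inside of `T` through their product in `F(T)`. -/
theorem ev₃_eq_ev₂ {Y Z T : Disk} (hT : Disk.Fits ![Y, Z] T) {m : ℤ} {c : F.Chain}
    (hc : c ∈ chains (fun U => Disjoint (U : Set Plane) T) m) (y : F.obj Y) (z : F.obj Z) :
    ev₃ S Y Z c y z = ev₂ S T c (F.op₂ Y Z T hT y z) := by
  refine map_eq_map hc (((ev₃ S Y Z).flip y).flip z) ((ev₂ S T).flip (F.op₂ Y Z T hT y z))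
    fun U hU x _ => ?_
  have h : Disjoint₃ U Y Z := ⟨hU.mono_right (fits_left hT), hU.mono_right (fits_right hT),
    fits_disjoint hT⟩
  rw [LinearMap.flip_apply, LinearMap.flip_apply, LinearMap.flip_apply,
    ev₃_of S h, ev₂_of S hU, ev₂_op₂_right S U Y Z T hT hU h.1 h.2.1 h.2.2]

/-- If the chain and `z` lie in `T`, they can be multiplied first, past `y`. -/
theorem ev₃_swap {Y Z T : Disk} (hT : Disjoint (Y : Set Plane) T) (hYZ : Disjoint (Y : Set Plane) Z)
    {m n : ℤ} {c : F.Chain} (hc : c ∈ chains (fun U => Disk.Fits ![U, Z] T) m) {y : F.obj Y}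
    (hy : y ∈ (F.obj Y).gr n) (z : F.obj Z) :
    ev₃ S Y Z c y z = sgn K (m * n) • PFA.ev₂ S Y T hT y (mulIn Z T c z) := by
  refine map_eq_map hc (((ev₃ S Y Z).flip y).flip z)
    (sgn K (m * n) • PFA.ev₂ S Y T hT y ∘ₗ (mulIn Z T).flip z) fun U hU x hx => ?_
  have h : Disjoint₃ U Y Z := ⟨hT.symm.mono_left (fits_left hU), fits_disjoint hU, hYZ⟩
  rw [LinearMap.flip_apply, LinearMap.flip_apply, LinearMap.smul_apply, LinearMap.comp_apply,
    LinearMap.flip_apply, ev₃_of S h, mulIn_of hU,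
    ev₂_op₂_right S Y U Z T hU hT h.1.symm h.2.2 h.2.1, PFA.ev₃_swap S _ _ _ _ _ _ hx hy]

/-- A chain inside of `E` can be summed up in `F(E)` first. -/
theorem ev₃_sumIn {E Y Z : Disk} (hE : Disjoint₃ E Y Z) {m : ℤ} {c : F.Chain}
    (hc : c ∈ chains (fun U => (U : Set Plane) ⊆ E) m) (y : F.obj Y) (z : F.obj Z) :
    ev₃ S Y Z c y z = PFA.ev₃ S E Y Z hE.1 hE.2.1 hE.2.2 (sumIn E c) y z := by
  refine map_eq_map hc (((ev₃ S Y Z).flip y).flip z)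
    (((PFA.ev₃ S E Y Z hE.1 hE.2.1 hE.2.2).flip y).flip z ∘ₗ sumIn E) fun U hU x _ => ?_
  have h : Disjoint₃ U Y Z := ⟨hE.1.mono_left hU, hE.2.1.mono_left hU, hE.2.2⟩
  rw [LinearMap.flip_apply, LinearMap.flip_apply, LinearMap.comp_apply, LinearMap.flip_apply,
    LinearMap.flip_apply, ev₃_of S h, sumIn_of hU]
  conv_rhs => rw [← F.incl_self Y subset_rfl y, ← F.incl_self Z subset_rfl z]
  rw [PFA.ev₃_incl S U E Y Y Z Z hU subset_rfl subset_rfl _ _ _ h.1 h.2.1 h.2.2]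

theorem pT_sumIn {T : Disk} {m : ℤ} {c : F.Chain}
    (hc : c ∈ chains (fun U => (U : Set Plane) ⊆ T) m) :
    pT S T (sumIn T c) = lift (fun U => pT S U) c := by
  refine map_eq_map hc (pT S T ∘ₗ sumIn T) _ fun U hU x _ => ?_
  rw [LinearMap.comp_apply, sumIn_of hU, lift_of, pT_incl]

-- Unfolding these direct sum constructions during unification is expensive; the lemmas above
-- suffice.
attribute [irreducible] of lift bdry sumIn mulIn ev₂ ev₃

end Chain
end PFA
end Prefact

/-! ### Paths in polar rectangles -/

namespace Prefact

/-- An arc of the circle, with end points of angle `a π / 12` and `b π / 12`. -/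
structure Arc where
  a : ℤ
  b : ℤ
  lt : a < b
  le : b ≤ a + 24

namespace Arc

/-- The arc `s` is contained in the arc `s'`, up to a full turn. -/
def Sub (s s' : Arc) : Prop :=
  (s'.a ≤ s.a ∧ s.b ≤ s'.b) ∨ (s'.a ≤ s.a + 24 ∧ s.b + 24 ≤ s'.b)
    ∨ (s'.a ≤ s.a - 24 ∧ s.b - 24 ≤ s'.b)

instance (s s' : Arc) : Decidable (s.Sub s') := inferInstanceAs (Decidable (_ ∨ _ ∨ _))

/-- The arcs `s` and `s'` are disjoint, also after full turns. -/
def Apart (s s' : Arc) : Prop :=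
  (s.b ≤ s'.a ∧ s'.b ≤ s.a + 24) ∨ (s.b ≤ s'.a + 24 ∧ s'.b ≤ s.a)
    ∨ (s.b ≤ s'.a - 24 ∧ s'.b ≤ s.a + 48)

instance (s s' : Arc) : Decidable (s.Apart s') := inferInstanceAs (Decidable (_ ∨ _ ∨ _))

/-- The point of angle `t π / 12` lies on the arc. -/
def Has (s : Arc) (t : ℝ) : Prop := ∃ k : ℤ, s.a < t + 24 * k ∧ t + 24 * k < s.b

end Arc

/-- The polar rectangle of the points of absolute value between `m` and `n` over the arc `s`. -/
noncomputable def cell (m n : ℕ) (h : m < n) (s : Arc) : Disk :=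
  Disk.sector m n (s.a * (Real.pi / 12)) (s.b * (Real.pi / 12)) (Nat.cast_nonneg m)
    (Nat.cast_lt.2 h) (mul_lt_mul_of_pos_right (Int.cast_lt.2 s.lt) (by positivity)) (by
      have h1 : (s.b : ℝ) ≤ s.a + 24 := by exact_mod_cast s.le
      have h2 := Real.pi_pos
      nlinarith)

theorem cell_carrier (m n : ℕ) (h : m < n) (s : Arc) :
    (cell m n h s : Set Plane) = sector m n (s.a * (Real.pi / 12)) (s.b * (Real.pi / 12)) := rfl

theorem sector_add_two_pi (r₀ r₁ α β : ℝ) :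
    sector r₀ r₁ (α + 2 * Real.pi) (β + 2 * Real.pi) = sector r₀ r₁ α β := by
  rw [← sector_sub_two_pi r₀ r₁ (α + 2 * Real.pi), add_sub_cancel_right, add_sub_cancel_right]

theorem cell_subset {m n m' n' : ℕ} {h : m < n} {h' : m' < n'} {s s' : Arc} (hm : m' ≤ m)
    (hn : n ≤ n') (hs : s.Sub s') : (cell m n h s : Set Plane) ⊆ cell m' n' h' s' := by
  have hm' : (m' : ℝ) ≤ m := by exact_mod_cast hm
  have hn' : (n : ℝ) ≤ n' := by exact_mod_cast hn
  have hpi := Real.pi_pos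
  rw [cell_carrier, cell_carrier]
  rcases hs with h | h | h
  · have h1 : (s'.a : ℝ) ≤ s.a := by exact_mod_cast h.1
    have h2 : (s.b : ℝ) ≤ s'.b := by exact_mod_cast h.2
    exact sector_mono hm' hn' (by nlinarith) (by nlinarith)
  · have h1 : (s'.a : ℝ) ≤ s.a + 24 := by exact_mod_cast h.1
    have h2 : (s.b : ℝ) + 24 ≤ s'.b := by exact_mod_cast h.2
    rw [← sector_add_two_pi m n]
    exact sector_mono hm' hn' (by nlinarith) (by nlinarith)
  · have h1 : (s'.a : ℝ) ≤ s.a - 24 := by exact_mod_cast h.1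
    have h2 : (s.b : ℝ) - 24 ≤ s'.b := by exact_mod_cast h.2
    rw [← sector_sub_two_pi m n]
    exact sector_mono hm' hn' (by nlinarith) (by nlinarith)

theorem cell_disjoint_of_radius {m n m' n' : ℕ} {h : m < n} {h' : m' < n'} (s s' : Arc)
    (hm : n ≤ m' ∨ n' ≤ m) : Disjoint (cell m n h s : Set Plane) (cell m' n' h' s') :=
  sector_disjoint_of_radius (Nat.cast_nonneg _) (Nat.cast_nonneg _)
    (hm.imp (fun h => Nat.cast_le.2 h) (fun h => Nat.cast_le.2 h))

theorem cell_disjoint {m n m' n' : ℕ} {h : m < n} {h' : m' < n'} {s s' : Arc} (hs : s.Apart s') :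
    Disjoint (cell m n h s : Set Plane) (cell m' n' h' s') := by
  have hpi := Real.pi_pos
  rw [cell_carrier, cell_carrier]
  rcases hs with h | h | h
  · have h1 : (s.b : ℝ) ≤ s'.a := by exact_mod_cast h.1
    have h2 : (s'.b : ℝ) ≤ s.a + 24 := by exact_mod_cast h.2
    exact sector_disjoint_of_angle (Nat.cast_nonneg _) (Nat.cast_nonneg _) (by nlinarith)
      (by nlinarith)
  · have h1 : (s.b : ℝ) ≤ s'.a + 24 := by exact_mod_cast h.1
    have h2 : (s'.b : ℝ) ≤ s.a := by exact_mod_cast h.2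
    exact (sector_disjoint_of_angle (Nat.cast_nonneg _) (Nat.cast_nonneg _) (by nlinarith)
      (by nlinarith)).symm
  · have h1 : (s.b : ℝ) ≤ s'.a - 24 := by exact_mod_cast h.1
    have h2 : (s'.b : ℝ) ≤ s.a + 48 := by exact_mod_cast h.2
    rw [← sector_sub_two_pi m' n']
    exact sector_disjoint_of_angle (Nat.cast_nonneg _) (Nat.cast_nonneg _) (by nlinarith)
      (by nlinarith)

theorem polarPoint_mem_cell {m n : ℕ} {h : m < n} {s : Arc} {r t : ℝ} (hr : m < r) (hr' : r < n)
    (ht : s.Has t) : polarPoint 0 r (t * (Real.pi / 12)) ∈ (cell m n h s : Set Plane) := by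
  obtain ⟨k, h1, h2⟩ := ht
  have hpi : 0 < Real.pi / 12 := by positivity
  refine ⟨r, ⟨hr, hr'⟩, (t + 24 * k) * (Real.pi / 12),
    ⟨mul_lt_mul_of_pos_right h1 hpi, mul_lt_mul_of_pos_right h2 hpi⟩, ?_⟩
  have e : (t + 24 * k) * (Real.pi / 12) = t * (Real.pi / 12) + k * (2 * Real.pi) := by ring
  rw [polarPoint, polarPoint, e, Real.cos_add_int_mul_two_pi, Real.sin_add_int_mul_two_pi]

/-- The disk of radius `n` around the origin. -/
noncomputable def core (n : ℕ) (h : 0 < n) : Disk := Disk.ball 0 n (Nat.cast_pos.2 h)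

theorem zero_mem_core (n : ℕ) (h : 0 < n) : (0 : Plane) ∈ (core n h : Set Plane) :=
  Metric.mem_ball_self (Nat.cast_pos.2 h)

theorem core_subset {m n : ℕ} {h : 0 < m} {h' : 0 < n} (hmn : m ≤ n) :
    (core m h : Set Plane) ⊆ core n h' := Metric.ball_subset_ball (Nat.cast_le.2 hmn)

theorem norm_polarPoint {r : ℝ} (hr : 0 ≤ r) (θ : ℝ) : ‖polarPoint 0 r θ‖ = r := by
  rw [EuclideanSpace.norm_eq, Fin.sum_univ_two, polarPoint_zero, polarPoint_one, PiLp.zero_apply,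
    PiLp.zero_apply, zero_add, zero_add, Real.norm_eq_abs, Real.norm_eq_abs, sq_abs, sq_abs]
  have e : (r * Real.cos θ) ^ 2 + (r * Real.sin θ) ^ 2 = r ^ 2 := by
    linear_combination r ^ 2 * Real.sin_sq_add_cos_sq θ
  rw [e, Real.sqrt_sq hr]

theorem norm_mem_of_mem_cell {m n : ℕ} {h : m < n} {s : Arc} {w : Plane}
    (hw : w ∈ (cell m n h s : Set Plane)) : m < ‖w‖ ∧ ‖w‖ < n := by
  obtain ⟨r, hr, θ, -, rfl⟩ := hw
  rw [norm_polarPoint ((Nat.cast_nonneg m).trans hr.1.le)]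
  exact hr

theorem cell_subset_core {m n k : ℕ} {h : m < n} {h' : 0 < k} (s : Arc) (hk : n ≤ k) :
    (cell m n h s : Set Plane) ⊆ core k h' := by
  intro w hw
  exact mem_ball_zero_iff.2 ((norm_mem_of_mem_cell hw).2.trans_le (Nat.cast_le.2 hk))

theorem cell_disjoint_core {m n k : ℕ} {h : m < n} {h' : 0 < k} (s : Arc) (hk : k ≤ m) :
    Disjoint (cell m n h s : Set Plane) (core k h') := by
  rw [Set.disjoint_left]
  intro w hw hw'
  have h1 : ‖w‖ < k := mem_ball_zero_iff.1 hw'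
  have h2 : (k : ℝ) ≤ m := Nat.cast_le.2 hk
  linarith [(norm_mem_of_mem_cell hw).1]

namespace PFA
namespace Chain

variable {K : Type u} [Field K] {F : PFA.{u, v} K} (S : F.Retracts) (hF : F.IsLocallyConstant)

section natural

variable {V : Type*} [AddCommGroup V] [Module K V]

/-- A linear map on chains is natural for the disks with the property `P` if it does not see the
inclusion of a subdisk in such a disk. -/
def Natural (f : F.Chain →ₗ[K] V) (P : Disk → Prop) : Prop :=
  ∀ (A U : Disk) (h : (A : Set Plane) ⊆ U), P U → ∀ x, f (of U (F.incl A U h x)) = f (of A x)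

theorem natural_sumIn (T : Disk) :
    Natural (sumIn (F := F) T) (fun U => (U : Set Plane) ⊆ T) := by
  intro A U h hU x
  rw [sumIn_of hU, sumIn_of (h.trans hU), F.incl_incl]

theorem natural_mulIn (Y T : Disk) (y : F.obj Y) :
    Natural ((mulIn Y T).flip y) (fun U => Disk.Fits ![U, Y] T) := by
  intro A U h hU x
  have hA := fits_mono hU h subset_rfl
  rw [LinearMap.flip_apply, LinearMap.flip_apply, mulIn_of hU, mulIn_of hA]
  conv_lhs => rw [← F.incl_self Y subset_rfl y]
  rw [F.op₂_incl A U Y Y T h subset_rfl hU hA]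

theorem natural_ev₂ (Y : Disk) (y : F.obj Y) :
    Natural ((ev₂ S Y).flip y) (fun U => Disjoint (U : Set Plane) Y) := by
  intro A U h hU x
  rw [LinearMap.flip_apply, LinearMap.flip_apply, ev₂_of S hU, ev₂_of S (hU.mono_left h),
    ev₂_incl_left S A U Y h hU (hU.mono_left h)]

variable {S} {f : F.Chain →ₗ[K] V} {P : Disk → Prop}

theorem Natural.bdry_path (hf : Natural f P) {U A A' : Disk} (hU : P U)
    (h : (A : Set Plane) ⊆ U) (h' : (A' : Set Plane) ⊆ U) (x : F.HR) :
    f (bdry (of U (path S hF U A A' h h' x))) =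
      f (of A' (iT S hF A' x)) - f (of A (iT S hF A x)) := by
  rw [bdry_of, d_path, map_sub, map_sub, hf A' U h' hU, hf A U h hU]

end natural

/-- The chain that moves `x` from `n` to `n'` along the arc `s`, at distance between `k` and `l`
from the origin. -/
noncomputable def arcPath (k l : ℕ) (hkl : k < l) (s n n' : Arc) (hn : n.Sub s) (hn' : n'.Sub s)
    (x : F.HR) : F.Chain :=
  of (cell k l hkl s) (path S hF (cell k l hkl s) (cell k l hkl n) (cell k l hkl n')
    (cell_subset le_rfl le_rfl hn) (cell_subset le_rfl le_rfl hn') x)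

/-- The chain that moves `x` towards the origin over the arc `n`. -/
noncomputable def channel (n : Arc) (x : F.HR) : F.Chain :=
  of (cell 1 4 (by decide) n) (path S hF (cell 1 4 (by decide) n) (cell 3 4 (by decide) n)
    (cell 1 2 (by decide) n) (cell_subset (by decide) (by decide) (Or.inl ⟨le_rfl, le_rfl⟩))
    (cell_subset (by decide) (by decide) (Or.inl ⟨le_rfl, le_rfl⟩)) x)

/-- The loop in a polar rectangle over the arc `s` that consists of two arcs and two channels. -/
noncomputable def loop (s n n' : Arc) (hn : n.Sub s) (hn' : n'.Sub s) (x : F.HR) : F.Chain :=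
  arcPath S hF 3 4 (by decide) s n n' hn hn' x + channel S hF n' x
    - arcPath S hF 1 2 (by decide) s n n' hn hn' x - channel S hF n x

variable {S} {j : ℤ} {x : F.HR}

theorem arcPath_mem {P : Disk → Prop} {k l : ℕ} {hkl : k < l} {s n n' : Arc} {hn : n.Sub s}
    {hn' : n'.Sub s} (hP : P (cell k l hkl s)) (hx : x ∈ F.HR.gr j) :
    arcPath S hF k l hkl s n n' hn hn' x ∈ chains P (j - 1) :=
  of_mem hP (path_mem S hF _ _ _ _ _ hx)

theorem channel_mem {P : Disk → Prop} {n : Arc} (hP : P (cell 1 4 (by decide) n))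
    (hx : x ∈ F.HR.gr j) : channel S hF n x ∈ chains P (j - 1) :=
  of_mem hP (path_mem S hF _ _ _ _ _ hx)

theorem loop_mem {s n n' : Arc} {hn : n.Sub s} {hn' : n'.Sub s} (hx : x ∈ F.HR.gr j) :
    loop S hF s n n' hn hn' x ∈
      chains (fun U => (U : Set Plane) ⊆ cell 1 4 (by decide) s) (j - 1) :=
  Submodule.sub_mem _ (Submodule.sub_mem _ (Submodule.add_mem _
    (arcPath_mem hF (cell_subset (by decide) (by decide) (Or.inl ⟨le_rfl, le_rfl⟩)) hx)
    (channel_mem hF (cell_subset (by decide) (by decide) hn') hx))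
    (arcPath_mem hF (cell_subset (by decide) (by decide) (Or.inl ⟨le_rfl, le_rfl⟩)) hx))
    (channel_mem hF (cell_subset (by decide) (by decide) hn) hx)

theorem sumIn_loop_mem {s n n' : Arc} {hn : n.Sub s} {hn' : n'.Sub s} (hx : x ∈ F.HR.gr j) :
    sumIn (cell 1 4 (by decide) s) (loop S hF s n n' hn hn' x) ∈ (F.obj _).gr (j - 1) :=
  sumIn_mem (loop_mem hF hx)

section natural

variable {V : Type*} [AddCommGroup V] [Module K V] {f : F.Chain →ₗ[K] V} {P : Disk → Prop}

theorem Natural.bdry_arcPath (hf : Natural f P) {k l : ℕ} {hkl : k < l} {s n n' : Arc}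
    {hn : n.Sub s} {hn' : n'.Sub s} (hP : P (cell k l hkl s)) :
    f (bdry (arcPath S hF k l hkl s n n' hn hn' x)) =
      f (of (cell k l hkl n') (iT S hF _ x)) - f (of (cell k l hkl n) (iT S hF _ x)) :=
  hf.bdry_path hF hP _ _ _

theorem Natural.bdry_channel (hf : Natural f P) {n : Arc} (hP : P (cell 1 4 (by decide) n)) :
    f (bdry (channel S hF n x)) =
      f (of (cell 1 2 (by decide) n) (iT S hF _ x))
        - f (of (cell 3 4 (by decide) n) (iT S hF _ x)) :=
  hf.bdry_path hF hP _ _ _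

theorem Natural.bdry_loop (hf : Natural f P) {s n n' : Arc} {hn : n.Sub s} {hn' : n'.Sub s}
    (h₁ : P (cell 3 4 (by decide) s)) (h₂ : P (cell 1 2 (by decide) s))
    (h₃ : P (cell 1 4 (by decide) n)) (h₄ : P (cell 1 4 (by decide) n')) :
    f (bdry (loop S hF s n n' hn hn' x)) = 0 := by
  rw [loop, map_sub, map_sub, map_sub, map_sub, map_add, map_add, hf.bdry_arcPath hF h₁,
    hf.bdry_arcPath hF h₂, hf.bdry_channel hF h₃, hf.bdry_channel hF h₄]
  abel

end natural

theorem d_sumIn_loop {s n n' : Arc} {hn : n.Sub s} {hn' : n'.Sub s} (hx : x ∈ F.HR.gr j) :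
    (F.obj _).d (sumIn (cell 1 4 (by decide) s) (loop S hF s n n' hn hn' x)) = 0 := by
  rw [d_sumIn (loop_mem hF hx)]
  exact (natural_sumIn _).bdry_loop hF
    (cell_subset (by decide) (by decide) (Or.inl ⟨le_rfl, le_rfl⟩))
    (cell_subset (by decide) (by decide) (Or.inl ⟨le_rfl, le_rfl⟩))
    (cell_subset (by decide) (by decide) hn) (cell_subset (by decide) (by decide) hn')

theorem pT_sumIn_loop {s n n' : Arc} {hn : n.Sub s} {hn' : n'.Sub s} (hx : x ∈ F.HR.gr j) :
    pT S (cell 1 4 (by decide) s) (sumIn _ (loop S hF s n n' hn hn' x)) = 0 := by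
  rw [pT_sumIn (loop_mem hF hx), loop, map_sub, map_sub, map_add, arcPath, arcPath, channel,
    channel, lift_of, lift_of, lift_of, lift_of, pT_path, pT_path, pT_path, pT_path]
  simp

/-- A primitive of a loop in the polar rectangle that contains it. The sum of the loop is a cocycle
of class `0`. -/
noncomputable def filling (S : F.Retracts) (hF : F.IsLocallyConstant) (s n n' : Arc)
    (hn : n.Sub s) (hn' : n'.Sub s) (x : F.HR) : F.obj (cell 1 4 (by decide) s) :=
  -hT S hF _ (sumIn _ (loop S hF s n n' hn hn' x))

theorem d_filling {s n n' : Arc} {hn : n.Sub s} {hn' : n'.Sub s} (hx : x ∈ F.HR.gr j) :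
    (F.obj _).d (filling S hF s n n' hn hn' x) = sumIn _ (loop S hF s n n' hn hn' x) := by
  rw [filling, map_neg, d_hT_of_closed S hF _ (d_sumIn_loop hF hx), pT_sumIn_loop hF hx, map_zero,
    zero_sub, neg_neg]

theorem filling_mem {s n n' : Arc} {hn : n.Sub s} {hn' : n'.Sub s} (hx : x ∈ F.HR.gr j) :
    filling S hF s n n' hn hn' x ∈ (F.obj _).gr (j - 1 - 1) :=
  Submodule.neg_mem _ (hT_mem S hF _ (sumIn_loop_mem hF hx))

/-- The value of a cycle on a cocycle only depends on the class of the cocycle. -/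
theorem ev₂_of_closed {Y : Disk} {m : ℤ} {c : F.Chain}
    (hc : c ∈ chains (fun U => Disjoint (U : Set Plane) Y) m)
    (hb : ∀ e, ev₂ S Y (bdry c) e = 0) {e : F.obj Y} (he : (F.obj Y).d e = 0) :
    ev₂ S Y c e = ev₂ S Y c (iT S hF Y (pT S Y e)) := by
  have h1 := congrArg (sgn K m • ·) (ev₂_d (S := S) hc (hT S hF Y e))
  simp only [hb, zero_add, smul_smul, sgn_mul_self, one_smul, smul_zero] at h1
  rw [d_hT_of_closed S hF Y he, map_sub, sub_eq_zero] at h1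
  exact h1.symm

/-- The product of a chain with a unit only sees the classes of its summands. -/
theorem ev₂_unit {Y : Disk} {c : F.Chain} {m : ℤ}
    (hc : c ∈ chains (fun U => Disjoint (U : Set Plane) Y) m) :
    ev₂ S Y c (F.unit Y) = lift (fun U => pT S U) c := by
  refine map_eq_map hc ((ev₂ S Y).flip (F.unit Y)) _ fun U hU x _ => ?_
  rw [LinearMap.flip_apply, ev₂_of S hU, lift_of, PFA.ev₂_apply,
    F.op₂_unit_right U Y Disk.whole _ (Disk.subset_whole U)]
  rfl

theorem lift_arcPath {k l : ℕ} {hkl : k < l} {s n n' : Arc} {hn : n.Sub s} {hn' : n'.Sub s} :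
    lift (fun U => pT S U) (arcPath S hF k l hkl s n n' hn hn' x) = 0 := by
  rw [arcPath, lift_of, pT_path]

/-- The value of the path along an arc is a difference of potentials. -/
theorem ev₂_arcPath (hx : x ∈ F.HR.gr j) (y : F.HR) {k l : ℕ} {hkl : k < l} {s n n' : Arc}
    {hn : n.Sub s} {hn' : n'.Sub s} {B : Disk} (h0 : (0 : Plane) ∈ (B : Set Plane))
    (hB : ∀ s, Disjoint (cell k l hkl s : Set Plane) B) {r t t' : ℝ} (hr : k < r) (hr' : r < l)
    (htt : t' ≤ t) (hs : ∃ i : ℤ, s.a < t' + 24 * i ∧ t + 24 * i < s.b) (ht : n.Has t)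
    (ht' : n'.Has t') :
    ev₂ S B (arcPath S hF k l hkl s n n' hn hn' x) (iT S hF B y) =
      (cocycle S hF hx y).pot 0 r (t' * (Real.pi / 12)) ⟨cell k l hkl n', B, hB n'⟩
        - (cocycle S hF hx y).pot 0 r (t * (Real.pi / 12)) ⟨cell k l hkl n, B, hB n⟩ := by
  rw [arcPath, ev₂_of S (hB s)]
  have := ev₂_path S hF hx y (U := cell k l hkl s) (A := cell k l hkl n) (A' := cell k l hkl n')
    (cell_subset le_rfl le_rfl hn) (cell_subset le_rfl le_rfl hn') (hB s) (z := 0)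
    (r := fun _ => r) (θ := fun τ => -τ * (Real.pi / 12)) continuous_const (by fun_prop)
    (t₀ := -t) (t₁ := -t') (by linarith) (fun _ _ => (Nat.cast_nonneg k).trans_lt hr) h0
    (fun τ hτ => ?_) ?_ ?_
  · simpa only [neg_neg] using this
  · obtain ⟨i, h1, h2⟩ := hs
    exact polarPoint_mem_cell hr hr' ⟨i, by linarith [hτ.2], by linarith [hτ.1]⟩
  · simp only [neg_neg]
    exact polarPoint_mem_cell hr hr' ht
  · simp only [neg_neg]
    exact polarPoint_mem_cell hr hr' ht'

end Chain
end PFA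
end Prefact

/-! ### Homotopies between cocycles -/

namespace Prefact
namespace PFA

variable {K : Type u} [Field K] {F : PFA.{u, v} K} (S : F.Retracts) (hF : F.IsLocallyConstant)

/-- A homotopy `g` in `U` from a cocycle `c` in `A` to a cocycle `c'` in `A'` acts on cohomology
like the canonical path of the class of `c`, up to a multiplication and terms that only depend on
`c` and `c'`. -/
theorem ev₂_homotopy {A A' U Z : Disk} (hA : (A : Set Plane) ⊆ U) (hA' : (A' : Set Plane) ⊆ U)
    (hU : Disjoint (U : Set Plane) Z) {n : ℤ} {c : F.obj A} {c' : F.obj A'} {g : F.obj U}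
    (hc : c ∈ (F.obj A).gr n) (hc' : c' ∈ (F.obj A').gr n) (hg : g ∈ (F.obj U).gr (n - 1))
    (hdc : (F.obj A).d c = 0) (hdc' : (F.obj A').d c' = 0)
    (hdg : (F.obj U).d g = F.incl A' U hA' c' - F.incl A U hA c) {ζ : F.obj Z}
    (hζ : (F.obj Z).d ζ = 0) :
    ev₂ S U Z hU g ζ = ev₂ S U Z hU (path S hF U A A' hA hA' (pT S A c)) ζ
      + prod S hF (pT S U g) (pT S Z ζ)
      + (ev₂ S A Z (hU.mono_left hA) (hT S hF A c) ζ
        - ev₂ S A' Z (hU.mono_left hA') (hT S hF A' c') ζ) := by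
  have hw : pT S A' c' = pT S A c := by
    have := congrArg (pT S U) hdg
    rwa [pT_d, map_sub, pT_incl, pT_incl, eq_comm, sub_eq_zero] at this
  set γ : F.obj U := g + F.incl A' U hA' (hT S hF A' c') - F.incl A U hA (hT S hF A c)
    - path S hF U A A' hA hA' (pT S A c) with hγ
  have h1 : γ ∈ (F.obj U).gr (n - 1) :=
    Submodule.sub_mem _ (Submodule.sub_mem _ (Submodule.add_mem _ hg
      (incl_mem _ _ _ (hT_mem S hF _ hc'))) (incl_mem _ _ _ (hT_mem S hF _ hc)))
      (path_mem S hF _ _ _ _ _ (pT_mem S A hc))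
  have h2 : (F.obj U).d γ = 0 := by
    rw [hγ, map_sub, map_sub, map_add, hdg, ← F.incl_d, ← F.incl_d, d_hT_of_closed S hF _ hdc,
      d_hT_of_closed S hF _ hdc', d_path, hw, map_sub, map_sub]
    abel
  have h3 : pT S U γ = pT S U g := by
    rw [hγ, map_sub, map_sub, map_add, pT_incl, pT_incl, pT_hT, pT_hT, pT_path, add_zero, sub_zero,
      sub_zero]
  have h4 := ev₂_eq_prod S hF U Z hU h1 h2 hζ
  rw [h3, hγ, map_sub, map_sub, map_add, LinearMap.sub_apply, LinearMap.sub_apply,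
    LinearMap.add_apply, ev₂_incl_left S A' U Z hA' hU (hU.mono_left hA'),
    ev₂_incl_left S A U Z hA hU (hU.mono_left hA)] at h4
  rw [← h4]
  abel

/-- Two homotopies in `U` and `V` between the same cocycles, compared to the canonical paths. -/
theorem ev₂_homotopy_sub {A A' U V Z : Disk} (hA : (A : Set Plane) ⊆ U)
    (hA' : (A' : Set Plane) ⊆ U) (hAV : (A : Set Plane) ⊆ V) (hAV' : (A' : Set Plane) ⊆ V)
    (hU : Disjoint (U : Set Plane) Z) (hV : Disjoint (V : Set Plane) Z) {n : ℤ} {c : F.obj A}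
    {c' : F.obj A'} {g : F.obj U} {g' : F.obj V}
    (hc : c ∈ (F.obj A).gr n) (hc' : c' ∈ (F.obj A').gr n) (hg : g ∈ (F.obj U).gr (n - 1))
    (hg' : g' ∈ (F.obj V).gr (n - 1)) (hdc : (F.obj A).d c = 0) (hdc' : (F.obj A').d c' = 0)
    (hdg : (F.obj U).d g = F.incl A' U hA' c' - F.incl A U hA c)
    (hdg' : (F.obj V).d g' = F.incl A' V hAV' c' - F.incl A V hAV c) {ζ : F.obj Z}
    (hζ : (F.obj Z).d ζ = 0) :
    ev₂ S U Z hU g ζ - ev₂ S V Z hV g' ζ =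
      ev₂ S U Z hU (path S hF U A A' hA hA' (pT S A c)) ζ
      + ev₂ S V Z hV (path S hF V A' A hAV' hAV (pT S A c)) ζ
      + prod S hF (pT S U g - pT S V g') (pT S Z ζ) := by
  rw [ev₂_homotopy S hF hA hA' hU hc hc' hg hdc hdc' hdg hζ,
    ev₂_homotopy S hF hAV hAV' hV hc hc' hg' hdc hdc' hdg' hζ, path_apply S hF V, path_apply S hF V,
    map_sub (ev₂ S V Z hV), map_sub (ev₂ S V Z hV), map_sub (prod S hF),
    LinearMap.sub_apply, LinearMap.sub_apply, LinearMap.sub_apply]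
  abel

namespace Chain

/-- A homotopy in `D` that moves the product of `α` with the cycle `cL` to the product of `α'` with
the cycle `cR`: the path `υ` from `α` to `α'` is multiplied by the large cycle `cL + cM + cR`, whose
unwanted parts are contracted by their primitives `bL`, `bM`, `bR`. -/
noncomputable def mover (m : ℤ) {D Y A A' EL EM ER : Disk} (c : F.Chain) (bL : F.obj EL)
    (bM : F.obj EM) (bR : F.obj ER) (α : F.obj A) (α' : F.obj A') (υ : F.obj Y) : F.obj D :=
  sgn K m • mulIn Y D c υ - mulIn A' D (of EL bL + of EM bM) α'
    + mulIn A D (of EM bM + of ER bR) α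

variable {S}

theorem mover_mem {m k : ℤ} {D Y A A' EL EM ER : Disk} {c : F.Chain} {bL : F.obj EL}
    {bM : F.obj EM} {bR : F.obj ER} {α : F.obj A} {α' : F.obj A'} {υ : F.obj Y}
    (hc : c ∈ chains (fun U => Disk.Fits ![U, Y] D) m)
    (fL : Disk.Fits ![EL, A'] D) (fM' : Disk.Fits ![EM, A'] D) (fM : Disk.Fits ![EM, A] D)
    (fR : Disk.Fits ![ER, A] D) (hbL : bL ∈ (F.obj EL).gr (m - 1))
    (hbM : bM ∈ (F.obj EM).gr (m - 1)) (hbR : bR ∈ (F.obj ER).gr (m - 1))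
    (hα : α ∈ (F.obj A).gr k) (hα' : α' ∈ (F.obj A').gr k)
    (hυ : υ ∈ (F.obj Y).gr (k - 1)) :
    mover m c bL bM bR α α' υ ∈ (F.obj D).gr (m + k - 1) := by
  have e1 : m + k - 1 = m + (k - 1) := by ring
  have e2 : m + k - 1 = m - 1 + k := by ring
  refine Submodule.add_mem _ (Submodule.sub_mem _ (Submodule.smul_mem _ _ ?_) ?_) ?_
  · rw [e1]
    exact mulIn_mem hc hυ
  · rw [e2]
    exact mulIn_mem (Submodule.add_mem _ (of_mem (P := fun U => Disk.Fits ![U, A'] D) fL hbL)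
      (of_mem (P := fun U => Disk.Fits ![U, A'] D) fM' hbM)) hα'
  · rw [e2]
    exact mulIn_mem (Submodule.add_mem _ (of_mem (P := fun U => Disk.Fits ![U, A] D) fM hbM)
      (of_mem (P := fun U => Disk.Fits ![U, A] D) fR hbR)) hα

/-- A filling of a chain remains one after multiplication with a cocycle. -/
theorem d_mulIn_filling {m : ℤ} {D A E : Disk} {c : F.Chain} {b : F.obj E} {α : F.obj A}
    (hc : c ∈ chains (fun U => (U : Set Plane) ⊆ E) m) (f : Disk.Fits ![E, A] D)
    (hb : b ∈ (F.obj E).gr (m - 1)) (hdb : (F.obj E).d b = sumIn E c) (hα : (F.obj A).d α = 0) :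
    (F.obj D).d (mulIn A D (of E b) α) = mulIn A D c α := by
  rw [mulIn_of f, d_op₂ _ _ _ _ hb, hα, map_zero, smul_zero, add_zero, hdb, op₂_sumIn f hc]

/-- The hypothesis `hb` says that the large cycle is a cycle in the complement of the path `υ`. -/
theorem d_mover {m : ℤ} {D Y A A' EL EM ER : Disk} {cL cM cR : F.Chain} {bL : F.obj EL}
    {bM : F.obj EM} {bR : F.obj ER} {α : F.obj A} {α' : F.obj A'} {υ : F.obj Y}
    (hL : cL ∈ chains (fun U => (U : Set Plane) ⊆ EL) m)
    (hM : cM ∈ chains (fun U => (U : Set Plane) ⊆ EM) m)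
    (hR : cR ∈ chains (fun U => (U : Set Plane) ⊆ ER) m)
    (hc : cL + cM + cR ∈ chains (fun U => Disk.Fits ![U, Y] D) m)
    (hb : mulIn Y D (bdry (cL + cM + cR)) υ = 0)
    (hA : (A : Set Plane) ⊆ Y) (hA' : (A' : Set Plane) ⊆ Y)
    (fL : Disk.Fits ![EL, A'] D) (fM' : Disk.Fits ![EM, A'] D) (fM : Disk.Fits ![EM, A] D)
    (fR : Disk.Fits ![ER, A] D) (hbL : bL ∈ (F.obj EL).gr (m - 1))
    (hbM : bM ∈ (F.obj EM).gr (m - 1)) (hbR : bR ∈ (F.obj ER).gr (m - 1))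
    (hdL : (F.obj EL).d bL = sumIn EL cL) (hdM : (F.obj EM).d bM = sumIn EM cM)
    (hdR : (F.obj ER).d bR = sumIn ER cR) (hα : (F.obj A).d α = 0) (hα' : (F.obj A').d α' = 0)
    (hυ : (F.obj Y).d υ = F.incl A' Y hA' α' - F.incl A Y hA α) :
    (F.obj D).d (mover m (cL + cM + cR) bL bM bR α α' υ) = mulIn A' D cR α' - mulIn A D cL α := by
  rw [mover, map_add, map_sub, map_smul, d_mulIn hc, hb, zero_add, smul_smul, sgn_mul_self,
    one_smul, hυ, map_sub, mulIn_incl hA' hc, mulIn_incl hA hc]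
  simp only [map_add, LinearMap.add_apply]
  rw [d_mulIn_filling hL fL hbL hdL hα', d_mulIn_filling hM fM' hbM hdM hα',
    d_mulIn_filling hM fM hbM hdM hα, d_mulIn_filling hR fR hbR hdR hα]
  abel

/-- A path `υ` is moved across a cycle that is filled in the complement of the path. -/
theorem ev₃_filling {m : ℤ} {E Y A A' Z : Disk} {c : F.Chain} {b : F.obj E} {α : F.obj A}
    {α' : F.obj A'} {υ : F.obj Y} {ζ : F.obj Z}
    (hc : c ∈ chains (fun U => (U : Set Plane) ⊆ E) m) (h : Disjoint₃ E Y Z)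
    (hA : (A : Set Plane) ⊆ Y) (hA' : (A' : Set Plane) ⊆ Y)
    {k : ℤ} (hk : υ ∈ (F.obj Y).gr k)
    (hb : b ∈ (F.obj E).gr (m - 1)) (hdb : (F.obj E).d b = sumIn E c)
    (hυ : (F.obj Y).d υ = F.incl A' Y hA' α' - F.incl A Y hA α) (hζ : (F.obj Z).d ζ = 0) :
    ev₃ S Y Z c υ ζ = sgn K m • (ev₃ S A' Z (of E b) α' ζ - ev₃ S A Z (of E b) α ζ) := by
  have h1 : Disjoint₃ E A Z := ⟨h.1.mono_right hA, h.2.1, h.2.2.mono_left hA⟩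
  have h2 : Disjoint₃ E A' Z := ⟨h.1.mono_right hA', h.2.1, h.2.2.mono_left hA'⟩
  have h3 := PFA.ev₃_d S E Y Z h.1 h.2.1 h.2.2 hb hk hζ
  have e1 := PFA.ev₃_incl S E E A Y Z Z subset_rfl hA subset_rfl h.1 h.2.1 h.2.2 h1.1 h1.2.1 h1.2.2
    b α ζ
  have e2 := PFA.ev₃_incl S E E A' Y Z Z subset_rfl hA' subset_rfl h.1 h.2.1 h.2.2 h2.1 h2.2.1
    h2.2.2 b α' ζ
  rw [F.incl_self, F.incl_self] at e1 e2
  rw [hυ, map_sub, LinearMap.sub_apply, e1, e2, hdb, sgn_sub, sgn_one, mul_neg_one, neg_smul] at h3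
  rw [ev₃_sumIn h hc, ev₃_of S h1, ev₃_of S h2, ← sub_eq_zero, ← h3]
  abel

/-- The complement cycle `cN` completes `cL + cM + cR` to the difference of two rings around `ζ`.
It is filled by `bN`, and the terms with fillings are symmetric in `bM` and `bN`, so that they
cancel when the roles of `bM` and `bN` are exchanged. -/
theorem ev₂_mover {m k : ℤ} {D Y A A' EL EM EN ER Z : Disk} {cL cM cN cR : F.Chain} {bL : F.obj EL}
    {bM : F.obj EM} {bN : F.obj EN} {bR : F.obj ER} {α : F.obj A} {α' : F.obj A'} {υ : F.obj Y}
    {ζ : F.obj Z} (hD : Disjoint (D : Set Plane) Z)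
    (hc : cL + cM + cR ∈ chains (fun U => Disk.Fits ![U, Y] D) m)
    (hN : cN ∈ chains (fun U => (U : Set Plane) ⊆ EN) m)
    (hA : (A : Set Plane) ⊆ Y) (hA' : (A' : Set Plane) ⊆ Y)
    (fL : Disk.Fits ![EL, A'] D) (fM' : Disk.Fits ![EM, A'] D) (fM : Disk.Fits ![EM, A] D)
    (fR : Disk.Fits ![ER, A] D) (fN : Disjoint₃ EN Y Z) (hbL : bL ∈ (F.obj EL).gr (m - 1))
    (hbM : bM ∈ (F.obj EM).gr (m - 1)) (hbN : bN ∈ (F.obj EN).gr (m - 1))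
    (hbR : bR ∈ (F.obj ER).gr (m - 1)) (hdN : (F.obj EN).d bN = sumIn EN cN)
    (hk : υ ∈ (F.obj Y).gr k)
    (hυ : (F.obj Y).d υ = F.incl A' Y hA' α' - F.incl A Y hA α) (hζ : (F.obj Z).d ζ = 0) :
    PFA.ev₂ S D Z hD (mover m (cL + cM + cR) bL bM bR α α' υ) ζ =
      sgn K m • ev₃ S Y Z (cL + cM + cN + cR) υ ζ
        - (ev₃ S A' Z (of EL bL) α' ζ + ev₃ S A' Z (of EM bM) α' ζ + ev₃ S A' Z (of EN bN) α' ζ)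
        + (ev₃ S A Z (of EM bM) α ζ + ev₃ S A Z (of EN bN) α ζ + ev₃ S A Z (of ER bR) α ζ) := by
  have e : cL + cM + cN + cR = cL + cM + cR + cN := by abel
  have e1 := ev₂_mulIn (S := S) hD hc υ ζ
  have e2 := ev₂_mulIn (S := S) hD (of_mem (P := fun U => Disk.Fits ![U, A'] D) fL hbL) α' ζ
  have e3 := ev₂_mulIn (S := S) hD (of_mem (P := fun U => Disk.Fits ![U, A'] D) fM' hbM) α' ζ
  have e4 := ev₂_mulIn (S := S) hD (of_mem (P := fun U => Disk.Fits ![U, A] D) fM hbM) α ζ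
  have e5 := ev₂_mulIn (S := S) hD (of_mem (P := fun U => Disk.Fits ![U, A] D) fR hbR) α ζ
  have e6 := ev₃_filling (S := S) hN fN hA hA' hk hbN hdN hυ hζ
  have e7 : ev₃ S Y Z (cL + cM + cN + cR) υ ζ =
      ev₃ S Y Z (cL + cM + cR) υ ζ + ev₃ S Y Z cN υ ζ := by
    rw [e, map_add (ev₃ S Y Z) (cL + cM + cR) cN]
    rfl
  rw [mover, map_add, map_sub, map_smul, LinearMap.add_apply, LinearMap.sub_apply,
    LinearMap.smul_apply, e1, map_add (mulIn A' D), map_add (mulIn A D), LinearMap.add_apply,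
    LinearMap.add_apply, map_add (PFA.ev₂ S D Z hD), map_add (PFA.ev₂ S D Z hD),
    LinearMap.add_apply, LinearMap.add_apply, e2, e3, e4, e5, e7, e6]
  have key : ∀ a t₁ t₂ t₃ t₄ t₅ t₆ : F.HR, sgn K m • a - (t₁ + t₂) + (t₄ + t₆) =
      sgn K m • (a + sgn K m • (t₃ - t₅)) - (t₁ + t₂ + t₃) + (t₄ + t₅ + t₆) := by
    intro a t₁ t₂ t₃ t₄ t₅ t₆
    rw [smul_add, smul_smul, sgn_mul_self, one_smul]
    abel
  exact key _ _ _ _ _ _ _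

end Chain
end PFA
end Prefact

/-! ### Rings and loops around the origin -/

namespace Prefact

namespace Arc

/-- The position at the lower left. The positions `n₁`, `n₂`, `n₃`, `n₄` are in clockwise order, and
the arcs below have them as ends. All arcs are in units of `π / 12`. -/
def n₁ : Arc := ⟨14, 15, by decide, by decide⟩
/-- The position at the upper left. -/
def n₂ : Arc := ⟨9, 10, by decide, by decide⟩
/-- The position at the upper right. -/
def n₃ : Arc := ⟨2, 3, by decide, by decide⟩
/-- The position at the lower right. -/
def n₄ : Arc := ⟨-3, -2, by decide, by decide⟩
/-- The arc on the left, from `n₁` to `n₂`. -/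
def left : Arc := ⟨9, 15, by decide, by decide⟩
/-- The arc at the top, from `n₂` to `n₃`. -/
def top : Arc := ⟨2, 10, by decide, by decide⟩
/-- The arc on the right, from `n₃` to `n₄`. -/
def right : Arc := ⟨-3, 3, by decide, by decide⟩
/-- The arc at the bottom, from `n₄` to `n₁`. -/
def bottom : Arc := ⟨14, 22, by decide, by decide⟩
/-- The position on the left, between `n₁` and `n₂` and apart from them. -/
def yl : Arc := ⟨11, 13, by decide, by decide⟩
/-- The position on the right, between `n₃` and `n₄` and apart from them. -/
def yr : Arc := ⟨-1, 1, by decide, by decide⟩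
/-- The arc from `yl` to `yr` through the top. -/
def yu : Arc := ⟨-1, 13, by decide, by decide⟩
/-- The arc from `yr` to `yl` through the bottom. -/
def yd : Arc := ⟨11, 25, by decide, by decide⟩
/-- The arc that covers `left`, `top` and `right`. -/
def upper : Arc := ⟨-3, 15, by decide, by decide⟩
/-- The arc that covers `left`, `bottom` and `right`. -/
def lower : Arc := ⟨9, 27, by decide, by decide⟩

end Arc

namespace PFA

open Arc

variable {K : Type u} [Field K] {F : PFA.{u, v} K} (S : F.Retracts) (hF : F.IsLocallyConstant)

namespace Chain

/-- The chain that moves `x` clockwise around the origin, at distance between `k` and `l`. -/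
noncomputable def ring (k l : ℕ) (hkl : k < l) (x : F.HR) : F.Chain :=
  arcPath S hF k l hkl left n₁ n₂ (by decide) (by decide) x
    + arcPath S hF k l hkl top n₂ n₃ (by decide) (by decide) x
    + arcPath S hF k l hkl right n₃ n₄ (by decide) (by decide) x
    + arcPath S hF k l hkl bottom n₄ n₁ (by decide) (by decide) x

/-- The chain that moves `y` clockwise around the origin, at distance between `2` and `3`. -/
noncomputable def midRing (y : F.HR) : F.Chain :=
  arcPath S hF 2 3 (by decide) yu yl yr (by decide) (by decide) y
    + arcPath S hF 2 3 (by decide) yd yr yl (by decide) (by decide) y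

/-- The loop of `x` around the left position `yl`. -/
noncomputable def loopL (x : F.HR) : F.Chain := loop S hF left n₁ n₂ (by decide) (by decide) x

/-- The loop of `x` around the arc at the top. -/
noncomputable def loopT (x : F.HR) : F.Chain := loop S hF top n₂ n₃ (by decide) (by decide) x

/-- The loop of `x` around the right position `yr`. -/
noncomputable def loopR (x : F.HR) : F.Chain := loop S hF right n₃ n₄ (by decide) (by decide) x

/-- The loop of `x` around the arc at the bottom. -/
noncomputable def loopB (x : F.HR) : F.Chain := loop S hF bottom n₄ n₁ (by decide) (by decide) x

/-- The channels cancel: the four loops subdivide the region between two rings. -/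
theorem loop_sum (x : F.HR) :
    loopL S hF x + loopT S hF x + loopB S hF x + loopR S hF x =
      ring S hF 3 4 (by decide) x - ring S hF 1 2 (by decide) x := by
  simp only [loopL, loopT, loopR, loopB, loop, ring]
  abel

/-- The three loops `loopL`, `loopT`, `loopR` add up to a loop around the arc `yu`. -/
theorem loop_sum_upper (x : F.HR) : loopL S hF x + loopT S hF x + loopR S hF x =
    arcPath S hF 3 4 (by decide) left n₁ n₂ (by decide) (by decide) x
    + arcPath S hF 3 4 (by decide) top n₂ n₃ (by decide) (by decide) x
    + arcPath S hF 3 4 (by decide) right n₃ n₄ (by decide) (by decide) x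
    + channel S hF n₄ x
    - arcPath S hF 1 2 (by decide) left n₁ n₂ (by decide) (by decide) x
    - arcPath S hF 1 2 (by decide) top n₂ n₃ (by decide) (by decide) x
    - arcPath S hF 1 2 (by decide) right n₃ n₄ (by decide) (by decide) x
    - channel S hF n₁ x := by
  simp only [loopL, loopT, loopR, loop]
  abel

/-- The three loops `loopL`, `loopB`, `loopR` add up to a loop around the arc `yd`. -/
theorem loop_sum_lower (x : F.HR) : loopL S hF x + loopB S hF x + loopR S hF x =
    arcPath S hF 3 4 (by decide) left n₁ n₂ (by decide) (by decide) x
    + arcPath S hF 3 4 (by decide) bottom n₄ n₁ (by decide) (by decide) x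
    + arcPath S hF 3 4 (by decide) right n₃ n₄ (by decide) (by decide) x
    + channel S hF n₂ x
    - arcPath S hF 1 2 (by decide) left n₁ n₂ (by decide) (by decide) x
    - arcPath S hF 1 2 (by decide) bottom n₄ n₁ (by decide) (by decide) x
    - arcPath S hF 1 2 (by decide) right n₃ n₄ (by decide) (by decide) x
    - channel S hF n₃ x := by
  simp only [loopL, loopB, loopR, loop]
  abel

variable {S} {j : ℤ} {x : F.HR} {P : Disk → Prop}

theorem ring_mem {k l : ℕ} {hkl : k < l} (hP : ∀ s, P (cell k l hkl s)) (hx : x ∈ F.HR.gr j) :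
    ring S hF k l hkl x ∈ chains P (j - 1) :=
  Submodule.add_mem _ (Submodule.add_mem _ (Submodule.add_mem _ (arcPath_mem hF (hP _) hx)
    (arcPath_mem hF (hP _) hx)) (arcPath_mem hF (hP _) hx)) (arcPath_mem hF (hP _) hx)

theorem midRing_mem (hP : ∀ s, P (cell 2 3 (by decide) s)) (hx : x ∈ F.HR.gr j) :
    midRing S hF x ∈ chains P (j - 1) :=
  Submodule.add_mem _ (arcPath_mem hF (hP _) hx) (arcPath_mem hF (hP _) hx)

section natural

variable {V : Type*} [AddCommGroup V] [Module K V] {f : F.Chain →ₗ[K] V}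

theorem Natural.bdry_ring (hf : Natural f P) {k l : ℕ} {hkl : k < l}
    (hP : ∀ s, P (cell k l hkl s)) : f (bdry (ring S hF k l hkl x)) = 0 := by
  rw [ring, map_add, map_add, map_add, map_add, map_add, map_add, hf.bdry_arcPath hF (hP _),
    hf.bdry_arcPath hF (hP _), hf.bdry_arcPath hF (hP _), hf.bdry_arcPath hF (hP _)]
  abel

theorem Natural.bdry_midRing (hf : Natural f P)
    (hP : ∀ s, P (cell 2 3 (by decide) s)) : f (bdry (midRing S hF x)) = 0 := by
  rw [midRing, map_add, map_add, hf.bdry_arcPath hF (hP _), hf.bdry_arcPath hF (hP _)]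
  abel

theorem Natural.bdry_upper (hf : Natural f P) (h₁ : P (cell 3 4 (by decide) left))
    (h₂ : P (cell 3 4 (by decide) top)) (h₃ : P (cell 3 4 (by decide) right))
    (h₄ : P (cell 1 2 (by decide) left)) (h₅ : P (cell 1 2 (by decide) top))
    (h₆ : P (cell 1 2 (by decide) right)) (h₇ : P (cell 1 4 (by decide) n₄))
    (h₈ : P (cell 1 4 (by decide) n₁)) :
    f (bdry (loopL S hF x + loopT S hF x + loopR S hF x)) = 0 := by
  rw [loop_sum_upper]
  iterate 8 rw [map_sub]
  iterate 6 rw [map_add]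
  rw [hf.bdry_arcPath hF h₁, hf.bdry_arcPath hF h₂, hf.bdry_arcPath hF h₃,
    hf.bdry_arcPath hF h₄, hf.bdry_arcPath hF h₅, hf.bdry_arcPath hF h₆, hf.bdry_channel hF h₇,
    hf.bdry_channel hF h₈]
  abel

theorem Natural.bdry_lower (hf : Natural f P) (h₁ : P (cell 3 4 (by decide) left))
    (h₂ : P (cell 3 4 (by decide) bottom)) (h₃ : P (cell 3 4 (by decide) right))
    (h₄ : P (cell 1 2 (by decide) left)) (h₅ : P (cell 1 2 (by decide) bottom))
    (h₆ : P (cell 1 2 (by decide) right)) (h₇ : P (cell 1 4 (by decide) n₂))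
    (h₈ : P (cell 1 4 (by decide) n₃)) :
    f (bdry (loopL S hF x + loopB S hF x + loopR S hF x)) = 0 := by
  rw [loop_sum_lower]
  iterate 8 rw [map_sub]
  iterate 6 rw [map_add]
  rw [hf.bdry_arcPath hF h₁, hf.bdry_arcPath hF h₂, hf.bdry_arcPath hF h₃,
    hf.bdry_arcPath hF h₄, hf.bdry_arcPath hF h₅, hf.bdry_arcPath hF h₆, hf.bdry_channel hF h₇,
    hf.bdry_channel hF h₈]
  abel

end natural

/-- Transport of `x` around a disk that contains the origin is the bracket. -/
theorem ev₂_ring (c : AnnularConfiguration) (hx : x ∈ F.HR.gr j) {k l : ℕ} {hkl : k < l} {B : Disk}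
    (h0 : (0 : Plane) ∈ (B : Set Plane)) (hB : ∀ s, Disjoint (cell k l hkl s : Set Plane) B)
    {e : F.obj B} (he : (F.obj B).d e = 0) :
    ev₂ S B (ring S hF k l hkl x) e = L S hF c x (pT S B e) := by
  have hkl' : (k : ℝ) < l := by exact_mod_cast hkl
  have hr : (k : ℝ) < (k + l) / 2 := by linarith
  have hr' : ((k : ℝ) + l) / 2 < l := by linarith
  have h2 := (cocycle S hF hx (pT S B e)).pot_sub_two_pi (z := 0) (r := (k + l) / 2)
    (θ := (29 / 2) * (Real.pi / 12)) (p := ⟨cell k l hkl n₁, B, hB _⟩)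
    ((Nat.cast_nonneg k).trans_lt hr)
    ⟨polarPoint_mem_cell (h := hkl) hr hr' ⟨0, by norm_num [n₁], by norm_num [n₁]⟩, h0⟩
  -- The midpoints of `n₁`, `n₂`, `n₃`, `n₄` are at `29 / 2`, `19 / 2`, `5 / 2`, `-5 / 2`, and
  -- after a clockwise turn the midpoint of `n₁` is at `-19 / 2`.
  have e2 : (29 / 2) * (Real.pi / 12) - 2 * Real.pi = (-19 / 2) * (Real.pi / 12) := by ring
  rw [e2] at h2
  rw [ev₂_of_closed hF (ring_mem hF (P := fun U => Disjoint (U : Set Plane) B) hB hx)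
    (fun e => (natural_ev₂ S B e).bdry_ring hF hB) he, L_eq_holonomy S hF c hx, ← h2, ring, map_add,
    map_add, map_add, LinearMap.add_apply, LinearMap.add_apply, LinearMap.add_apply,
    ev₂_arcPath hF hx _ h0 hB hr hr' (t := 29 / 2) (t' := 19 / 2) (by norm_num)
      ⟨0, by norm_num [left], by norm_num [left]⟩ ⟨0, by norm_num [n₁], by norm_num [n₁]⟩
      ⟨0, by norm_num [n₂], by norm_num [n₂]⟩,
    ev₂_arcPath hF hx _ h0 hB hr hr' (t := 19 / 2) (t' := 5 / 2) (by norm_num)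
      ⟨0, by norm_num [top], by norm_num [top]⟩ ⟨0, by norm_num [n₂], by norm_num [n₂]⟩
      ⟨0, by norm_num [n₃], by norm_num [n₃]⟩,
    ev₂_arcPath hF hx _ h0 hB hr hr' (t := 5 / 2) (t' := -5 / 2) (by norm_num)
      ⟨0, by norm_num [right], by norm_num [right]⟩ ⟨0, by norm_num [n₃], by norm_num [n₃]⟩
      ⟨0, by norm_num [n₄], by norm_num [n₄]⟩,
    ev₂_arcPath hF hx _ h0 hB hr hr' (t := -5 / 2) (t' := -19 / 2) (by norm_num)
      ⟨1, by norm_num [bottom], by norm_num [bottom]⟩ ⟨0, by norm_num [n₄], by norm_num [n₄]⟩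
      ⟨1, by norm_num [n₁], by norm_num [n₁]⟩]
  abel

/-- A path above the origin from the left to the right and a path back below the origin make up a
turn around the origin, so they compute the bracket. -/
theorem ev₂_arcPath_add (c : AnnularConfiguration) (hx : x ∈ F.HR.gr j) (y : F.HR) {k l : ℕ}
    {hkl : k < l} {u d n n' : Arc} {hn : n.Sub u} {hn' : n'.Sub u} {hd : n.Sub d} {hd' : n'.Sub d}
    (hu : u.a < 0 ∧ 12 < u.b) (hl : d.a < 12 ∧ 24 < d.b) (h : n.a < 12 ∧ 12 < n.b)
    (h' : n'.a < 0 ∧ 0 < n'.b) {B : Disk} (h0 : (0 : Plane) ∈ (B : Set Plane))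
    (hB : ∀ s, Disjoint (cell k l hkl s : Set Plane) B) :
    ev₂ S B (arcPath S hF k l hkl u n n' hn hn' x) (iT S hF B y)
      + ev₂ S B (arcPath S hF k l hkl d n' n hd' hd x) (iT S hF B y) = L S hF c x y := by
  have hkl' : (k : ℝ) < l := by exact_mod_cast hkl
  have hr : (k : ℝ) < (k + l) / 2 := by linarith
  have hr' : ((k : ℝ) + l) / 2 < l := by linarith
  have cast : ∀ {a b : ℤ}, a < b → (a : ℝ) < b := fun h => Int.cast_lt.2 h
  have u1 := cast hu.1
  have u2 := cast hu.2
  have d1 := cast hl.1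
  have d2 := cast hl.2
  have n1 := cast h.1
  have n2 := cast h.2
  have m1 := cast h'.1
  have m2 := cast h'.2
  push_cast at u1 u2 d1 d2 n1 n2 m1 m2
  have h2 := (cocycle S hF hx y).pot_sub_two_pi (z := 0) (r := (k + l) / 2)
    (θ := 12 * (Real.pi / 12)) (p := ⟨cell k l hkl n, B, hB _⟩)
    ((Nat.cast_nonneg k).trans_lt hr)
    ⟨polarPoint_mem_cell (h := hkl) hr hr' ⟨0, by push_cast; linarith, by push_cast; linarith⟩, h0⟩
  have e2 : 12 * (Real.pi / 12) - 2 * Real.pi = (-12) * (Real.pi / 12) := by ring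
  rw [e2] at h2
  rw [L_eq_holonomy S hF c hx, ← h2,
    ev₂_arcPath hF hx _ h0 hB hr hr' (t := 12) (t' := 0) (by norm_num)
      ⟨0, by push_cast; linarith, by push_cast; linarith⟩
      ⟨0, by push_cast; linarith, by push_cast; linarith⟩
      ⟨0, by push_cast; linarith, by push_cast; linarith⟩,
    ev₂_arcPath hF hx _ h0 hB hr hr' (t := 0) (t' := -12) (by norm_num)
      ⟨1, by push_cast; linarith, by push_cast; linarith⟩
      ⟨0, by push_cast; linarith, by push_cast; linarith⟩
      ⟨1, by push_cast; linarith, by push_cast; linarith⟩]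
  abel

/-- Transport of `x` along the middle ring, whose two paths make up a turn, is the bracket. -/
theorem ev₂_midRing (c : AnnularConfiguration) (hx : x ∈ F.HR.gr j) {B : Disk}
    (h0 : (0 : Plane) ∈ (B : Set Plane))
    (hB : ∀ s, Disjoint (cell 2 3 (by decide) s : Set Plane) B)
    {e : F.obj B} (he : (F.obj B).d e = 0) :
    ev₂ S B (midRing S hF x) e = L S hF c x (pT S B e) := by
  rw [ev₂_of_closed hF (midRing_mem hF (P := fun U => Disjoint (U : Set Plane) B) hB hx)
    (fun e => (natural_ev₂ S B e).bdry_midRing hF hB) he, midRing, map_add, LinearMap.add_apply]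
  exact ev₂_arcPath_add hF c hx _ (by decide) (by decide) (by decide) (by decide) h0 hB

end Chain
end PFA
end Prefact

/-! ### Unit, associativity and the classes of loops -/

namespace Prefact
namespace PFA

open Arc

variable {K : Type u} [Field K] {F : PFA.{u, v} K} (S : F.Retracts) (hF : F.IsLocallyConstant)

theorem pT_unit (D : Disk) : pT S D (F.unit D) = one S := by
  rw [pT_apply, F.incl_unit]
  rfl

theorem one_mem : one S ∈ F.HR.gr 0 := by
  rw [← pT_unit S Disk.whole]
  exact pT_mem S _ (unit_mem _)

theorem prod_mem {j k : ℤ} {x y : F.HR} (hx : x ∈ F.HR.gr j) (hy : y ∈ F.HR.gr k) :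
    prod S hF x y ∈ F.HR.gr (j + k) := by
  rw [prod, mul_eq]
  exact ev₂_mem S _ _ _ (iT_mem S hF _ hx) (iT_mem S hF _ hy)

theorem prod_one (x : F.HR) : prod S hF x (one S) = x := by
  have : (prod S hF).flip (one S) = LinearMap.id := by
    refine F.HR.hom_ext fun j x hx => ?_
    rw [LinearMap.flip_apply, LinearMap.id_apply]
    have h := ev₂_eq_prod S hF _ _ (halfPlane_disjoint 0 0) (iT_mem S hF _ hx) (d_iT S hF _ x)
      (F.d_unit _)
    rw [pT_iT, pT_unit, ev₂_apply, F.op₂_unit_right _ _ _ _ (Disk.subset_whole _), ← pT_apply,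
      pT_iT] at h
    exact h.symm
  exact LinearMap.congr_fun this x

theorem one_prod (x : F.HR) : prod S hF (one S) x = x := by
  have h := ev₂_eq_prod S hF _ _ (halfPlane_disjoint 0 0) (unit_mem (F := F) _) (F.d_unit _)
    (d_iT S hF _ x)
  rw [pT_iT, pT_unit, ev₂_apply, F.op₂_unit_left _ _ _ _ (Disk.subset_whole _), ← pT_apply,
    pT_iT] at h
  exact h.symm

theorem prod_comm {j k : ℤ} {x y : F.HR} (hx : x ∈ F.HR.gr j) (hy : y ∈ F.HR.gr k) :
    prod S hF x y = sgn K (j * k) • prod S hF y x := by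
  have e := ev₂_comm S _ _ (halfPlane_disjoint 0 0) (halfPlane_disjoint 0 0).symm
    (iT_mem S hF _ hx) (iT_mem S hF _ hy)
  rwa [← mul_eq S hF, ← mul_eq S hF, mul_eq_prod, mul_eq_prod] at e

theorem fits_cells {m n m' n' k l : ℕ} {h : m < n} {h' : m' < n'} {h'' : k < l} {s s' t : Arc}
    (h₁ : k ≤ m ∧ n ≤ l ∧ s.Sub t) (h₂ : k ≤ m' ∧ n' ≤ l ∧ s'.Sub t)
    (h₃ : s.Apart s' ∨ n ≤ m' ∨ n' ≤ m) :
    Disk.Fits ![cell m n h s, cell m' n' h' s'] (cell k l h'' t) := by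
  refine Disk.fits_two (cell_subset h₁.1 h₁.2.1 h₁.2.2) (cell_subset h₂.1 h₂.2.1 h₂.2.2) ?_
  rcases h₃ with h₃ | h₃
  · exact cell_disjoint h₃
  · exact cell_disjoint_of_radius s s' h₃

/-- The cocycle conditions for the product of the representatives of `x` and `y`. -/
theorem d_op₂_iT {A B T : Disk} (h : Disk.Fits ![A, B] T) {j : ℤ} {x : F.HR} (hx : x ∈ F.HR.gr j)
    {y : F.obj B} (hy : (F.obj B).d y = 0) :
    (F.obj T).d (F.op₂ A B T h (iT S hF A x) y) = 0 := by
  rw [d_op₂ _ _ _ _ (iT_mem S hF A hx), d_iT, hy, map_zero, map_zero, smul_zero, add_zero,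
    LinearMap.zero_apply]

theorem pT_op₂_iT {A B T : Disk} (h : Disk.Fits ![A, B] T) {j : ℤ} {x : F.HR}
    (hx : x ∈ F.HR.gr j) (y : F.HR) :
    pT S T (F.op₂ A B T h (iT S hF A x) (iT S hF B y)) = prod S hF x y := by
  rw [pT_op₂ S A B T h (Chain.fits_disjoint h), ev₂_eq_prod S hF _ _ _ (iT_mem S hF A hx)
    (d_iT S hF A x) (d_iT S hF B y), pT_iT, pT_iT]

/-- Both sides are the product of the three representatives over an outer cell, a middle cell and
the disk at the centre. -/
theorem prod_assoc (x y z : F.HR) :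
    prod S hF (prod S hF x y) z = prod S hF x (prod S hF y z) := by
  have key : ∀ (j : ℤ), ∀ x ∈ F.HR.gr j, ∀ (k : ℤ), ∀ y ∈ F.HR.gr k,
      prod S hF (prod S hF x y) z = prod S hF x (prod S hF y z) := by
    intro j x hx k y hy
    have f₁ : Disk.Fits ![cell 3 4 (by decide) left, cell 2 3 (by decide) yl]
        (cell 1 4 (by decide) left) := fits_cells (by decide) (by decide) (by decide)
    have f₂ : Disk.Fits ![cell 2 3 (by decide) yl, core 1 (by decide)] (core 3 (by decide)) :=
      Disk.fits_two (cell_subset_core _ (by decide)) (core_subset (by decide))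
        (cell_disjoint_core _ (by decide))
    have d₁ : Disjoint (cell 1 4 (by decide) left : Set Plane) (core 1 (by decide)) :=
      cell_disjoint_core _ (by decide)
    have d₂ : Disjoint (cell 3 4 (by decide) left : Set Plane) (core 3 (by decide)) :=
      cell_disjoint_core _ (by decide)
    have e := ev₂_op₂_left S _ _ _ _ f₁ d₁ (Chain.fits_disjoint f₁)
      (d₂.mono_right (Chain.fits_right f₂)) (Chain.fits_disjoint f₂) (iT S hF _ x) (iT S hF _ y)
      (iT S hF _ z)
    rw [← ev₂_op₂_right S _ _ _ _ f₂ d₂,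
      ev₂_eq_prod S hF _ _ _ (op₂_mem _ _ _ _ (iT_mem S hF _ hx) (iT_mem S hF _ hy))
        (d_op₂_iT S hF f₁ hx (d_iT S hF _ y)) (d_iT S hF _ z),
      ev₂_eq_prod S hF _ _ _ (iT_mem S hF _ hx) (d_iT S hF _ x)
        (d_op₂_iT S hF f₂ hy (d_iT S hF _ z)),
      pT_op₂_iT S hF f₁ hx, pT_op₂_iT S hF f₂ hy, pT_iT, pT_iT] at e
    exact e
  have h1 : ∀ (j : ℤ), ∀ x ∈ F.HR.gr j, (prod S hF).flip z ∘ₗ prod S hF x =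
      prod S hF x ∘ₗ (prod S hF).flip z :=
    fun j x hx => F.HR.hom_ext fun k y hy => key j x hx k y hy
  have h2 : (prod S hF).flip z ∘ₗ (prod S hF).flip y = (prod S hF).flip (prod S hF y z) :=
    F.HR.hom_ext fun j x hx => LinearMap.congr_fun (h1 j x hx) y
  exact LinearMap.congr_fun h2 x

variable (c : AnnularConfiguration)

/-- The paths of the ring have class `0`, so that nothing remains when the centre is filled by the
unit. -/
theorem L_one (x : F.HR) : L S hF c x (one S) = 0 := by
  have : (L S hF c).flip (one S) = 0 := by
    refine F.HR.hom_ext fun j x hx => ?_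
    have hm : Chain.ring S hF 1 2 (by decide) x ∈
        Chain.chains (fun U => Disjoint (U : Set Plane) (core 1 (by decide))) (j - 1) :=
      Chain.ring_mem hF (P := fun U => Disjoint (U : Set Plane) (core 1 (by decide)))
        (fun s => cell_disjoint_core s le_rfl) hx
    have e := Chain.ev₂_ring (S := S) (k := 1) (l := 2) (hkl := by decide) hF c hx
      (zero_mem_core 1 (by decide)) (fun s => cell_disjoint_core s le_rfl) (F.d_unit _)
    rw [pT_unit, Chain.ev₂_unit hm, Chain.ring, map_add, map_add, map_add, Chain.lift_arcPath,
      Chain.lift_arcPath, Chain.lift_arcPath, Chain.lift_arcPath, add_zero, add_zero, add_zero] at e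
    exact e.symm
  exact LinearMap.congr_fun this x

/-- A loop that can be filled in the complement of `Y` and `Z` acts trivially. -/
theorem ev₃_loop {s n n' : Arc} {hn : n.Sub s} {hn' : n'.Sub s} {j k : ℤ} {x : F.HR}
    (hx : x ∈ F.HR.gr j) {Y Z : Disk} (h : Chain.Disjoint₃ (cell 1 4 (by decide) s) Y Z)
    {y : F.obj Y} {z : F.obj Z} (hk : y ∈ (F.obj Y).gr k) (hy : (F.obj Y).d y = 0)
    (hz : (F.obj Z).d z = 0) :
    Chain.ev₃ S Y Z (Chain.loop S hF s n n' hn hn' x) y z = 0 := by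
  have := ev₃_d S _ _ _ h.1 h.2.1 h.2.2 (Chain.filling_mem (S := S) hF (hn := hn) (hn' := hn') hx)
    hk hz
  rw [hy, map_zero, LinearMap.zero_apply, smul_zero, add_zero, Chain.d_filling hF hx] at this
  rw [Chain.ev₃_sumIn h (Chain.loop_mem hF hx), this]

theorem loopL_mem {j : ℤ} {x : F.HR} (hx : x ∈ F.HR.gr j) :
    Chain.loopL S hF x ∈ Chain.chains
      (fun U => Disk.Fits ![U, cell 2 3 (by decide) yl] (cell 1 4 (by decide) left)) (j - 1) := by
  refine Submodule.sub_mem _ (Submodule.sub_mem _ (Submodule.add_mem _ ?_ ?_) ?_) ?_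
  · exact Chain.arcPath_mem hF (fits_cells (by decide) (by decide) (by decide)) hx
  · exact Chain.channel_mem hF (fits_cells (by decide) (by decide) (by decide)) hx
  · exact Chain.arcPath_mem hF (fits_cells (by decide) (by decide) (by decide)) hx
  · exact Chain.channel_mem hF (fits_cells (by decide) (by decide) (by decide)) hx

theorem loopR_mem {j : ℤ} {x : F.HR} (hx : x ∈ F.HR.gr j) :
    Chain.loopR S hF x ∈ Chain.chains
      (fun U => Disk.Fits ![U, cell 2 3 (by decide) yr] (cell 1 4 (by decide) right)) (j - 1) := by
  refine Submodule.sub_mem _ (Submodule.sub_mem _ (Submodule.add_mem _ ?_ ?_) ?_) ?_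
  · exact Chain.arcPath_mem hF (fits_cells (by decide) (by decide) (by decide)) hx
  · exact Chain.channel_mem hF (fits_cells (by decide) (by decide) (by decide)) hx
  · exact Chain.arcPath_mem hF (fits_cells (by decide) (by decide) (by decide)) hx
  · exact Chain.channel_mem hF (fits_cells (by decide) (by decide) (by decide)) hx

/-- The loop on the left, multiplied with `y`: a cocycle that represents the bracket of `x` and
`y`. -/
noncomputable def bracketL (x y : F.HR) : F.obj (cell 1 4 (by decide) left) :=
  Chain.mulIn _ _ (Chain.loopL S hF x) (iT S hF (cell 2 3 (by decide) yl) y)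

/-- The loop on the right, multiplied with `y`. -/
noncomputable def bracketR (x y : F.HR) : F.obj (cell 1 4 (by decide) right) :=
  Chain.mulIn _ _ (Chain.loopR S hF x) (iT S hF (cell 2 3 (by decide) yr) y)

theorem d_bracketL {j : ℤ} {x : F.HR} (hx : x ∈ F.HR.gr j) (y : F.HR) :
    (F.obj _).d (bracketL S hF x y) = 0 := by
  rw [bracketL, Chain.d_mulIn (loopL_mem S hF hx), d_iT, map_zero, smul_zero, add_zero]
  exact (Chain.natural_mulIn _ _ _).bdry_loop hF (fits_cells (by decide) (by decide) (by decide))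
    (fits_cells (by decide) (by decide) (by decide))
    (fits_cells (by decide) (by decide) (by decide))
    (fits_cells (by decide) (by decide) (by decide))

theorem d_bracketR {j : ℤ} {x : F.HR} (hx : x ∈ F.HR.gr j) (y : F.HR) :
    (F.obj _).d (bracketR S hF x y) = 0 := by
  rw [bracketR, Chain.d_mulIn (loopR_mem S hF hx), d_iT, map_zero, smul_zero, add_zero]
  exact (Chain.natural_mulIn _ _ _).bdry_loop hF (fits_cells (by decide) (by decide) (by decide))
    (fits_cells (by decide) (by decide) (by decide))
    (fits_cells (by decide) (by decide) (by decide))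
    (fits_cells (by decide) (by decide) (by decide))

theorem bracketL_mem {j k : ℤ} {x y : F.HR} (hx : x ∈ F.HR.gr j) (hy : y ∈ F.HR.gr k) :
    bracketL S hF x y ∈ (F.obj _).gr (j - 1 + k) :=
  Chain.mulIn_mem (loopL_mem S hF hx) (iT_mem S hF _ hy)

theorem bracketR_mem {j k : ℤ} {x y : F.HR} (hx : x ∈ F.HR.gr j) (hy : y ∈ F.HR.gr k) :
    bracketR S hF x y ∈ (F.obj _).gr (j - 1 + k) :=
  Chain.mulIn_mem (loopR_mem S hF hx) (iT_mem S hF _ hy)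

/-- Transport of `x` around `y` and `z`, where `y` is at `Y` and `z` at the origin. -/
theorem ev₃_outer {j k : ℤ} {x : F.HR} (hx : x ∈ F.HR.gr j) {Y : Disk}
    (hY : Disk.Fits ![Y, core 1 (by decide)] (core 3 (by decide))) {y : F.obj Y}
    (hk : y ∈ (F.obj Y).gr k) (hy : (F.obj Y).d y = 0) (z : F.HR) :
    Chain.ev₃ S Y (core 1 (by decide)) (Chain.ring S hF 3 4 (by decide) x) y (iT S hF _ z) =
      L S hF c x (prod S hF (pT S Y y) z) := by
  rw [Chain.ev₃_eq_ev₂ (T := core 3 (by decide)) hY (Chain.ring_mem hF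
    (P := fun U => Disjoint (U : Set Plane) (core 3 _)) (fun s => cell_disjoint_core s le_rfl) hx),
    Chain.ev₂_ring hF c hx (zero_mem_core _ _) (fun s => cell_disjoint_core s le_rfl),
    pT_op₂ S _ _ _ _ (Chain.fits_disjoint hY), ev₂_eq_prod S hF _ _ _ hk hy (d_iT S hF _ z), pT_iT]
  rw [d_op₂ _ _ _ _ hk, hy, d_iT, map_zero, map_zero, smul_zero, add_zero,
    LinearMap.zero_apply]

end PFA
end Prefact

/-! ### The Leibniz rule -/

namespace Prefact
namespace PFA

open Arc

variable {K : Type u} [Field K] {F : PFA.{u, v} K} (S : F.Retracts) (hF : F.IsLocallyConstant)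
  (c : AnnularConfiguration)

theorem inner_mem {j : ℤ} {x : F.HR} (hx : x ∈ F.HR.gr j) :
    Chain.ring S hF 1 2 (by decide) x ∈ Chain.chains
      (fun U => Disk.Fits ![U, core 1 (by decide)] (core 2 (by decide))) (j - 1) :=
  Chain.ring_mem hF (P := fun U => Disk.Fits ![U, core 1 (by decide)] (core 2 (by decide)))
    (fun s => Disk.fits_two (cell_subset_core s le_rfl) (core_subset (by decide))
      (cell_disjoint_core s le_rfl)) hx

/-- Transport of `x` around `z` in the disk of radius `2`. -/
noncomputable def innerBracket (x z : F.HR) : F.obj (core 2 (by decide)) :=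
  Chain.mulIn (core 1 (by decide)) _ (Chain.ring S hF 1 2 (by decide) x) (iT S hF _ z)

theorem d_innerBracket {j : ℤ} {x : F.HR} (hx : x ∈ F.HR.gr j) (z : F.HR) :
    (F.obj _).d (innerBracket S hF x z) = 0 := by
  rw [innerBracket, Chain.d_mulIn (inner_mem S hF hx), d_iT, map_zero, smul_zero, add_zero]
  exact (Chain.natural_mulIn _ _ _).bdry_ring hF
    (fun s => Disk.fits_two (cell_subset_core s le_rfl) (core_subset (by decide))
      (cell_disjoint_core s le_rfl))

theorem pT_innerBracket {j : ℤ} {x : F.HR} (hx : x ∈ F.HR.gr j) (z : F.HR) :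
    pT S _ (innerBracket S hF x z) = L S hF c x z := by
  rw [innerBracket, Chain.pT_mulIn (inner_mem S hF hx),
    Chain.ev₂_ring hF c hx (zero_mem_core 1 _) (fun s => cell_disjoint_core s le_rfl)
      (d_iT S hF _ z), pT_iT]

/-- If `x` turns around `z` inside of `Y`, it does so before the multiplication with `y`. -/
theorem ev₃_inner {j k : ℤ} {x : F.HR} (hx : x ∈ F.HR.gr j) {Y : Disk}
    (hY : Disjoint (Y : Set Plane) (core 2 (by decide))) {y : F.obj Y}
    (hk : y ∈ (F.obj Y).gr k) (z : F.HR) :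
    Chain.ev₃ S Y (core 1 (by decide)) (Chain.ring S hF 1 2 (by decide) x) y (iT S hF _ z) =
      sgn K ((j - 1) * k) • ev₂ S Y _ hY y (innerBracket S hF x z) :=
  Chain.ev₃_swap hY (hY.mono_right (core_subset (by decide))) (inner_mem S hF hx) hk _

theorem disjoint₃_cells {k l m n i : ℕ} {h : k < l} {h' : m < n} {h'' : 0 < i} {s s' : Arc}
    (hs : s.Apart s') (hk : i ≤ k) (hm : i ≤ m) :
    Chain.Disjoint₃ (cell k l h s) (cell m n h' s') (core i h'') :=
  ⟨cell_disjoint hs, cell_disjoint_core s hk, cell_disjoint_core s' hm⟩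

theorem cell_core_fits (s : Arc) :
    Disk.Fits ![cell 2 3 (by decide) s, core 1 (by decide)] (core 3 (by decide)) :=
  Disk.fits_two (cell_subset_core _ (by decide)) (core_subset (by decide))
    (cell_disjoint_core _ (by decide))

/-- The ring of `x` around `y` and `z`, minus the ring around `z` only, is the loop around `y`; the
other three loops are contractible in the complement of `y` and `z`. -/
theorem prod_bracketL {j k : ℤ} {x y : F.HR} (hx : x ∈ F.HR.gr j) (hy : y ∈ F.HR.gr k) (z : F.HR) :
    prod S hF (pT S _ (bracketL S hF x y)) z =
      L S hF c x (prod S hF y z) - sgn K ((j - 1) * k) • prod S hF y (L S hF c x z) := by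
  have hy' := iT_mem S hF (cell 2 3 (by decide) yl) hy
  have d₁ : Disjoint (cell 1 4 (by decide) left : Set Plane) (core 1 (by decide)) :=
    cell_disjoint_core _ (by decide)
  have d₂ : Disjoint (cell 2 3 (by decide) yl : Set Plane) (core 2 (by decide)) :=
    cell_disjoint_core _ (by decide)
  have e1 := ev₂_eq_prod S hF _ _ d₁ (bracketL_mem S hF hx hy) (d_bracketL S hF hx y)
    (d_iT S hF _ z)
  rw [pT_iT, bracketL, Chain.ev₂_mulIn d₁ (loopL_mem S hF hx)] at e1
  have e2 := ev₃_outer S hF c hx (cell_core_fits yl) hy' (d_iT S hF _ y) z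
  rw [pT_iT] at e2
  have e3 := ev₃_inner S hF hx d₂ hy' z
  rw [ev₂_eq_prod S hF _ _ _ hy' (d_iT S hF _ y) (d_innerBracket S hF hx z), pT_iT,
    pT_innerBracket S hF c hx] at e3
  have e4 := ev₃_loop S hF (s := top) (n := n₂) (n' := n₃) (hn := by decide) (hn' := by decide) hx
    (disjoint₃_cells (m := 2) (n := 3) (i := 1) (h' := by decide) (h'' := by decide) (s' := yl)
      (by decide) (by decide) (by decide)) hy' (d_iT S hF _ y) (d_iT S hF _ z)
  have e5 := ev₃_loop S hF (s := bottom) (n := n₄) (n' := n₁) (hn := by decide)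
    (hn' := by decide) hx
    (disjoint₃_cells (m := 2) (n := 3) (i := 1) (h' := by decide) (h'' := by decide) (s' := yl)
      (by decide) (by decide) (by decide)) hy' (d_iT S hF _ y) (d_iT S hF _ z)
  have e6 := ev₃_loop S hF (s := right) (n := n₃) (n' := n₄) (hn := by decide) (hn' := by decide) hx
    (disjoint₃_cells (m := 2) (n := 3) (i := 1) (h' := by decide) (h'' := by decide) (s' := yl)
      (by decide) (by decide) (by decide)) hy' (d_iT S hF _ y) (d_iT S hF _ z)
  rw [bracketL, ← e1, ← e2, ← e3]
  have e7 := congrArg (fun a => Chain.ev₃ S (cell 2 3 (by decide) yl) (core 1 (by decide)) a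
    (iT S hF _ y) (iT S hF _ z)) (Chain.loop_sum S hF x)
  simp only [map_add, map_sub, LinearMap.add_apply, LinearMap.sub_apply] at e7
  rw [← e7, Chain.loopT, Chain.loopB, Chain.loopR, e4, e5, e6, add_zero, add_zero, add_zero]

/-- The case `z = 1` identifies the class of the loop of `x` around `y` with the bracket. -/
theorem pT_bracketL {j k : ℤ} {x y : F.HR} (hx : x ∈ F.HR.gr j) (hy : y ∈ F.HR.gr k) :
    pT S _ (bracketL S hF x y) = L S hF c x y := by
  have := prod_bracketL S hF c hx hy (one S)
  rwa [L_one, map_zero, smul_zero, sub_zero, prod_one, prod_one] at this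

/-- The bracket is a derivation of the product in its second argument. -/
theorem L_prod {j k : ℤ} {x y : F.HR} (hx : x ∈ F.HR.gr j) (hy : y ∈ F.HR.gr k) (z : F.HR) :
    L S hF c x (prod S hF y z) =
      prod S hF (L S hF c x y) z + sgn K ((j - 1) * k) • prod S hF y (L S hF c x z) := by
  rw [← pT_bracketL S hF c hx hy, prod_bracketL S hF c hx hy, sub_add_cancel]

/-! ### The Jacobi identity -/

/-- The path of `y` over the arc `s`, from the left to the right. -/
noncomputable def midPath (s : Arc) (h : yl.Sub s) (h' : yr.Sub s) (y : F.HR) :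
    F.obj (cell 2 3 (by decide) s) :=
  path S hF _ (cell 2 3 (by decide) yl) (cell 2 3 (by decide) yr)
    (cell_subset le_rfl le_rfl h) (cell_subset le_rfl le_rfl h') y

theorem midPath_mem {s : Arc} {h : yl.Sub s} {h' : yr.Sub s} {k : ℤ} {y : F.HR}
    (hy : y ∈ F.HR.gr k) : midPath S hF s h h' y ∈ (F.obj _).gr (k - 1) :=
  path_mem S hF _ _ _ _ _ hy

theorem d_midPath {s : Arc} {h : yl.Sub s} {h' : yr.Sub s} (y : F.HR) :
    (F.obj _).d (midPath S hF s h h' y) =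
      F.incl _ _ (cell_subset le_rfl le_rfl h') (iT S hF (cell 2 3 (by decide) yr) y)
        - F.incl _ _ (cell_subset le_rfl le_rfl h) (iT S hF (cell 2 3 (by decide) yl) y) :=
  d_path S hF _ _ _ _ _ y

theorem midRing_eq (y : F.HR) : Chain.midRing S hF y =
    Chain.of _ (midPath S hF yu (by decide) (by decide) y)
      - Chain.of _ (midPath S hF yd (by decide) (by decide) y) := by
  have e : path S hF (cell 2 3 (by decide) yd) (cell 2 3 (by decide) yr) (cell 2 3 (by decide) yl)
      (cell_subset le_rfl le_rfl (by decide)) (cell_subset le_rfl le_rfl (by decide)) y =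
      -midPath S hF yd (by decide) (by decide) y := by
    rw [midPath, path_apply, path_apply, neg_sub]
  rw [Chain.midRing, Chain.arcPath, Chain.arcPath, e, map_neg, ← sub_eq_add_neg]
  rfl

theorem midRing_mem_fits {k : ℤ} {y : F.HR} (hy : y ∈ F.HR.gr k) :
    Chain.midRing S hF y ∈ Chain.chains
      (fun U => Disk.Fits ![U, core 1 (by decide)] (core 3 (by decide))) (k - 1) :=
  Chain.midRing_mem hF (P := fun U => Disk.Fits ![U, core 1 (by decide)] (core 3 (by decide)))
    cell_core_fits hy

/-- `x` turns around `y` and `z`, while `y` turns around `z`. -/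
theorem ev₃_outer_midRing {j k : ℤ} {x y : F.HR} (hx : x ∈ F.HR.gr j) (hy : y ∈ F.HR.gr k)
    (z : F.HR) :
    Chain.ev₃ S _ (core 1 (by decide)) (Chain.ring S hF 3 4 (by decide) x)
        (midPath S hF yu (by decide) (by decide) y) (iT S hF _ z)
      - Chain.ev₃ S _ (core 1 (by decide)) (Chain.ring S hF 3 4 (by decide) x)
        (midPath S hF yd (by decide) (by decide) y) (iT S hF _ z) =
      L S hF c x (L S hF c y z) := by
  have hm := Chain.ring_mem (S := S) hF (k := 3) (l := 4) (hkl := by decide)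
    (P := fun U => Disjoint (U : Set Plane) (core 3 (by decide)))
    (fun s => cell_disjoint_core s le_rfl) hx
  have e1 : (F.obj _).d (Chain.mulIn (core 1 (by decide)) (core 3 (by decide))
      (Chain.midRing S hF y) (iT S hF _ z)) = 0 := by
    rw [Chain.d_mulIn (midRing_mem_fits S hF hy), d_iT, map_zero, smul_zero, add_zero]
    exact (Chain.natural_mulIn _ _ _).bdry_midRing hF cell_core_fits
  have e2 := Chain.ev₂_ring (S := S) (k := 3) (l := 4) (hkl := by decide) hF c hx
    (zero_mem_core 3 _) (fun s => cell_disjoint_core s le_rfl) e1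
  rw [Chain.pT_mulIn (midRing_mem_fits S hF hy), Chain.ev₂_midRing hF c hy (zero_mem_core 1 _)
    (fun s => cell_disjoint_core s (by decide)) (d_iT S hF _ z), pT_iT] at e2
  rw [← e2, Chain.ev₃_eq_ev₂ (cell_core_fits yu) hm, Chain.ev₃_eq_ev₂ (cell_core_fits yd) hm,
    midRing_eq, map_sub, LinearMap.sub_apply, Chain.mulIn_of (cell_core_fits yu),
    Chain.mulIn_of (cell_core_fits yd), map_sub]

/-- `y` turns around `x` and `z`, while `x` turns around `z`. -/
theorem ev₃_inner_midRing {j k : ℤ} {x y : F.HR} (hx : x ∈ F.HR.gr j) (hy : y ∈ F.HR.gr k)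
    (z : F.HR) :
    Chain.ev₃ S _ (core 1 (by decide)) (Chain.ring S hF 1 2 (by decide) x)
        (midPath S hF yu (by decide) (by decide) y) (iT S hF _ z)
      - Chain.ev₃ S _ (core 1 (by decide)) (Chain.ring S hF 1 2 (by decide) x)
        (midPath S hF yd (by decide) (by decide) y) (iT S hF _ z) =
      sgn K ((j - 1) * (k - 1)) • L S hF c y (L S hF c x z) := by
  have e2 := Chain.ev₂_midRing (S := S) hF c hy (zero_mem_core 2 (by decide))
    (fun s => cell_disjoint_core s le_rfl) (d_innerBracket S hF hx z)
  rw [pT_innerBracket S hF c hx, midRing_eq, map_sub, LinearMap.sub_apply,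
    Chain.ev₂_of S (cell_disjoint_core yu le_rfl),
    Chain.ev₂_of S (cell_disjoint_core yd le_rfl)] at e2
  rw [ev₃_inner S hF hx (cell_disjoint_core yu le_rfl) (midPath_mem S hF hy),
    ev₃_inner S hF hx (cell_disjoint_core yd le_rfl) (midPath_mem S hF hy), ← smul_sub, e2]

end PFA
end Prefact

namespace Prefact
namespace PFA

open Arc

variable {K : Type u} [Field K] {F : PFA.{u, v} K} (S : F.Retracts) (hF : F.IsLocallyConstant)
  (c : AnnularConfiguration)

theorem upper_mem {j : ℤ} {x : F.HR} (hx : x ∈ F.HR.gr j) :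
    Chain.loopL S hF x + Chain.loopT S hF x + Chain.loopR S hF x ∈ Chain.chains
      (fun U => Disk.Fits ![U, cell 2 3 (by decide) yu] (cell 1 4 (by decide) upper)) (j - 1) := by
  rw [Chain.loop_sum_upper]
  refine Submodule.sub_mem _ (Submodule.sub_mem _ (Submodule.sub_mem _ (Submodule.sub_mem _
    (Submodule.add_mem _ (Submodule.add_mem _ (Submodule.add_mem _ ?_ ?_) ?_) ?_) ?_) ?_) ?_) ?_
  · exact Chain.arcPath_mem hF (fits_cells (by decide) (by decide) (by decide)) hx
  · exact Chain.arcPath_mem hF (fits_cells (by decide) (by decide) (by decide)) hx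
  · exact Chain.arcPath_mem hF (fits_cells (by decide) (by decide) (by decide)) hx
  · exact Chain.channel_mem hF (fits_cells (by decide) (by decide) (by decide)) hx
  · exact Chain.arcPath_mem hF (fits_cells (by decide) (by decide) (by decide)) hx
  · exact Chain.arcPath_mem hF (fits_cells (by decide) (by decide) (by decide)) hx
  · exact Chain.arcPath_mem hF (fits_cells (by decide) (by decide) (by decide)) hx
  · exact Chain.channel_mem hF (fits_cells (by decide) (by decide) (by decide)) hx

theorem lower_mem {j : ℤ} {x : F.HR} (hx : x ∈ F.HR.gr j) :
    Chain.loopL S hF x + Chain.loopB S hF x + Chain.loopR S hF x ∈ Chain.chains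
      (fun U => Disk.Fits ![U, cell 2 3 (by decide) yd] (cell 1 4 (by decide) lower)) (j - 1) := by
  rw [Chain.loop_sum_lower]
  refine Submodule.sub_mem _ (Submodule.sub_mem _ (Submodule.sub_mem _ (Submodule.sub_mem _
    (Submodule.add_mem _ (Submodule.add_mem _ (Submodule.add_mem _ ?_ ?_) ?_) ?_) ?_) ?_) ?_) ?_
  · exact Chain.arcPath_mem hF (fits_cells (by decide) (by decide) (by decide)) hx
  · exact Chain.arcPath_mem hF (fits_cells (by decide) (by decide) (by decide)) hx
  · exact Chain.arcPath_mem hF (fits_cells (by decide) (by decide) (by decide)) hx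
  · exact Chain.channel_mem hF (fits_cells (by decide) (by decide) (by decide)) hx
  · exact Chain.arcPath_mem hF (fits_cells (by decide) (by decide) (by decide)) hx
  · exact Chain.arcPath_mem hF (fits_cells (by decide) (by decide) (by decide)) hx
  · exact Chain.arcPath_mem hF (fits_cells (by decide) (by decide) (by decide)) hx
  · exact Chain.channel_mem hF (fits_cells (by decide) (by decide) (by decide)) hx

/-- The filling of the loop `loopL` on the left. -/
noncomputable def fillL (x : F.HR) := Chain.filling S hF left n₁ n₂ (by decide) (by decide) x

/-- The filling of the loop `loopT` at the top. -/
noncomputable def fillT (x : F.HR) := Chain.filling S hF top n₂ n₃ (by decide) (by decide) x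

/-- The filling of the loop `loopR` on the right. -/
noncomputable def fillR (x : F.HR) := Chain.filling S hF right n₃ n₄ (by decide) (by decide) x

/-- The filling of the loop `loopB` at the bottom. -/
noncomputable def fillB (x : F.HR) := Chain.filling S hF bottom n₄ n₁ (by decide) (by decide) x

/-- The homotopy in the upper half of the annulus from the bracket on the left to the bracket on the
right. -/
noncomputable def upperMover (j : ℤ) (x y : F.HR) : F.obj (cell 1 4 (by decide) upper) :=
  Chain.mover (j - 1) (Chain.loopL S hF x + Chain.loopT S hF x + Chain.loopR S hF x)
    (fillL S hF x) (fillT S hF x) (fillR S hF x) (iT S hF (cell 2 3 (by decide) yl) y)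
    (iT S hF (cell 2 3 (by decide) yr) y) (midPath S hF yu (by decide) (by decide) y)

/-- The homotopy in the lower half of the annulus from the bracket on the left to the bracket on the
right. -/
noncomputable def lowerMover (j : ℤ) (x y : F.HR) : F.obj (cell 1 4 (by decide) lower) :=
  Chain.mover (j - 1) (Chain.loopL S hF x + Chain.loopB S hF x + Chain.loopR S hF x)
    (fillL S hF x) (fillB S hF x) (fillR S hF x) (iT S hF (cell 2 3 (by decide) yl) y)
    (iT S hF (cell 2 3 (by decide) yr) y) (midPath S hF yd (by decide) (by decide) y)

variable {S} {j k : ℤ} {x y : F.HR}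

theorem upperMover_mem (hx : x ∈ F.HR.gr j) (hy : y ∈ F.HR.gr k) :
    upperMover S hF j x y ∈ (F.obj _).gr (j - 1 + k - 1) :=
  Chain.mover_mem (upper_mem S hF hx) (fits_cells (by decide) (by decide) (by decide))
    (fits_cells (by decide) (by decide) (by decide))
    (fits_cells (by decide) (by decide) (by decide))
    (fits_cells (by decide) (by decide) (by decide)) (Chain.filling_mem hF hx)
    (Chain.filling_mem hF hx) (Chain.filling_mem hF hx) (iT_mem S hF _ hy) (iT_mem S hF _ hy)
    (midPath_mem S hF hy)

theorem lowerMover_mem (hx : x ∈ F.HR.gr j) (hy : y ∈ F.HR.gr k) :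
    lowerMover S hF j x y ∈ (F.obj _).gr (j - 1 + k - 1) :=
  Chain.mover_mem (lower_mem S hF hx) (fits_cells (by decide) (by decide) (by decide))
    (fits_cells (by decide) (by decide) (by decide))
    (fits_cells (by decide) (by decide) (by decide))
    (fits_cells (by decide) (by decide) (by decide)) (Chain.filling_mem hF hx)
    (Chain.filling_mem hF hx) (Chain.filling_mem hF hx) (iT_mem S hF _ hy) (iT_mem S hF _ hy)
    (midPath_mem S hF hy)

theorem d_upperMover (hx : x ∈ F.HR.gr j) :
    (F.obj _).d (upperMover S hF j x y) =
      F.incl _ _ (cell_subset le_rfl le_rfl (by decide)) (bracketR S hF x y)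
        - F.incl _ _ (cell_subset le_rfl le_rfl (by decide)) (bracketL S hF x y) := by
  rw [bracketL, bracketR, Chain.incl_mulIn _ (loopL_mem S hF hx),
    Chain.incl_mulIn _ (loopR_mem S hF hx)]
  refine Chain.d_mover (Chain.loop_mem hF hx) (Chain.loop_mem hF hx) (Chain.loop_mem hF hx)
    (upper_mem S hF hx) ?_ _ _ (fits_cells (by decide) (by decide) (by decide))
    (fits_cells (by decide) (by decide) (by decide))
    (fits_cells (by decide) (by decide) (by decide))
    (fits_cells (by decide) (by decide) (by decide)) (Chain.filling_mem hF hx)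
    (Chain.filling_mem hF hx) (Chain.filling_mem hF hx) (Chain.d_filling hF hx)
    (Chain.d_filling hF hx) (Chain.d_filling hF hx) (d_iT S hF _ y) (d_iT S hF _ y)
    (d_midPath S hF y)
  refine (Chain.natural_mulIn _ _ _).bdry_upper hF ?_ ?_ ?_ ?_ ?_ ?_ ?_ ?_ <;>
    exact fits_cells (by decide) (by decide) (by decide)

theorem d_lowerMover (hx : x ∈ F.HR.gr j) :
    (F.obj _).d (lowerMover S hF j x y) =
      F.incl _ _ (cell_subset le_rfl le_rfl (by decide)) (bracketR S hF x y)
        - F.incl _ _ (cell_subset le_rfl le_rfl (by decide)) (bracketL S hF x y) := by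
  rw [bracketL, bracketR, Chain.incl_mulIn _ (loopL_mem S hF hx),
    Chain.incl_mulIn _ (loopR_mem S hF hx)]
  refine Chain.d_mover (Chain.loop_mem hF hx) (Chain.loop_mem hF hx) (Chain.loop_mem hF hx)
    (lower_mem S hF hx) ?_ _ _ (fits_cells (by decide) (by decide) (by decide))
    (fits_cells (by decide) (by decide) (by decide))
    (fits_cells (by decide) (by decide) (by decide))
    (fits_cells (by decide) (by decide) (by decide)) (Chain.filling_mem hF hx)
    (Chain.filling_mem hF hx) (Chain.filling_mem hF hx) (Chain.d_filling hF hx)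
    (Chain.d_filling hF hx) (Chain.d_filling hF hx) (d_iT S hF _ y) (d_iT S hF _ y)
    (d_midPath S hF y)
  refine (Chain.natural_mulIn _ _ _).bdry_lower hF ?_ ?_ ?_ ?_ ?_ ?_ ?_ ?_ <;>
    exact fits_cells (by decide) (by decide) (by decide)

theorem upper_disjoint :
    Disjoint (cell 1 4 (by decide) upper : Set Plane) (core 1 (by decide)) :=
  cell_disjoint_core _ le_rfl

theorem lower_disjoint :
    Disjoint (cell 1 4 (by decide) lower : Set Plane) (core 1 (by decide)) :=
  cell_disjoint_core _ le_rfl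

/-- The difference of the homotopies through the upper and the lower half is the difference of the
two double transports of `x` and `y` around `z`. -/
theorem ev₂_mover_sub (hx : x ∈ F.HR.gr j) (hy : y ∈ F.HR.gr k) (z : F.HR) :
    ev₂ S _ _ upper_disjoint (upperMover S hF j x y) (iT S hF _ z)
      - ev₂ S _ _ lower_disjoint (lowerMover S hF j x y) (iT S hF _ z) =
    sgn K (j - 1) • (L S hF c x (L S hF c y z)
      - sgn K ((j - 1) * (k - 1)) • L S hF c y (L S hF c x z)) := by
  have e1 := Chain.ev₂_mover (S := S) upper_disjoint (upper_mem S hF hx) (Chain.loop_mem hF hx)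
    (cN := Chain.loopB S hF x) (bN := fillB S hF x)
    (cell_subset le_rfl le_rfl (by decide)) (cell_subset le_rfl le_rfl (by decide))
    (fits_cells (by decide) (by decide) (by decide))
    (fits_cells (by decide) (by decide) (by decide))
    (fits_cells (by decide) (by decide) (by decide))
    (fits_cells (by decide) (by decide) (by decide))
    (disjoint₃_cells (by decide) (by decide) (by decide)) (Chain.filling_mem hF hx)
    (Chain.filling_mem hF hx) (Chain.filling_mem hF hx) (Chain.filling_mem hF hx)
    (Chain.d_filling hF hx) (midPath_mem S hF hy) (d_midPath S hF y) (d_iT S hF _ z)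
    (υ := midPath S hF yu (by decide) (by decide) y)
    (bL := fillL S hF x) (bM := fillT S hF x) (bR := fillR S hF x)
  have e2 := Chain.ev₂_mover (S := S) lower_disjoint (lower_mem S hF hx) (Chain.loop_mem hF hx)
    (cN := Chain.loopT S hF x) (bN := fillT S hF x)
    (cell_subset le_rfl le_rfl (by decide)) (cell_subset le_rfl le_rfl (by decide))
    (fits_cells (by decide) (by decide) (by decide))
    (fits_cells (by decide) (by decide) (by decide))
    (fits_cells (by decide) (by decide) (by decide))
    (fits_cells (by decide) (by decide) (by decide))
    (disjoint₃_cells (by decide) (by decide) (by decide)) (Chain.filling_mem hF hx)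
    (Chain.filling_mem hF hx) (Chain.filling_mem hF hx) (Chain.filling_mem hF hx)
    (Chain.d_filling hF hx) (midPath_mem S hF hy) (d_midPath S hF y) (d_iT S hF _ z)
    (υ := midPath S hF yd (by decide) (by decide) y)
    (bL := fillL S hF x) (bM := fillB S hF x) (bR := fillR S hF x)
  have e3 : Chain.loopL S hF x + Chain.loopB S hF x + Chain.loopT S hF x + Chain.loopR S hF x =
      Chain.ring S hF 3 4 (by decide) x - Chain.ring S hF 1 2 (by decide) x := by
    rw [← Chain.loop_sum]
    abel
  rw [Chain.loop_sum, map_sub, LinearMap.sub_apply, LinearMap.sub_apply] at e1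
  rw [e3, map_sub, LinearMap.sub_apply, LinearMap.sub_apply] at e2
  have key : ∀ (s : K) (a a' b b' t₁ t₂ t₃ t₄ t₅ t₆ : F.HR),
      s • (a - b) - (t₁ + t₂ + t₃) + (t₄ + t₅ + t₆)
        - (s • (a' - b') - (t₁ + t₃ + t₂) + (t₅ + t₄ + t₆)) = s • ((a - a') - (b - b')) := by
    intro s a a' b b' t₁ t₂ t₃ t₄ t₅ t₆
    simp only [smul_sub]
    abel
  rw [← ev₃_outer_midRing S hF c hx hy, ← ev₃_inner_midRing S hF c hx hy]
  exact (congrArg₂ (· - ·) e1 e2).trans (key _ _ _ _ _ _ _ _ _ _ _)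

/-- The homotopies in the two halves make the representative of the bracket of `x` and `y` turn
around `z`. -/
theorem L_L (hx : x ∈ F.HR.gr j) (hy : y ∈ F.HR.gr k) (z : F.HR) :
    sgn K (j - 1) • (L S hF c x (L S hF c y z)
      - sgn K ((j - 1) * (k - 1)) • L S hF c y (L S hF c x z)) = L S hF c (L S hF c x y) z := by
  -- The two homotopies may differ from the canonical paths of the class by classes. They enter by
  -- the product with some `C` that does not depend on `z`, and the case `z = 1` shows that it is
  -- zero.
  obtain ⟨C, hC⟩ : ∃ C, ∀ z, sgn K (j - 1) • (L S hF c x (L S hF c y z)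
      - sgn K ((j - 1) * (k - 1)) • L S hF c y (L S hF c x z)) =
        L S hF c (L S hF c x y) z + prod S hF C z := by
    refine ⟨pT S _ (upperMover S hF j x y) - pT S _ (lowerMover S hF j x y), fun z => ?_⟩
    rw [← ev₂_mover_sub hF c hx hy, ev₂_homotopy_sub S hF _ _ _ _ upper_disjoint lower_disjoint
      (bracketL_mem S hF hx hy) (bracketR_mem S hF hx hy) (upperMover_mem hF hx hy)
      (lowerMover_mem hF hx hy) (d_bracketL S hF hx y) (d_bracketR S hF hx y) (d_upperMover hF hx)
      (d_lowerMover hF hx) (d_iT S hF _ z), pT_bracketL S hF c hx hy, pT_iT]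
    congr 1
    have := Chain.ev₂_arcPath_add (S := S) hF c (L_mem S hF c hx hy) z (k := 1) (l := 4)
      (hkl := by decide) (u := upper) (d := lower) (n := left) (n' := right) (hn := by decide)
      (hn' := by decide) (hd := by decide) (hd' := by decide) (by decide) (by decide) (by decide)
      (by decide) (zero_mem_core 1 (by decide)) (fun s => cell_disjoint_core s le_rfl)
    rwa [Chain.arcPath, Chain.arcPath, Chain.ev₂_of S upper_disjoint,
      Chain.ev₂_of S lower_disjoint] at this
  have h1 := hC (one S)
  rw [L_one, L_one, L_one, map_zero, map_zero, smul_zero, sub_zero, smul_zero, zero_add,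
    prod_one] at h1
  rw [hC, ← h1, map_zero, LinearMap.zero_apply, add_zero]

end PFA
end Prefact

/-! ### Independence of normalized retracts -/

namespace Prefact

/-- The projection of a normalized retract sends a cocycle to its class. -/
theorem DGSpace.Retract.IsNormalized.p_eq_cls {K : Type u} [Field K] {V : DGSpace.{u, v} K}
    {R : V.Retract} (hR : R.IsNormalized) {z : V} (hz : V.d z = 0) : R.p z = V.cls ⟨z, hz⟩ := by
  rw [← hR (R.p z)]
  refine (Submodule.Quotient.eq _).2 ⟨R.h z, ?_⟩
  have h1 := R.d_h z
  rwa [hz, map_zero, add_zero] at h1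

namespace PFA

variable {K : Type u} [Field K] {F : PFA.{u, v} K}

section Normalized

variable {S S' : F.Retracts} (hF : F.IsLocallyConstant)

theorem p_eq_of_isNormalized (hS : (S Disk.whole).IsNormalized)
    (hS' : (S' Disk.whole).IsNormalized)
    {ξ : F.obj Disk.whole} (hξ : (F.obj Disk.whole).d ξ = 0) :
    (S Disk.whole).p ξ = (S' Disk.whole).p ξ := by
  rw [hS.p_eq_cls hξ, hS'.p_eq_cls hξ]

theorem pT_eq_of_isNormalized (hS : (S Disk.whole).IsNormalized)
    (hS' : (S' Disk.whole).IsNormalized)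
    {D : Disk} {ξ : F.obj D} (hξ : (F.obj D).d ξ = 0) :
    pT S D ξ = pT S' D ξ :=
  p_eq_of_isNormalized hS hS' ((F.incl_d _ _ _ ξ).symm.trans (by rw [hξ, map_zero]))

/-- The classes that measure the difference of the primitives `η` of two choices of retracts are
additive. -/
theorem pT_eta_of_isNormalized (hS : (S Disk.whole).IsNormalized)
    (hS' : (S' Disk.whole).IsNormalized)
    {A U T : Disk} (h : (A : Set Plane) ⊆ U) (h' : (U : Set Plane) ⊆ T)
    (x : F.HR) : pT S U (eta S' hF A U h x) =
      pT S T (eta S' hF A T (h.trans h') x) - pT S T (eta S' hF U T h' x) := by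
  have h1 := pT_eq_of_isNormalized hS hS' (d_eta_sub S' hF A U T h h' x)
  rw [pT_eta_sub, map_sub, map_sub, pT_incl, sub_eq_zero] at h1
  exact h1.symm

theorem pT_path_of_isNormalized (hS : (S Disk.whole).IsNormalized)
    (hS' : (S' Disk.whole).IsNormalized)
    {A A' U : Disk} (h : (A : Set Plane) ⊆ U)
    (h' : (A' : Set Plane) ⊆ U) (x : F.HR) : pT S U (path S' hF U A A' h h' x) =
      pT S Disk.whole
        (path S' hF Disk.whole A A' (Disk.subset_whole A) (Disk.subset_whole A') x) := by
  rw [path_apply, path_apply, map_sub, map_sub,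
    pT_eta_of_isNormalized hF hS hS' h (Disk.subset_whole U),
    pT_eta_of_isNormalized hF hS hS' h' (Disk.subset_whole U), sub_sub_sub_cancel_right]

/-- The bracket does not depend on the choice of normalized retracts. -/
theorem L_eq_of_isNormalized (hS : (S Disk.whole).IsNormalized)
    (hS' : (S' Disk.whole).IsNormalized)
    (c : AnnularConfiguration) : L S hF c = L S' hF c := by
  refine F.HR.hom_ext fun j x hx => LinearMap.ext fun y => ?_
  set ζ := iT S' hF c.Dt y with hζ_def
  have hζ : (F.obj c.Dt).d ζ = 0 := d_iT S' hF _ y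
  have hζ' : pT S c.Dt ζ = y := by rw [pT_eq_of_isNormalized hS hS' hζ, pT_iT]
  set g := path S' hF c.Du c.D₁ c.D₂ c.sub₁u c.sub₂u x with hg_def
  set g' := path S' hF c.Dd c.D₁ c.D₂ c.sub₁d c.sub₂d x with hg_def'
  have hg : g ∈ (F.obj c.Du).gr (j - 1) := path_mem S' hF _ _ _ _ _ hx
  have hg' : g' ∈ (F.obj c.Dd).gr (j - 1) := path_mem S' hF _ _ _ _ _ hx
  have hneg : path S' hF c.Dd c.D₂ c.D₁ c.sub₂d c.sub₁d x = -g' := by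
    rw [hg_def', path_apply, path_apply, neg_sub]
  -- The two paths of `S'` deviate from those of `S` by the same class.
  have hgg' : pT S c.Du g = pT S c.Dd g' :=
    (pT_path_of_isNormalized hF hS hS' _ _ x).trans (pT_path_of_isNormalized hF hS hS' _ _ x).symm
  have hx' : pT S c.D₁ (iT S' hF c.D₁ x) = x := by
    rw [pT_eq_of_isNormalized hS hS' (d_iT S' hF _ x), pT_iT]
  -- The two terms together are a cocycle in the plane, where both projections give its class.
  have h1 : ev₂ S' c.Du c.Dt c.disjoint_u g ζ - ev₂ S' c.Dd c.Dt c.disjoint_d g' ζ =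
      ev₂ S c.Du c.Dt c.disjoint_u g ζ - ev₂ S c.Dd c.Dt c.disjoint_d g' ζ := by
    rw [ev₂_apply, ev₂_apply, ev₂_apply, ev₂_apply, ← map_sub, ← map_sub]
    have f : ∀ A : Disk, (A : Set Plane) ⊆ c.Du →
        Disk.Fits ![A, c.Dt] Disk.whole := fun A hA =>
      Disk.fits_two (Disk.subset_whole _) (Disk.subset_whole _) (c.disjoint_u.mono_left hA)
    refine (p_eq_of_isNormalized hS hS' ?_).symm
    rw [map_sub, d_op₂ _ _ _ _ hg, d_op₂ _ _ _ _ hg', hζ, map_zero, map_zero, smul_zero, add_zero,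
      add_zero, d_path, d_path, map_sub, map_sub, LinearMap.sub_apply, LinearMap.sub_apply,
      F.op₂_incl_left _ _ _ _ _ _ (f c.D₁ c.sub₁u), F.op₂_incl_left _ _ _ _ _ _ (f c.D₂ c.sub₂u),
      F.op₂_incl_left _ _ _ _ _ _ (f c.D₁ c.sub₁u), F.op₂_incl_left _ _ _ _ _ _ (f c.D₂ c.sub₂u),
      sub_self]
  rw [L_apply S', hneg, map_neg, LinearMap.neg_apply, ← sub_eq_add_neg, h1,
    ev₂_homotopy_sub S hF c.sub₁u c.sub₂u c.sub₁d c.sub₂d c.disjoint_u c.disjoint_d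
      (iT_mem S' hF _ hx) (iT_mem S' hF _ hx) hg hg' (d_iT S' hF _ x) (d_iT S' hF _ x)
      (d_path S' hF _ _ _ _ _ x) (d_path S' hF _ _ _ _ _ x) hζ, hx',
    hgg', sub_self, map_zero,
    LinearMap.zero_apply, add_zero]
  have hm : Chain.of c.Du (path S hF c.Du c.D₁ c.D₂ c.sub₁u c.sub₂u x)
      + Chain.of c.Dd (path S hF c.Dd c.D₂ c.D₁ c.sub₂d c.sub₁d x) ∈
        Chain.chains (fun U => Disjoint (U : Set Plane) c.Dt) (j - 1) :=
    Submodule.add_mem _ (Chain.of_mem c.disjoint_u (path_mem S hF _ _ _ _ _ hx))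
      (Chain.of_mem c.disjoint_d (path_mem S hF _ _ _ _ _ hx))
  -- The representative `ζ` that belongs to `S'` may be replaced by the one that belongs to `S`.
  have h2 := Chain.ev₂_of_closed (S := S) hF hm (fun e => ?_) hζ
  · rw [map_add, LinearMap.add_apply, LinearMap.add_apply, Chain.ev₂_of S c.disjoint_u,
      Chain.ev₂_of S c.disjoint_d, Chain.ev₂_of S c.disjoint_u, Chain.ev₂_of S c.disjoint_d,
      hζ'] at h2
    rw [L_apply, h2]
  · rw [map_add, Chain.bdry_of, Chain.bdry_of, map_add, LinearMap.add_apply,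
      Chain.ev₂_of S c.disjoint_u, Chain.ev₂_of S c.disjoint_d, d_path, d_path, map_sub, map_sub,
      LinearMap.sub_apply, LinearMap.sub_apply,
      ev₂_incl_left S _ _ _ c.sub₁u _ (c.disjoint_u.mono_left c.sub₁u),
      ev₂_incl_left S _ _ _ c.sub₂u _ (c.disjoint_u.mono_left c.sub₂u),
      ev₂_incl_left S _ _ _ c.sub₁d _ (c.disjoint_u.mono_left c.sub₁u),
      ev₂_incl_left S _ _ _ c.sub₂d _ (c.disjoint_u.mono_left c.sub₂u)]
    abel

end Normalized

/-! ### The Poisson algebra -/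

variable (S : F.Retracts) (hF : F.IsLocallyConstant) (c : AnnularConfiguration)

/-- The cyclic form of the Jacobi identity. -/
theorem L_jacobi {j k l : ℤ} {x y z : F.HR} (hx : x ∈ F.HR.gr j) (hy : y ∈ F.HR.gr k)
    (hz : z ∈ F.HR.gr l) :
    sgn K j • L S hF c x (L S hF c y z)
      + sgn K (l * (j + k) + l) • L S hF c z (L S hF c x y)
      + sgn K (j * (k + l) + k) • L S hF c y (L S hF c z x) = 0 := by
  have e1 : sgn K (l * (j + k) + l) * sgn K ((j + k - 1) * l) = 1 := by
    rw [← sgn_add, sgn_eq_sgn (b := 0) (l * (j + k)) (by ring), sgn_zero]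
  have e2 : sgn K (j * (k + l) + k) * sgn K (j * l) = sgn K (j * k + k) := by
    rw [← sgn_add]
    exact sgn_eq_sgn (j * l) (by ring)
  have e3 : sgn K (j - 1) * sgn K ((j - 1) * (k - 1)) = sgn K (j * k + k) := by
    rw [← sgn_add]
    exact sgn_eq_sgn (-k) (by ring)
  rw [L_symm S hF c (L_mem S hF c hx hy) hz, L_symm S hF c hx hz, map_smul, smul_smul, smul_smul,
    e1, e2, one_smul, ← L_L hF c hx hy z, smul_sub, smul_smul, e3, sgn_sub, sgn_one, mul_neg_one,
    neg_smul]
  abel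

theorem isP₂Algebra (A B : Disk) (h : Disjoint (A : Set Plane) B) :
    IsP₂Algebra F.HR.gr (mul S hF A B h) (one S) (L S hF c) := by
  rw [mul_eq_prod]
  exact
    { isInternal := F.HR.isInternal
      mul_mem := prod_mem S hF
      one_mem := one_mem S
      mul_assoc := prod_assoc S hF
      one_mul := one_prod S hF
      mul_one := prod_one S hF
      mul_comm := fun hx hy => by
        rw [negOnePow_smul (K := K)]
        exact prod_comm S hF hx hy
      bracket_mem := L_mem S hF c
      bracket_symm := fun {j k _ _} hx hy => by
        rw [negOnePow_smul (K := K), L_symm S hF c hx hy, smul_smul, sgn_mul_self, one_smul]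
      bracket_mul := fun {j k _ x y z} hx hy _ => by
        rw [negOnePow_smul (K := K), L_prod S hF c hx hy,
          sgn_eq_sgn (a := (j - 1) * k) (b := j * k + k) (-k) (by ring)]
      jacobi := fun hx hy hz => by
        rw [negOnePow_smul (K := K), negOnePow_smul (K := K), negOnePow_smul (K := K)]
        exact L_jacobi S hF c hx hy hz }

end PFA
end Prefact

theorem theorem3p9 {K : Type u} [Field K] [CharZero K] (F : Prefact.PFA.{u, v} K)
    (hF : F.IsLocallyConstant) (S : F.Retracts) :
    (∀ (A B : Prefact.Disk) (h : Disjoint A.carrier B.carrier) (c : Prefact.AnnularConfiguration),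
      Prefact.IsP₂Algebra F.HR.gr (Prefact.PFA.mul S hF A B h) (Prefact.PFA.one S)
        (Prefact.PFA.L S hF c)) ∧
    (∀ (A B A' B' : Prefact.Disk) (h : Disjoint A.carrier B.carrier)
      (h' : Disjoint A'.carrier B'.carrier),
      Prefact.PFA.mul S hF A B h = Prefact.PFA.mul S hF A' B' h') ∧
    (∀ c c' : Prefact.AnnularConfiguration, Prefact.PFA.L S hF c = Prefact.PFA.L S hF c') ∧
    (∀ S' : F.Retracts, (∀ D, (S D).IsNormalized) → (∀ D, (S' D).IsNormalized) →
      ∀ c : Prefact.AnnularConfiguration, Prefact.PFA.L S hF c = Prefact.PFA.L S' hF c) :=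
  ⟨fun A B h c => Prefact.PFA.isP₂Algebra S hF c A B h, Prefact.PFA.mul_eq_mul S hF,
    Prefact.PFA.L_eq_L S hF,
    fun _ hS hS' c => Prefact.PFA.L_eq_of_isNormalized hF (hS _) (hS' _) c⟩
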